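/- Let $C\subset\mathbb P^2_{\mathbb C}$ be an irreducible plane quintic (the zero locus of an irreducible form of degree $5$ in three variables) all of whose singular points are of type $A_l$ ($l\ge 1$, normal form $y^2+x^{l+1}=0$) or $D_k$ ($k\ge 4$, normal form $x^2y+y^{k-1}=0$). Let $m_l$, respectively $n_k$, be the number of singular points of $C$ of type $A_l$, respectively $D_k$, and write $\sum_l m_lA_l+\sum_k n_kD_k$ for this combination of singularities. Let $g$ be the geometric genus of $C$, i.e. the genus of its normalization, and let $\mu_{tot}(C)=\sum_l l\,m_l+\sum_k k\,n_k$ be the total Milnor number. If $\mu_{tot}(C)\le 5$, then $g\ge 1$, and $g=1$ if and only if $\sum_l m_lA_l+\sum_k n_kD_k=5A_1$, that is, $C$ has exactly five singular points and all of them are nodes. -/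

import Mathlib

open scoped LinearAlgebra.Projectivization

noncomputable section

/-! ## Irreducible projective plane curves over the complex numbers -/

/-- An irreducible (and reduced) plane curve of degree `d` in the complex projective plane:
the zero scheme of an irreducible form of degree `d` in three variables. -/
structure IrredPlaneCurve (d : ℕ) where
  /-- the equation of the curve -/
  form : MvPolynomial (Fin 3) ℂ
  isHomogeneous : form.IsHomogeneous d
  irreducible : Irreducible form

/-! ## The genus of a function field in one variable -/

section Genus

variable (k K : Type*) [Field k] [Field K] [Algebra k K]

/-- The places of `K / k`: the valuation rings of `K` that contain `k`, other than `K` itself.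
For a function field in one variable over an algebraically closed field `k`, these are the local
rings of the closed points of the smooth projective curve with function field `K`, each occurring
exactly once. -/
def Place : Type _ :=
  {v : ValuationSubring K // (∀ c : k, algebraMap k K c ∈ v) ∧ v ≠ ⊤}

/-- Repartitions (Weil): families of elements of `K`, indexed by the places, that are integral at
all but finitely many places. -/
def repartitions : Submodule k (Place k K → K) where
  carrier := {r | {v : Place k K | r v ∉ v.1}.Finite}
  zero_mem' := by
    have h : {v : Place k K | (0 : Place k K → K) v ∉ v.1} = ∅ := by
      ext v; simp [zero_mem]
    simp only [Set.mem_ofPred_eq, h, Set.finite_empty]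
  add_mem' := by
    intro a b ha hb
    refine (Set.Finite.union ha hb).subset ?_
    intro v hv
    by_contra hc
    simp only [Set.mem_union, Set.mem_ofPred_eq, not_or, not_not] at hc
    exact hv (add_mem hc.1 hc.2)
  smul_mem' := by
    intro c a ha
    refine Set.Finite.subset ha ?_
    intro v hv hc
    refine hv ?_
    change c • a v ∈ v.1
    rw [Algebra.smul_def]
    exact mul_mem (v.2.1 c) hc

/-- The repartitions that are integral at every place. -/
def integralRepartitions : Submodule k (Place k K → K) where
  carrier := {r | ∀ v : Place k K, r v ∈ v.1}
  zero_mem' := fun v => zero_mem v.1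
  add_mem' := fun ha hb v => add_mem (ha v) (hb v)
  smul_mem' := by
    intro c a ha v
    change c • a v ∈ v.1
    rw [Algebra.smul_def]
    exact mul_mem (v.2.1 c) (ha v)

/-- The principal repartitions: the constant families given by the elements of `K`. -/
def principalRepartitions : Submodule k (Place k K → K) :=
  LinearMap.range (LinearMap.pi fun _ : Place k K => (LinearMap.id : K →ₗ[k] K))

/-- The first cohomology `H¹(X, 𝒪_X)` of the smooth projective curve `X` with function field `K`,
as the cokernel of `K → ⨁_v K / 𝒪_v` coming from the flasque resolution
`0 → 𝒪_X → K → ⨁_v K / 𝒪_v → 0`; in terms of repartitions, it is the space of all repartitions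
modulo the sum of the integral and the principal ones. -/
abbrev H1StructureSheaf : Type _ :=
  repartitions k K ⧸
    (integralRepartitions k K ⊔ principalRepartitions k K).submoduleOf (repartitions k K)

/-- The genus of the function field `K / k`, i.e. the genus `dim H¹(X, 𝒪_X)` of the smooth
projective curve `X` with function field `K`. -/
def functionFieldGenus : ℕ := Module.finrank k (H1StructureSheaf k K)

end Genus

/-! ## Normal forms of the simple singularities of type A and D -/

/-- The singularity types `A_l` (`l ≥ 1`) and `D_k` (`k ≥ 4`). -/
inductive ADType : Type
  | A (l : ℕ) (hl : 1 ≤ l) : ADType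
  | D (k : ℕ) (hk : 4 ≤ k) : ADType

namespace ADType

/-- The Milnor number of a singularity of a given type (the index of its name). -/
def milnor : ADType → ℕ
  | A l _ => l
  | D k _ => k

open MvPowerSeries in
/-- The normal forms, in `ℂ⟦x, y⟧` with `x = X 0` and `y = X 1`:
`y² + x^(l+1)` for `A_l` and `x² y + y^(k-1)` for `D_k`. -/
def normalForm : ADType → MvPowerSeries (Fin 2) ℂ
  | A l _ => X 1 ^ 2 + X 0 ^ (l + 1)
  | D k _ => X 0 ^ 2 * X 1 + X 1 ^ (k - 1)

end ADType

/-- Contact equivalence of formal plane curve germs `f = 0` and `g = 0`: up to a unit, `f` becomes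
`g` after a formal change of coordinates, i.e. an automorphism of the `ℂ`-algebra `ℂ⟦x, y⟧`. -/
def GermEquiv (f g : MvPowerSeries (Fin 2) ℂ) : Prop :=
  ∃ φ : MvPowerSeries (Fin 2) ℂ ≃ₐ[ℂ] MvPowerSeries (Fin 2) ℂ, Associated (φ f) g

namespace IrredPlaneCurve

variable {d : ℕ} (C : IrredPlaneCurve d)

/-! ## Function field and geometric genus -/

/-- The homogeneous coordinate ring of the curve. -/
abbrev CoordRing : Type := MvPolynomial (Fin 3) ℂ ⧸ Ideal.span {C.form}

instance isDomain_coordRing : IsDomain C.CoordRing := by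
  have hp : Prime C.form := C.irreducible.prime
  have : (Ideal.span {C.form}).IsPrime :=
    (Ideal.span_singleton_prime hp.ne_zero).2 hp
  exact Ideal.Quotient.isDomain _

/-- The homogeneous coordinate `x_i`, in the fraction field of the homogeneous coordinate ring. -/
def coord (i : Fin 3) : FractionRing C.CoordRing :=
  algebraMap C.CoordRing _ (Ideal.Quotient.mk _ (MvPolynomial.X i))

/-- The field of rational functions on the curve: the subfield `ℂ(x_i / x_j : i, j)` of the
fraction field of the homogeneous coordinate ring. -/
def functionField : IntermediateField ℂ (FractionRing C.CoordRing) :=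
  IntermediateField.adjoin ℂ {z | ∃ i j : Fin 3, C.coord j ≠ 0 ∧ z = C.coord i / C.coord j}

/-- The geometric genus of the curve: the genus of its normalization, which is the smooth
projective curve with the same function field. -/
def geometricGenus : ℕ := functionFieldGenus ℂ C.functionField

/-! ## Singular points and their types -/

/-- The point `p` of the projective plane is a singular point of the curve. -/
def IsSingular (p : ℙ ℂ (Fin 3 → ℂ)) : Prop :=
  MvPolynomial.eval p.rep C.form = 0 ∧
    ∀ i, MvPolynomial.eval p.rep (MvPolynomial.pderiv i C.form) = 0

/-- The equation `F(v + x a + y b)` of the curve `F = 0` in the affine chart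
`(x, y) ↦ [v + x a + y b]` of the projective plane, which is centred at the point `[v]`
(for linearly independent `v, a, b`). -/
def localEquation (v a b : Fin 3 → ℂ) : MvPolynomial (Fin 2) ℂ :=
  MvPolynomial.aeval
    (fun i => MvPolynomial.C (v i) + MvPolynomial.C (a i) * MvPolynomial.X 0
      + MvPolynomial.C (b i) * MvPolynomial.X 1) C.form

/-- The curve has a singularity of type `t` at `p`: in affine coordinates centred at `p`, its
equation is formally contact equivalent to the normal form of `t`. (Another choice of affine
coordinates changes the local equation by a formal change of coordinates and a unit only.) -/
def HasSingularityAt (p : ℙ ℂ (Fin 3 → ℂ)) (t : ADType) : Prop :=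
  ∃ a b : Fin 3 → ℂ, LinearIndependent ℂ ![p.rep, a, b] ∧
    GermEquiv (C.localEquation p.rep a b : MvPowerSeries (Fin 2) ℂ) t.normalForm

/-- The curve has the combination of singularities `R = ∑ m_l A_l + ∑ n_k D_k`, written as a
finitely supported function on the types: every singular point is of one of the types `A_l`,
`D_k`, and there are exactly `R t` singular points of type `t`. -/
def HasSingularities (R : ADType →₀ ℕ) : Prop :=
  (∀ p, C.IsSingular p → ∃ t, C.HasSingularityAt p t) ∧
    ∀ t, {p | C.IsSingular p ∧ C.HasSingularityAt p t}.encard = R t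

end IrredPlaneCurve

/-- The total Milnor number `∑ l m_l + ∑ k n_k` of a combination `∑ m_l A_l + ∑ n_k D_k`. -/
def totalMilnor (R : ADType →₀ ℕ) : ℕ := R.sum fun t m => t.milnor * m

end

/-! The genus is 6, the arithmetic genus of a plane quintic, minus the colength δ of the coordinate
ring of a suitable affine chart in its normalization. Each singular point contributes at least 1 to
δ, and at most ⌊(l+1)/2⌋ for `A_l` and k - 1 for `D_k`. These upper bounds never exceed the Milnor
number and reach it only for `A_1`. Hence δ ≤ μ_tot ≤ 5, which gives g ≥ 1. If g = 1, then δ = 5,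
equality holds throughout, and the singularities are five nodes. Conversely, five singular points
give δ ≥ 5. The exact δ-invariant of `D_k` is not needed.

Formula g + δ = 6. Coordinates are chosen so that [0:1:0] is off the curve and the line at infinity
is transversal to it (`exists_basis_separable`); all singular points are then affine, and y is
integral of degree 5 over ℂ[x]. Put R = ℂ[x, y], let S be its normalization and T the ring of
functions regular at the places over x = ∞. Strong approximation on the charts where x, respectively
1/x, is regular turns the repartition description of H¹ into K/(S + T)
(`functionFieldGenus_eq_finrank_quotient`). By transversality T is the localization of ℂ[1/x, y/x]
along the line at infinity (`integralAtInfinity_eq`). So K/(R + T) can be read off from Laurent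
tails in 1/x of the coordinates in the basis 1, y, …, y⁴ over ℂ(x), and has dimension 0+0+1+2+3 = 6.
Since S ∩ T = ℂ lies in R, replacing R by S lowers this dimension by dim S/R = δ
(`functionFieldGenus_add_finrank`).

Lower bound for δ. If S/R had no contribution at a singular point, R would be a discrete valuation
ring there, and one local coordinate would divide the other; differentiating this relation
contradicts the vanishing of the gradient (`smul_top_ne_top_of_pderiv_eq_zero`).

Upper bound for δ. The Tjurina ideal (f, f_x, f_y) lies in the conductor, by Dedekind's theorem on
the derivative of the minimal polynomial. For nonzero h in it, S/R ≅ hS/hR, and (hs)(hs') = h(hss')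
lies in hR; so δ is locally bounded by the dimension of a square-zero ideal of R/hR
(`finrank_quotient_smul_le_of_sq_eq_bot`). For `A_l`, h is approximately y and R/hR is locally a
quotient of ℂ[x]/(x^(l+1)). For `D_k`, h is approximately f_y + f_x/2; its quadratic part is not a
square, so a square-zero ideal lies in m², of dimension at most k - 1 (`localBound_A`,
`localBound_D`). Polynomials and formal normal forms are compared modulo powers of the maximal
ideals (`IsFormalChart`). -/

noncomputable section

/-! ## Places over a Dedekind domain -/

section DedekindPlaces

variable {K : Type*} [Field K] {D : Type*} [CommRing D] [Algebra D K]

/-- The centre on `D` of a valuation ring containing `D`. -/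
def placeCenter (v : ValuationSubring K) (hv : ∀ d : D, algebraMap D K d ∈ v) : Ideal D where
  carrier := {d | v.valuation (algebraMap D K d) < 1}
  zero_mem' := by simp
  add_mem' := by
    intro a b ha hb
    simp only [Set.mem_ofPred_eq, map_add] at *
    exact v.valuation.map_add_lt ha hb
  smul_mem' := by
    intro c a ha
    simp only [Set.mem_ofPred_eq, smul_eq_mul, map_mul] at *
    exact mul_lt_one_of_nonneg_of_lt_one_right ((v.valuation_le_one_iff _).2 (hv c)) zero_le ha

lemma mem_placeCenter {v : ValuationSubring K} {hv : ∀ d : D, algebraMap D K d ∈ v} {d : D} :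
    d ∈ placeCenter v hv ↔ v.valuation (algebraMap D K d) < 1 := Iff.rfl

lemma placeCenter_isPrime (v : ValuationSubring K) (hv : ∀ d : D, algebraMap D K d ∈ v) :
    (placeCenter v hv).IsPrime := by
  refine ⟨?_, ?_⟩
  · rw [Ideal.ne_top_iff_one, mem_placeCenter]
    simp
  · intro a b hab
    by_contra! h
    simp only [mem_placeCenter, not_lt, map_mul] at h hab
    exact absurd hab (not_lt.2 (one_le_mul h.1 h.2))

/-- A denominator outside the centre is a unit of `v`. In this form "z lies in the localization of
`D` at the centre" is used without constructing the localization. -/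
lemma mem_of_mul_mem_of_notMem_placeCenter {v : ValuationSubring K}
    {hv : ∀ d : D, algebraMap D K d ∈ v} {s e : D} (hs : s ∉ placeCenter v hv) {z : K}
    (hz : algebraMap D K s * z = algebraMap D K e) : z ∈ v := by
  rw [mem_placeCenter, not_lt] at hs
  have h1 : v.valuation (algebraMap D K s) = 1 :=
    le_antisymm ((v.valuation_le_one_iff _).2 (hv s)) hs
  have h2 := congrArg v.valuation hz
  rw [map_mul, h1, one_mul] at h2
  rw [← v.valuation_le_one_iff, h2]
  exact (v.valuation_le_one_iff _).2 (hv e)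

variable [IsDedekindDomain D] [IsFractionRing D K]

lemma placeCenter_ne_bot (v : ValuationSubring K) (hv : ∀ d : D, algebraMap D K d ∈ v)
    (htop : v ≠ ⊤) : placeCenter v hv ≠ ⊥ := by
  intro h
  refine htop (eq_top_iff.2 fun z _ => ?_)
  obtain ⟨a, b, hb, rfl⟩ := IsFractionRing.div_surjective (A := D) z
  have hb0 : algebraMap D K b ≠ 0 := by
    simpa using nonZeroDivisors.ne_zero hb
  refine mem_of_mul_mem_of_notMem_placeCenter (hv := hv) (s := b) (e := a) ?_ ?_
  · rw [h, Ideal.mem_bot]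
    exact nonZeroDivisors.ne_zero hb
  · field_simp

lemma Ideal.exists_span_singleton_eq_pow_mul {P : Ideal D} (hP : P.IsPrime)
    {d : D} (hd : d ≠ 0) : ∃ (n : ℕ) (J : Ideal D), ¬ J ≤ P ∧ Ideal.span {d} = P ^ n * J := by
  have h0 : Ideal.span {d} ≠ 0 := by simpa using hd
  obtain ⟨J, h, hJ⟩ := (FiniteMultiplicity.of_not_isUnit (a := P)
    (fun hu => hP.ne_top (Ideal.isUnit_iff.1 hu)) h0).exists_eq_pow_mul_and_not_dvd
  exact ⟨_, J, fun hle => hJ (Ideal.dvd_iff_le.2 hle), h⟩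

/-- Partial fractions. With (d) = Pⁿ J for the denominator d of f, write 1 = i + j with i in Pⁿ and
j in J. Then h = f j has the polar part of f at P and no pole at any other prime. -/
lemma exists_split_at_prime {P : Ideal D} (hP : P.IsPrime) (hP0 : P ≠ ⊥) (f : K) :
    ∃ h : K, (∃ s ∉ P, ∃ e, algebraMap D K s * (h - f) = algebraMap D K e) ∧
      ∀ Q : Ideal D, Q.IsPrime → Q ≠ P →
        ∃ s ∉ Q, ∃ e, algebraMap D K s * h = algebraMap D K e := by
  obtain ⟨a, d, hd, rfl⟩ := IsFractionRing.div_surjective (A := D) f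
  have hd0 : d ≠ 0 := nonZeroDivisors.ne_zero hd
  have hdK : algebraMap D K d ≠ 0 := by simpa using hd0
  obtain ⟨n, J, hJ, hdJ⟩ := Ideal.exists_span_singleton_eq_pow_mul hP hd0
  have hmax : P.IsMaximal := hP.isMaximal hP0
  have hco : IsCoprime (P ^ n) J := by
    apply IsCoprime.pow_left
    rw [Ideal.isCoprime_iff_sup_eq]
    exact hmax.1.2 _ (lt_of_le_of_ne le_sup_left fun h => hJ (h ▸ le_sup_right))
  obtain ⟨i, hi, j, hj, hij⟩ := Ideal.isCoprime_iff_exists.1 hco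
  obtain ⟨t, htJ, htP⟩ := Set.not_subset.1 hJ
  have hijK : algebraMap D K i + algebraMap D K j = 1 := by rw [← map_add, hij, map_one]
  refine ⟨algebraMap D K (a * j) / algebraMap D K d, ⟨t, htP, ?_⟩, ?_⟩
  · have : i * t ∈ Ideal.span {d} := hdJ ▸ Ideal.mul_mem_mul hi htJ
    obtain ⟨e, he⟩ := Ideal.mem_span_singleton'.1 this
    refine ⟨-(a * e), ?_⟩
    have he' := congrArg (algebraMap D K) he
    simp only [map_mul, map_neg] at he' ⊢
    field_simp
    linear_combination (algebraMap D K t * algebraMap D K a) * hijK + algebraMap D K a * he'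
  · intro Q hQ hQP
    have : ¬ P ≤ Q := fun h => hQP (hmax.eq_of_le hQ.ne_top h).symm
    obtain ⟨p, hp, hpQ⟩ := Set.not_subset.1 this
    refine ⟨p ^ n, fun h => hpQ (hQ.mem_of_pow_mem _ h), ?_⟩
    have : p ^ n * j ∈ Ideal.span {d} := hdJ ▸ Ideal.mul_mem_mul (Ideal.pow_mem_pow hp n) hj
    obtain ⟨e, he⟩ := Ideal.mem_span_singleton'.1 this
    refine ⟨a * e, ?_⟩
    have he' := congrArg (algebraMap D K) he
    simp only [map_mul, map_pow] at he' ⊢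
    field_simp
    linear_combination - algebraMap D K a * he'

/-- Both rings are the localization of `D` at the common centre P. For a/b in v the order of a at P
is at least that of b: otherwise an element outside P would have v-value below 1. Hence a/b has a
denominator outside P and lies in w. -/
lemma le_of_placeCenter_eq {v w : ValuationSubring K} {hv : ∀ d : D, algebraMap D K d ∈ v}
    {hw : ∀ d : D, algebraMap D K d ∈ w} (htop : v ≠ ⊤)
    (h : placeCenter v hv = placeCenter w hw) : v ≤ w := by
  intro z hz
  obtain ⟨a, b, hb, rfl⟩ := IsFractionRing.div_surjective (A := D) z
  have hb0 : b ≠ 0 := nonZeroDivisors.ne_zero hb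
  have hbK : algebraMap D K b ≠ 0 := by simpa using hb0
  by_cases ha0 : a = 0
  · simp [ha0, zero_mem]
  have haK : algebraMap D K a ≠ 0 := by simpa using ha0
  have hP : (placeCenter v hv).IsPrime := placeCenter_isPrime v hv
  have hP0 : placeCenter v hv ≠ ⊥ := placeCenter_ne_bot v hv htop
  have hPv : ∀ d, d ∈ placeCenter v hv ↔ v.valuation (algebraMap D K d) < 1 := fun d => Iff.rfl
  generalize placeCenter v hv = P at hP hP0 hPv h
  obtain ⟨m, A', hA', hA⟩ := Ideal.exists_span_singleton_eq_pow_mul hP ha0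
  obtain ⟨n, B', hB', hB⟩ := Ideal.exists_span_singleton_eq_pow_mul hP hb0
  rcases le_or_gt n m with hnm | hnm
  · obtain ⟨s, hs, hsP⟩ := Set.not_subset.1 hB'
    have h1 : a * s ∈ Ideal.span {b} := by
      rw [hB]
      refine Ideal.mul_mem_mul ?_ hs
      have : a ∈ P ^ m * A' := hA ▸ Ideal.mem_span_singleton_self a
      exact (Ideal.mul_le_inf.trans (inf_le_left.trans (Ideal.pow_le_pow_right hnm))) this
    obtain ⟨e, he⟩ := Ideal.mem_span_singleton'.1 h1
    have he' := congrArg (algebraMap D K) he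
    refine mem_of_mul_mem_of_notMem_placeCenter (hv := hw) (s := s) (e := e) (h ▸ hsP) ?_
    simp only [map_mul] at he'
    field_simp
    linear_combination - he'
  · exfalso
    obtain ⟨s, hs, hsP⟩ := Set.not_subset.1 hA'
    have h1 : b * s ∈ P * Ideal.span {a} := by
      rw [hA, ← mul_assoc, ← pow_succ']
      refine Ideal.mul_mem_mul ?_ hs
      have : b ∈ P ^ n * B' := hB ▸ Ideal.mem_span_singleton_self b
      exact (Ideal.mul_le_inf.trans (inf_le_left.trans (Ideal.pow_le_pow_right hnm))) this
    obtain ⟨p, hp, he⟩ := Ideal.mem_mul_span_singleton.1 h1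
    have he' := congrArg (algebraMap D K) he
    simp only [map_mul] at he'
    have h2 : v.valuation (algebraMap D K p) * v.valuation (algebraMap D K a / algebraMap D K b)
        = v.valuation (algebraMap D K s) := by
      rw [← map_mul]; congr 1; field_simp; linear_combination he'
    refine hsP ((hPv _).2 ?_)
    rw [← h2]
    exact mul_lt_one_of_nonneg_of_lt_one_left zero_le ((hPv _).1 hp) ((v.valuation_le_one_iff _).2 hz)

lemma eq_of_placeCenter_eq {v w : ValuationSubring K} {hv : ∀ d : D, algebraMap D K d ∈ v}
    {hw : ∀ d : D, algebraMap D K d ∈ w} (hvtop : v ≠ ⊤) (hwtop : w ≠ ⊤)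
    (h : placeCenter v hv = placeCenter w hw) : v = w :=
  le_antisymm (le_of_placeCenter_eq hvtop h) (le_of_placeCenter_eq hwtop h.symm)

variable (D) {k : Type*} [Field k] [Algebra k K]

/-- The centre of a pole of a/d contains d, so it divides (d). Only finitely many ideals do, and the
centre determines the place. -/
lemma finite_poles (f : K) :
    {v : Place k K | (∀ d : D, algebraMap D K d ∈ v.1) ∧ f ∉ v.1}.Finite := by
  obtain ⟨a, d, hd, rfl⟩ := IsFractionRing.div_surjective (A := D) f
  have hd0 : d ≠ 0 := nonZeroDivisors.ne_zero hd
  have hdK : algebraMap D K d ≠ 0 := by simpa using hd0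
  have hfin : {P : Ideal D | P ∣ Ideal.span {d}}.Finite := by
    have := UniqueFactorizationMonoid.fintypeSubtypeDvd (Ideal.span {d}) (by simpa using hd0)
    exact Set.finite_coe_iff.1 (Finite.of_fintype {P : Ideal D // P ∣ Ideal.span {d}})
  classical
  refine Set.Finite.of_finite_image (f := fun v : Place k K =>
    if hv : ∀ d : D, algebraMap D K d ∈ v.1 then placeCenter v.1 hv else ⊤) ?_ ?_
  · refine hfin.subset ?_
    rintro _ ⟨v, ⟨hv, hf⟩, rfl⟩
    simp only [hv, implies_true, dite_true, Set.mem_ofPred_eq, Ideal.dvd_span_singleton]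
    by_contra hc
    refine hf (mem_of_mul_mem_of_notMem_placeCenter hc (e := a) ?_)
    field_simp
  · rintro v ⟨hv, -⟩ w ⟨hw, -⟩ h
    simp only [hv, hw, implies_true, dite_true] at h
    exact Subtype.ext (eq_of_placeCenter_eq v.2.2 w.2.2 h)

/-- Strong approximation on the affine curve with ring `D`: the sum, over the finitely many poles in
the chart, of functions carrying one local polar part each. -/
lemma exists_approximation (r : Place k K → K) (hr : {v : Place k K | r v ∉ v.1}.Finite) :
    ∃ h : K, ∀ v : Place k K, (∀ d : D, algebraMap D K d ∈ v.1) → h - r v ∈ v.1 := by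
  classical
  have key : ∀ v : Place k K, ∃ h : K, (∀ d : D, algebraMap D K d ∈ v.1) →
      h - r v ∈ v.1 ∧ ∀ w : Place k K, w ≠ v → (∀ d : D, algebraMap D K d ∈ w.1) → h ∈ w.1 := by
    intro v
    by_cases hv : ∀ d : D, algebraMap D K d ∈ v.1
    · obtain ⟨h, ⟨s, hs, e, he⟩, h2⟩ := exists_split_at_prime (placeCenter_isPrime v.1 hv)
        (placeCenter_ne_bot v.1 hv v.2.2) (r v)
      refine ⟨h, fun _ => ⟨mem_of_mul_mem_of_notMem_placeCenter hs he, fun w hwv hw => ?_⟩⟩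
      obtain ⟨s, hs, e, he⟩ := h2 _ (placeCenter_isPrime w.1 hw) fun h =>
        hwv (Subtype.ext (eq_of_placeCenter_eq w.2.2 v.2.2 h))
      exact mem_of_mul_mem_of_notMem_placeCenter hs he
    · exact ⟨0, fun h => absurd h hv⟩
  choose h hh using key
  set B := hr.toFinset.filter (fun v => ∀ d : D, algebraMap D K d ∈ v.1) with hB
  refine ⟨∑ v ∈ B, h v, fun v hv => ?_⟩
  by_cases hvB : v ∈ B
  · rw [← Finset.add_sum_erase _ _ hvB, add_sub_right_comm]
    refine add_mem (hh v hv).1 (sum_mem fun w hw => ?_)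
    have hw' := Finset.mem_erase.1 hw
    exact (hh w (Finset.mem_filter.1 hw'.2).2).2 v hw'.1.symm hv
  · have hrv : r v ∈ v.1 := by
      by_contra hc
      exact hvB (by simp only [hB, Finset.mem_filter, Set.Finite.mem_toFinset]; exact ⟨hc, hv⟩)
    refine sub_mem (sum_mem fun w hw => ?_) hrv
    exact (hh w (Finset.mem_filter.1 hw).2).2 v (fun h => hvB (h ▸ hw)) hv

end DedekindPlaces

/-! ## The first cohomology of the structure sheaf from two affine charts -/

section TwoCharts

variable {k K : Type*} [Field k] [Field K] [Algebra k K]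

/-- The functions that are integral at all places that do not contain `D`. -/
def integralAtInfinity (D : Subalgebra k K) : Submodule k K where
  carrier := {z | ∀ v : Place k K, (¬ ∀ d : D, (d : K) ∈ v.1) → z ∈ v.1}
  zero_mem' := fun v _ => zero_mem v.1
  add_mem' := fun ha hb v hv => add_mem (ha v hv) (hb v hv)
  smul_mem' := by
    intro c a ha v hv
    rw [Algebra.smul_def]
    exact mul_mem (v.2.1 c) (ha v hv)

lemma mem_integralAtInfinity {D : Subalgebra k K} {z : K} : z ∈ integralAtInfinity D ↔
    ∀ v : Place k K, (¬ ∀ d : D, (d : K) ∈ v.1) → z ∈ v.1 := Iff.rfl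

open Classical in
/-- The repartition that is `f` at the places not containing `D`, and zero elsewhere. -/
def repartitionAtInfinity (D : Subalgebra k K) (f : K) : Place k K → K :=
  fun v => if ∀ d : D, (d : K) ∈ v.1 then 0 else f

lemma repartitionAtInfinity_mem (D₀ D₁ : Subalgebra k K) [IsDedekindDomain D₁]
    [IsFractionRing D₁ K]
    (hcov : ∀ v : Place k K, (∀ d : D₀, (d : K) ∈ v.1) ∨ ∀ d : D₁, (d : K) ∈ v.1) (f : K) : repartitionAtInfinity D₀ f ∈ repartitions k K := by
  refine (finite_poles (k := k) D₁ f).subset ?_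
  intro v hv
  change repartitionAtInfinity D₀ f v ∉ v.1 at hv
  rw [repartitionAtInfinity] at hv
  split_ifs at hv with h
  · exact absurd (zero_mem v.1) hv
  · exact ⟨(hcov v).resolve_left h, hv⟩

/-- Mayer–Vietoris for two affine charts. Extending f by zero from the places off the first chart to
all places maps K to H¹. The kernel is found by splitting f as h + (f - h), with h regular on the
first chart; `hD₀` places this h in `D₀`. The map is onto because every repartition can be made
integral on the first chart by a principal one, and what remains is approximated on the second
chart. -/
theorem functionFieldGenus_eq_finrank_quotient (D₀ D₁ : Subalgebra k K)
    [IsDedekindDomain D₀] [IsDedekindDomain D₁] [IsFractionRing D₀ K] [IsFractionRing D₁ K]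
    (hcov : ∀ v : Place k K, (∀ d : D₀, (d : K) ∈ v.1) ∨ ∀ d : D₁, (d : K) ∈ v.1)
    (hD₀ : ∀ z : K, (∀ v : Place k K, (∀ d : D₀, (d : K) ∈ v.1) → z ∈ v.1) → z ∈ D₀) : functionFieldGenus k K =
    Module.finrank k (K ⧸ (Subalgebra.toSubmodule D₀ ⊔ integralAtInfinity D₀)) := by
  classical
  let L : K →ₗ[k] repartitions k K :=
    { toFun := fun f => ⟨repartitionAtInfinity D₀ f, repartitionAtInfinity_mem D₀ D₁ hcov f⟩
      map_add' := by
        intro a b; ext v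
        change repartitionAtInfinity D₀ _ v =
          repartitionAtInfinity D₀ _ v + repartitionAtInfinity D₀ _ v
        simp only [repartitionAtInfinity]; split_ifs <;> simp
      map_smul' := by
        intro a b; ext v
        change repartitionAtInfinity D₀ _ v = a • repartitionAtInfinity D₀ _ v
        simp only [repartitionAtInfinity]; split_ifs <;> simp }
  set N := (integralRepartitions k K ⊔ principalRepartitions k K).submoduleOf (repartitions k K)
  let Λ : K →ₗ[k] H1StructureSheaf k K := N.mkQ ∘ₗ L
  have hL : ∀ f, ((L f : repartitions k K) : Place k K → K) = repartitionAtInfinity D₀ f :=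
    fun f => rfl
  have hmemN : ∀ r : repartitions k K, r ∈ N ↔ ∃ h : K, ∀ v : Place k K, r.1 v - h ∈ v.1 := by
    intro r
    change r.1 ∈ integralRepartitions k K ⊔ principalRepartitions k K ↔ _
    rw [Submodule.mem_sup]
    constructor
    · rintro ⟨a, ha, b, ⟨h, rfl⟩, hab⟩
      refine ⟨h, fun v => ?_⟩
      rw [← hab]
      simpa using ha v
    · rintro ⟨h, hh⟩
      exact ⟨fun v => r.1 v - h, hh, fun _ => h, ⟨h, rfl⟩, by ext v; simp⟩
  have hker : LinearMap.ker Λ = Subalgebra.toSubmodule D₀ ⊔ integralAtInfinity D₀ := by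
    ext f
    rw [LinearMap.mem_ker]
    change Submodule.Quotient.mk (L f) = 0 ↔ _
    rw [Submodule.Quotient.mk_eq_zero, hmemN, Submodule.mem_sup]
    simp only [hL, repartitionAtInfinity]
    constructor
    · rintro ⟨h, hh⟩
      refine ⟨h, hD₀ h fun v hv => ?_, f - h, fun v hv => ?_, by ring⟩
      · have := hh v
        rw [if_pos hv, zero_sub] at this
        simpa using neg_mem this
      · have := hh v
        rwa [if_neg hv] at this
    · rintro ⟨a, ha, b, hb, rfl⟩
      refine ⟨a, fun v => ?_⟩
      split_ifs with hv
      · rw [zero_sub]; exact neg_mem (hv ⟨a, ha⟩)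
      · rw [add_sub_cancel_left]; exact hb v hv
  have hsurj : Function.Surjective Λ := by
    intro q
    obtain ⟨r, rfl⟩ := Submodule.Quotient.mk_surjective N q
    obtain ⟨h, hh⟩ := exists_approximation (k := k) D₀ r.1 r.2
    -- `repartitionAtInfinity D₀ 1` serves as the indicator function of the places off the first
    -- chart. All of these lie in the second chart, so h has finitely many poles among them.
    have hfin : {v : Place k K | (repartitionAtInfinity D₀ 1 v * (r.1 v - h)) ∉ v.1}.Finite := by
      refine (Set.Finite.union r.2 (finite_poles (k := k) D₁ h)).subset ?_
      intro v hv
      simp only [Set.mem_ofPred_eq, repartitionAtInfinity] at hv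
      split_ifs at hv with hvD
      · simp [zero_mem] at hv
      · by_contra hc
        simp only [Set.mem_union, not_or] at hc
        refine hv ?_
        rw [one_mul]
        refine sub_mem (not_not.1 hc.1) ?_
        by_contra hc2
        exact hc.2 ⟨(hcov v).resolve_left hvD, hc2⟩
    obtain ⟨f, hf⟩ := exists_approximation (k := k) D₁ _ hfin
    refine ⟨f, ?_⟩
    change Submodule.Quotient.mk (L f) = Submodule.Quotient.mk r
    rw [Submodule.Quotient.eq, hmemN]
    refine ⟨-h, fun v => ?_⟩
    change repartitionAtInfinity D₀ f v - r.1 v - -h ∈ v.1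
    simp only [repartitionAtInfinity] at hf ⊢
    split_ifs with hv
    · convert hh v hv using 1; ring
    · convert hf v ((hcov v).resolve_left hv) using 1
      rw [if_neg hv]; ring
  rw [functionFieldGenus, ← hker]
  exact (Λ.quotKerEquivOfSurjective hsurj).finrank_eq.symm

end TwoCharts

end

noncomputable section

/-! ## The derivative of the minimal polynomial and the conductor -/

open Polynomial in
-- Dedekind: the dual of A[y] for the trace form is A[y] divided by the derivative of the minimal
-- polynomial at y. Integral elements lie in this dual because traces of integral elements are in A.
lemma aeval_derivative_minpoly_mul_mem_adjoin (A k : Type*) {L : Type*} [CommRing A] [IsDomain A]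
    [IsIntegrallyClosed A] [Field k] [Field L] [Algebra A k] [IsFractionRing A k] [Algebra k L]
    [Algebra A L] [IsScalarTower A k L] [FiniteDimensional k L] [Algebra.IsSeparable k L] {y z : L}
    (hadj : Algebra.adjoin k {y} = ⊤) (hy : IsIntegral A y) (hz : IsIntegral A z) :
    aeval y (derivative (minpoly A y)) * z ∈ Algebra.adjoin A {y} := by
  have hmem : z ∈ (Algebra.traceForm k L).dualSubmodule
      (Subalgebra.toSubmodule (Algebra.adjoin A {y})) := by
    rw [LinearMap.BilinForm.mem_dualSubmodule]
    intro b hb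
    rw [Submodule.mem_one]
    have hb' : IsIntegral A b := by
      have : Algebra.adjoin A {y} ≤ integralClosure A L := by
        rw [Algebra.adjoin_le_iff, Set.singleton_subset_iff]; exact hy
      exact this hb
    exact IsIntegrallyClosed.isIntegral_iff.1 (Algebra.isIntegral_trace (hz.mul hb'))
  rw [traceForm_dualSubmodule_adjoin A k hadj hy, Submodule.mem_smul_pointwise_iff_exists] at hmem
  obtain ⟨b, hb, rfl⟩ := hmem
  have hne : aeval y (derivative (minpoly k y)) ≠ 0 :=
    (Algebra.IsSeparable.isSeparable k y).aeval_derivative_ne_zero (minpoly.aeval _ _)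
  have heq : aeval y (derivative (minpoly A y)) = aeval y (derivative (minpoly k y)) := by
    rw [minpoly.isIntegrallyClosed_eq_field_fractions' k hy, derivative_map, aeval_map_algebraMap]
  rw [heq, smul_eq_mul, mul_inv_cancel_left₀ hne]
  exact hb

/-! ## Normalization of an affine chart -/

section Chart

open Polynomial
open scoped IntermediateField IntermediateField.algebraAdjoinAdjoin

variable {K : Type*} [Field K] [Algebra ℂ K]

/-- The integral closure of `ℂ[x]` in `K`. -/
def normalization (x : K) : Subalgebra ℂ K :=
  (integralClosure (Algebra.adjoin ℂ {x}) K).restrictScalars ℂ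

lemma mem_normalization {x z : K} :
    z ∈ normalization x ↔ IsIntegral (Algebra.adjoin ℂ {x}) z := Iff.rfl

lemma isPrincipalIdealRing_adjoin {x : K} (hx : Transcendental ℂ x) :
    IsPrincipalIdealRing (Algebra.adjoin ℂ {x}) :=
  IsPrincipalIdealRing.of_surjective (Polynomial.algEquivOfTranscendental ℂ x hx).toRingHom
    (Polynomial.algEquivOfTranscendental ℂ x hx).surjective

lemma adjoin_adjoin_simple_eq_top {x y : K} (htop : IntermediateField.adjoin ℂ {x, y} = ⊤) :
    (ℂ⟮x⟯)⟮y⟯ = ⊤ := by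
  have h := IntermediateField.adjoin_adjoin_left ℂ {x} {y}
  rw [show ({x} ∪ {y} : Set K) = {x, y} from rfl, htop] at h
  rw [eq_top_iff]
  intro z _
  have : z ∈ IntermediateField.restrictScalars ℂ (ℂ⟮x⟯)⟮y⟯ := h ▸ IntermediateField.mem_top
  exact this

lemma isIntegral_field_of_isIntegral_adjoin {x y : K} (hy : IsIntegral (Algebra.adjoin ℂ {x}) y) :
    IsIntegral ℂ⟮x⟯ y := hy.tower_top

lemma finiteDimensional_adjoin_simple {x y : K} (hy : IsIntegral (Algebra.adjoin ℂ {x}) y)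
    (htop : IntermediateField.adjoin ℂ {x, y} = ⊤) : FiniteDimensional ℂ⟮x⟯ K := by
  have h := IntermediateField.adjoin.finiteDimensional (isIntegral_field_of_isIntegral_adjoin hy)
  rw [adjoin_adjoin_simple_eq_top htop] at h
  exact IntermediateField.topEquiv.toLinearEquiv.finiteDimensional

lemma isDedekindDomain_normalization {x y : K} (hx : Transcendental ℂ x)
    (hy : IsIntegral (Algebra.adjoin ℂ {x}) y)
    (htop : IntermediateField.adjoin ℂ {x, y} = ⊤) : IsDedekindDomain (normalization x) := by
  have := isPrincipalIdealRing_adjoin hx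
  have := finiteDimensional_adjoin_simple hy htop
  exact integralClosure.isDedekindDomain (Algebra.adjoin ℂ {x}) ℂ⟮x⟯ K

lemma isFractionRing_normalization {x y : K}
    (hy : IsIntegral (Algebra.adjoin ℂ {x}) y)
    (htop : IntermediateField.adjoin ℂ {x, y} = ⊤) : IsFractionRing (normalization x) K := by
  have := finiteDimensional_adjoin_simple hy htop
  exact integralClosure.isFractionRing_of_finite_extension (A := Algebra.adjoin ℂ {x}) ℂ⟮x⟯ K

lemma normalization_finite {x y : K} (hx : Transcendental ℂ x)
    (hy : IsIntegral (Algebra.adjoin ℂ {x}) y)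
    (htop : IntermediateField.adjoin ℂ {x, y} = ⊤) :
    Module.Finite (Algebra.adjoin ℂ {x}) (integralClosure (Algebra.adjoin ℂ {x}) K) := by
  have := isPrincipalIdealRing_adjoin hx
  have := finiteDimensional_adjoin_simple hy htop
  exact IsIntegralClosure.finite (Algebra.adjoin ℂ {x}) ℂ⟮x⟯ K _

lemma exists_mul_mem_normalization {x y : K}
    (hy : IsIntegral (Algebra.adjoin ℂ {x}) y)
    (htop : IntermediateField.adjoin ℂ {x, y} = ⊤) (z : K) :
    ∃ d : Algebra.adjoin ℂ {x}, d ≠ 0 ∧ (d : K) * z ∈ normalization x := by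
  have := finiteDimensional_adjoin_simple hy htop
  have hz : IsAlgebraic (Algebra.adjoin ℂ {x}) z :=
    (IsFractionRing.isAlgebraic_iff (Algebra.adjoin ℂ {x}) ℂ⟮x⟯ K).2
      (Algebra.IsAlgebraic.isAlgebraic z)
  obtain ⟨d, hd, h⟩ := hz.exists_integral_multiple
  exact ⟨d, hd, by rw [mem_normalization]; rwa [Algebra.smul_def] at h⟩

lemma normalization_le_place {x : K} {v : Place ℂ K} (h : x ∈ v.1) (d : normalization x) :
    (d : K) ∈ v.1 := by
  have hle : ∀ a ∈ Algebra.adjoin ℂ {x}, a ∈ v.1 := by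
    intro a ha
    induction ha using Algebra.adjoin_induction with
    | mem a ha => rw [Set.mem_singleton_iff.1 ha]; exact h
    | algebraMap c => exact v.2.1 c
    | add a b _ _ ha hb => exact add_mem ha hb
    | mul a b _ _ ha hb => exact mul_mem ha hb
  obtain ⟨p, hp, hp0⟩ := mem_normalization.1 d.2
  have : IsIntegral v.1 (d : K) := by
    refine ⟨p.map (Subring.inclusion (S := (Algebra.adjoin ℂ {x}).toSubring)
      (T := v.1.toSubring) hle), hp.map _, ?_⟩
    rw [Polynomial.eval₂_map]
    exact hp0
  obtain ⟨z, hz⟩ := IsIntegrallyClosed.isIntegral_iff.1 this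
  rw [← hz]; exact z.2

lemma self_mem_normalization (x : K) : x ∈ normalization x :=
  mem_normalization.2 (isIntegral_algebraMap (R := Algebra.adjoin ℂ {x})
    (x := ⟨x, Algebra.self_mem_adjoin_singleton ℂ x⟩))

lemma normalization_le_place_iff {x : K} {v : Place ℂ K} :
    (∀ d : normalization x, (d : K) ∈ v.1) ↔ x ∈ v.1 :=
  ⟨fun h => h ⟨x, self_mem_normalization x⟩, fun h d => normalization_le_place h d⟩

/-- An integral closure is the intersection of the valuation rings containing the base. The trivial
ring `⊤` imposes no condition, so it suffices to test places. -/
lemma mem_integralClosure_of_mem_places (s : Set K) (z : K)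
    (hz : ∀ v : Place ℂ K, s ⊆ v.1 → z ∈ v.1) : IsIntegral (Algebra.adjoin ℂ s) z := by
  have h := iInf_valuationSubring_superset (K := K) (s := Set.range (algebraMap ℂ K) ∪ s)
  have hz' : z ∈ (⨅ V : {V : ValuationSubring K //
      (Set.range (algebraMap ℂ K) ∪ s) ⊆ V.toSubring}, V.1.toSubring) := by
    rw [Subring.mem_iInf]
    rintro ⟨V, hV⟩
    by_cases hVt : V = ⊤
    · subst hVt; exact ValuationSubring.mem_top z
    · exact hz ⟨V, fun c => hV (Or.inl ⟨c, rfl⟩), hVt⟩ fun a ha => hV (Or.inr ha)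
  rw [h] at hz'
  obtain ⟨p, hp, hp0⟩ := hz'
  have hle : Subring.closure (Set.range (algebraMap ℂ K) ∪ s) ≤
      (Algebra.adjoin ℂ s).toSubring := by
    rw [Subring.closure_le]
    rintro _ (⟨c, rfl⟩ | ha)
    · exact (Algebra.adjoin ℂ s).algebraMap_mem c
    · exact Algebra.subset_adjoin ha
  refine ⟨p.map (Subring.inclusion hle), hp.map _, ?_⟩
  rw [Polynomial.eval₂_map]
  exact hp0

lemma mem_normalization_of_mem_places {x z : K}
    (hz : ∀ v : Place ℂ K, (∀ d : normalization x, (d : K) ∈ v.1) → z ∈ v.1) :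
    z ∈ normalization x :=
  mem_normalization.2 <| mem_integralClosure_of_mem_places {x} z fun v hv =>
    hz v (normalization_le_place_iff.2 (hv rfl))

/-- The computation of H⁰: a function without poles is integral over ℂ, hence constant. -/
lemma mem_range_of_mem_all_places {z : K} (hz : ∀ v : Place ℂ K, z ∈ v.1) :
    z ∈ (algebraMap ℂ K).range := by
  have h := mem_integralClosure_of_mem_places ∅ z fun v _ => hz v
  have h2 : IsIntegral ℂ z := by
    have : Algebra.IsIntegral ℂ (Algebra.adjoin ℂ (∅ : Set K)) := by
      rw [Algebra.adjoin_empty]; infer_instance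
    exact isIntegral_trans z h
  have h3 := IsAlgClosed.algebraMap_bijective_of_isIntegral
    (k := ℂ) (K := integralClosure ℂ K)
  obtain ⟨c, hc⟩ := h3.2 ⟨z, h2⟩
  exact ⟨c, congrArg Subtype.val hc⟩

/-- The derivative of an integral equation of `y` over `ℂ[x]` multiplies the normalization into
`ℂ[x, y]`. -/
lemma aeval_derivative_mul_mem {x y : K} (hx : Transcendental ℂ x)
    (htop : IntermediateField.adjoin ℂ {x, y} = ⊤) {g : (Algebra.adjoin ℂ {x})[X]}
    (hg : g.Monic) (hgy : aeval y g = 0) {z : K} (hz : z ∈ normalization x) :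
    aeval y (derivative g) * z ∈ Algebra.adjoin ℂ {x, y} := by
  have hy : IsIntegral (Algebra.adjoin ℂ {x}) y := ⟨g, hg, hgy⟩
  have := isPrincipalIdealRing_adjoin hx
  have := finiteDimensional_adjoin_simple hy htop
  -- The given equation is a multiple of the minimal polynomial, so at y its derivative is a
  -- multiple of the derivative of the minimal polynomial.
  obtain ⟨q, rfl⟩ := minpoly.isIntegrallyClosed_dvd hy hgy
  have hadj : Algebra.adjoin ℂ⟮x⟯ {y} = ⊤ := by
    rw [← IntermediateField.adjoin_simple_toSubalgebra_of_isAlgebraic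
      (isIntegral_field_of_isIntegral_adjoin hy).isAlgebraic]
    rw [adjoin_adjoin_simple_eq_top htop, IntermediateField.top_toSubalgebra]
  have h1 := aeval_derivative_minpoly_mul_mem_adjoin (Algebra.adjoin ℂ {x}) ℂ⟮x⟯ hadj hy
    (mem_normalization.1 hz)
  have h3 : Algebra.adjoin ℂ {x, y} = (Algebra.adjoin (Algebra.adjoin ℂ {x}) {y}).restrictScalars ℂ :=
    Algebra.adjoin_union_eq_adjoin_adjoin ℂ {x} {y}
  rw [h3, Subalgebra.mem_restrictScalars]
  have : aeval y (derivative (minpoly (Algebra.adjoin ℂ {x}) y * q)) * z =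
      aeval y q * (aeval y (derivative (minpoly (Algebra.adjoin ℂ {x}) y)) * z) := by
    rw [derivative_mul]
    simp only [map_add, map_mul, minpoly.aeval]
    ring
  rw [this]
  exact mul_mem (aeval_mem_adjoin_singleton _ _) h1

end Chart
end

noncomputable section

/-! ## Forms that are monic in the second variable -/

section Forms

open MvPolynomial

/-- The chain rule for a derivation applied to the value of a polynomial. -/
lemma Derivation.map_mvPolynomial_aeval {R B M σ : Type*} [CommRing R] [CommRing B] [Algebra R B]
    [AddCommGroup M] [Module B M] [Module R M] [Fintype σ]
    (D : Derivation R B M) (v : σ → B) (p : MvPolynomial σ R) :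
    D (aeval v p) = ∑ i, aeval v (pderiv i p) • D (v i) := by
  classical
  induction p using MvPolynomial.induction_on with
  | C a => simp
  | add p q hp hq => simp only [map_add, hp, hq, add_smul, Finset.sum_add_distrib]
  | mul_X p j hp =>
    simp only [map_mul, aeval_X, Derivation.leibniz, hp, smul_eq_mul, pderiv_X, map_add, add_smul,
      Finset.sum_add_distrib, Pi.single_apply, Finset.smul_sum, smul_smul]
    congr 1
    rw [Finset.sum_eq_single j] <;> simp +contextual [eq_comm]

variable {R : Type*} [CommRing R] [Algebra ℂ R]

/-- The substitution treats all charts at once: (a, b) = (x, 1) gives the affine equation, (1, 1/x)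
the equation near infinity, and (1, 0) its restriction to the line at infinity. -/
lemma aeval_form_eq_sum (Φ : MvPolynomial (Fin 3) ℂ) (a b : R) :
    (aeval ![Polynomial.C a, Polynomial.X, Polynomial.C b] Φ : Polynomial R) =
      ∑ m ∈ Φ.support, Polynomial.C (algebraMap ℂ R (coeff m Φ) * (a ^ m 0 * b ^ m 2)) *
        Polynomial.X ^ m 1 := by
  rw [aeval_def, eval₂_eq']
  refine Finset.sum_congr rfl fun m _ => ?_
  simp only [Fin.prod_univ_three, Matrix.cons_val_zero, Matrix.cons_val_one, Matrix.cons_val,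
    Polynomial.algebraMap_apply, Polynomial.C_mul, Polynomial.C_pow]
  ring

lemma MvPolynomial.IsHomogeneous.sum_eq {Φ : MvPolynomial (Fin 3) ℂ} {d : ℕ}
    (hΦ : Φ.IsHomogeneous d) {m : Fin 3 →₀ ℕ} (hm : m ∈ Φ.support) : m 0 + m 1 + m 2 = d := by
  have h := hΦ (mem_support_iff.1 hm)
  rw [Finsupp.weight_apply, Finsupp.sum_fintype _ _ (by simp), Fin.sum_univ_three] at h
  simpa using h

lemma natDegree_aeval_form_le {Φ : MvPolynomial (Fin 3) ℂ} {d : ℕ} (hΦ : Φ.IsHomogeneous d)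
    (a b : R) :
    (aeval ![Polynomial.C a, Polynomial.X, Polynomial.C b] Φ : Polynomial R).natDegree ≤ d := by
  rw [aeval_form_eq_sum]
  refine Polynomial.natDegree_sum_le_of_forall_le _ _ fun m hm => ?_
  refine (Polynomial.natDegree_C_mul_X_pow_le _ _).trans ?_
  have := hΦ.sum_eq hm
  omega

/-- Only the d-th power of the second variable contributes in degree d, and its coefficient is the
value at [0:1:0]. -/
lemma coeff_aeval_form {Φ : MvPolynomial (Fin 3) ℂ} {d : ℕ} (hΦ : Φ.IsHomogeneous d) (a b : R) :
    (aeval ![Polynomial.C a, Polynomial.X, Polynomial.C b] Φ : Polynomial R).coeff d =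
      algebraMap ℂ R (eval ![0, 1, 0] Φ) := by
  rw [aeval_form_eq_sum, eval_eq', Polynomial.finsetSum_coeff, map_sum]
  refine Finset.sum_congr rfl fun m hm => ?_
  have h := hΦ.sum_eq hm
  rw [Polynomial.coeff_C_mul_X_pow, Fin.prod_univ_three]
  simp only [Matrix.cons_val_zero, Matrix.cons_val_one, Matrix.cons_val, one_pow, mul_one]
  by_cases h1 : d = m 1
  · have h0 : m 0 = 0 := by omega
    have h2 : m 2 = 0 := by omega
    simp [h0, h2, h1]
  · rw [if_neg h1]
    by_cases h0 : m 0 = 0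
    · have h2 : m 2 ≠ 0 := by omega
      simp [h2]
    · simp [h0]

lemma monic_aeval_form {Φ : MvPolynomial (Fin 3) ℂ} {d : ℕ} (hΦ : Φ.IsHomogeneous d)
    (h1 : eval ![0, 1, 0] Φ = 1) (a b : R) :
    (aeval ![Polynomial.C a, Polynomial.X, Polynomial.C b] Φ : Polynomial R).Monic := by
  refine Polynomial.monic_of_natDegree_le_of_coeff_eq_one d (natDegree_aeval_form_le hΦ a b) ?_
  rw [coeff_aeval_form hΦ, h1, map_one]

lemma natDegree_aeval_form [Nontrivial R] {Φ : MvPolynomial (Fin 3) ℂ} {d : ℕ}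
    (hΦ : Φ.IsHomogeneous d) (h1 : eval ![0, 1, 0] Φ = 1) (a b : R) :
    (aeval ![Polynomial.C a, Polynomial.X, Polynomial.C b] Φ : Polynomial R).natDegree = d := by
  refine Polynomial.natDegree_eq_of_le_of_coeff_ne_zero (natDegree_aeval_form_le hΦ a b) ?_
  rw [coeff_aeval_form hΦ, h1, map_one]
  exact one_ne_zero

lemma derivative_aeval_form (Φ : MvPolynomial (Fin 3) ℂ) (a b : R) :
    Polynomial.derivative
      (aeval ![Polynomial.C a, Polynomial.X, Polynomial.C b] Φ : Polynomial R) =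
      aeval ![Polynomial.C a, Polynomial.X, Polynomial.C b] (pderiv 1 Φ) := by
  have h := Derivation.map_mvPolynomial_aeval
    ((Polynomial.derivative' (R := R)).restrictScalars ℂ)
    ![Polynomial.C a, Polynomial.X, Polynomial.C b] Φ
  rw [Fin.sum_univ_three] at h
  simpa using h

lemma aeval_aeval_form {A : Type*} [CommRing A] [Algebra ℂ A] [Algebra R A] [IsScalarTower ℂ R A]
    (Φ : MvPolynomial (Fin 3) ℂ) (a b : R) (y : A) :
    Polynomial.aeval y
      (aeval ![Polynomial.C a, Polynomial.X, Polynomial.C b] Φ : Polynomial R) =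
      aeval ![algebraMap R A a, y, algebraMap R A b] Φ := by
  change ((Polynomial.aeval y).restrictScalars ℂ) _ = _
  rw [← AlgHom.comp_apply]
  congr 1
  ext i
  fin_cases i <;> simp

end Forms

/-! ## Charts of a plane curve -/

section PlaneChart

open Polynomial
open scoped IntermediateField IntermediateField.algebraAdjoinAdjoin

variable {K : Type*} [Field K] [Algebra ℂ K]

lemma mem_adjoin_singleton_iff_aeval {R A : Type*} [CommRing R] [CommRing A] [Algebra R A]
    {a z : A} : z ∈ Algebra.adjoin R {a} ↔ ∃ p : R[X], aeval a p = z := by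
  rw [Algebra.adjoin_singleton_eq_range_aeval]
  rfl

/-- `K` is the function field of the plane quintic `Φ = 0`, with affine coordinates `x, y`, and the
point `[0 : 1 : 0]` is not on the curve. -/
structure IsPlaneChart (Φ : MvPolynomial (Fin 3) ℂ) (x y : K) : Prop where
  isHomogeneous : Φ.IsHomogeneous 5
  eval_eq_one : MvPolynomial.eval ![0, 1, 0] Φ = 1
  aeval_eq_zero : MvPolynomial.aeval ![x, y, 1] Φ = 0
  dvd_of_aeval_eq_zero : ∀ p : MvPolynomial (Fin 2) ℂ, MvPolynomial.aeval ![x, y] p = 0 →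
    MvPolynomial.aeval ![MvPolynomial.X 0, MvPolynomial.X 1, 1] Φ ∣ p
  adjoin_eq_top : IntermediateField.adjoin ℂ {x, y} = ⊤

namespace IsPlaneChart

variable {Φ : MvPolynomial (Fin 3) ℂ} {x y : K} (h : IsPlaneChart Φ x y)

include h

/-- Every relation between x and y is a multiple of the affine equation, which is monic of degree 5
in y. -/
lemma eq_zero_of_natDegree_lt {p : ℂ[X][X]} (hp : p.natDegree < 5)
    (h0 : Polynomial.aevalAeval x y p = 0) : p = 0 := by
  let τ : MvPolynomial (Fin 2) ℂ →ₐ[ℂ] ℂ[X][X] := MvPolynomial.aeval ![C X, X]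
  have hτ : Function.Surjective τ := by
    have h1 : ∀ q : ℂ[X], ∃ r, τ r = C q := by
      intro q
      refine ⟨Polynomial.aeval (MvPolynomial.X 0) q, ?_⟩
      rw [← Polynomial.aeval_algHom_apply]
      simp only [τ, MvPolynomial.aeval_X, Matrix.cons_val_zero]
      induction q using Polynomial.induction_on' with
      | add p q hp hq => simp only [map_add, hp, hq]
      | monomial n a =>
        rw [Polynomial.aeval_monomial, ← C_pow, ← Polynomial.C_mul_X_pow_eq_monomial, C_mul]
        rfl
    intro q
    induction q using Polynomial.induction_on' with
    | add p q hp hq =>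
      obtain ⟨a, rfl⟩ := hp
      obtain ⟨b, rfl⟩ := hq
      exact ⟨a + b, map_add _ _ _⟩
    | monomial n a =>
      obtain ⟨r, hr⟩ := h1 a
      refine ⟨r * MvPolynomial.X 1 ^ n, ?_⟩
      rw [map_mul, hr, map_pow, ← C_mul_X_pow_eq_monomial]
      simp [τ]
  obtain ⟨q, rfl⟩ := hτ p
  have hev : (Polynomial.aevalAeval x y).comp τ = MvPolynomial.aeval ![x, y] := by
    ext i
    fin_cases i <;> simp [τ]
  have h1 := h.dvd_of_aeval_eq_zero q (by rw [← hev]; exact h0)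
  have h2 := map_dvd τ h1
  have h3 : τ (MvPolynomial.aeval ![MvPolynomial.X 0, MvPolynomial.X 1, 1] Φ) =
      (MvPolynomial.aeval ![C (X : ℂ[X]), X, C 1] Φ : ℂ[X][X]) := by
    rw [← AlgHom.comp_apply]
    congr 1
    apply MvPolynomial.algHom_ext
    intro i
    fin_cases i <;> simp [τ]
  rw [h3] at h2
  have hm := monic_aeval_form h.isHomogeneous h.eval_eq_one (X : ℂ[X]) 1
  by_contra hne
  have := Polynomial.natDegree_le_of_dvd h2 hne
  rw [natDegree_aeval_form h.isHomogeneous h.eval_eq_one] at this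
  omega

lemma transcendental : Transcendental ℂ x := by
  rw [transcendental_iff]
  intro p hp
  have := h.eq_zero_of_natDegree_lt (p := C p) (by simp) (by simpa using hp)
  simpa using this

/-- The equation of the curve, as a polynomial in `y` with coefficients in `ℂ[x]`. -/
lemma exists_monic : ∃ g : (Algebra.adjoin ℂ {x})[X], g.Monic ∧ g.natDegree = 5 ∧
    aeval y g = 0 ∧ aeval y (derivative g) = MvPolynomial.aeval ![x, y, 1]
      (MvPolynomial.pderiv 1 Φ) := by
  let a : Algebra.adjoin ℂ {x} := ⟨x, Algebra.self_mem_adjoin_singleton ℂ x⟩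
  refine ⟨MvPolynomial.aeval ![C a, X, C 1] Φ, monic_aeval_form h.isHomogeneous h.eval_eq_one _ _,
    natDegree_aeval_form h.isHomogeneous h.eval_eq_one _ _, ?_, ?_⟩
  · rw [aeval_aeval_form]
    simpa [a] using h.aeval_eq_zero
  · rw [derivative_aeval_form, aeval_aeval_form]
    simp [a]

lemma isIntegral : IsIntegral (Algebra.adjoin ℂ {x}) y := by
  obtain ⟨g, hg, -, h0, -⟩ := h.exists_monic
  exact ⟨g, hg, h0⟩

lemma linearIndependent : LinearIndependent ℂ⟮x⟯ fun b : Fin 5 => y ^ (b : ℕ) := by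
  rw [← LinearIndependent.iff_fractionRing (R := Algebra.adjoin ℂ {x}), Fintype.linearIndependent_iff]
  intro g hg
  have hsurj : ∀ b : Fin 5, ∃ p : ℂ[X], aeval x p = (g b : K) := by
    intro b
    exact mem_adjoin_singleton_iff_aeval.1 (g b).2
  choose p hp using hsurj
  have h0 := h.eq_zero_of_natDegree_lt (p := ∑ b : Fin 5, C (p b) * X ^ (b : ℕ)) (by
    refine (Polynomial.natDegree_sum_le_of_forall_le (n := 4) _ _ fun b _ => ?_).trans_lt
      (by norm_num)
    exact (Polynomial.natDegree_C_mul_X_pow_le _ _).trans (by omega)) (by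
    rw [map_sum, ← hg]
    refine Finset.sum_congr rfl fun b _ => ?_
    simp [hp, Algebra.smul_def])
  intro b
  have h1 := congrArg (fun q => Polynomial.coeff q (b : ℕ)) h0
  simp only [Polynomial.finsetSum_coeff, Polynomial.coeff_C_mul_X_pow, Polynomial.coeff_zero] at h1
  rw [Finset.sum_eq_single b (fun c _ hc => by
    rw [if_neg]; exact fun hbc => hc (Fin.ext hbc.symm)) (by simp), if_pos rfl] at h1
  apply Subtype.ext
  rw [← hp, h1, map_zero]
  rfl

/-- The basis `1, y, …, y⁴` of `K` over `ℂ(x)`. -/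
lemma exists_basis : ∃ B : Module.Basis (Fin 5) ℂ⟮x⟯ K, ∀ b : Fin 5, B b = y ^ (b : ℕ) := by
  have := finiteDimensional_adjoin_simple h.isIntegral h.adjoin_eq_top
  obtain ⟨g, hg, hdeg, h0, -⟩ := h.exists_monic
  have hyi := isIntegral_field_of_isIntegral_adjoin h.isIntegral
  have hle : Module.finrank ℂ⟮x⟯ K ≤ 5 := by
    have h1 := IntermediateField.adjoin.finrank hyi
    rw [adjoin_adjoin_simple_eq_top h.adjoin_eq_top, IntermediateField.finrank_top'] at h1
    rw [h1]
    have h2 : minpoly ℂ⟮x⟯ y ∣ g.map (algebraMap _ ℂ⟮x⟯) :=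
      minpoly.dvd _ _ (by rw [aeval_map_algebraMap, h0])
    have := Polynomial.natDegree_le_of_dvd h2 (hg.map _).ne_zero
    rwa [hg.natDegree_map, hdeg] at this
  have hge := h.linearIndependent.fintype_card_le_finrank
  refine ⟨basisOfLinearIndependentOfCardEqFinrank h.linearIndependent
    (le_antisymm hge (by simpa using hle)), fun b => by simp⟩

/-- Division with remainder by the monic equation makes ℂ[x, y] free over ℂ[x] on 1, y, …, y⁴. -/
lemma mem_adjoin_iff (B : Module.Basis (Fin 5) ℂ⟮x⟯ K) (hB : ∀ b : Fin 5, B b = y ^ (b : ℕ))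
    (z : K) : z ∈ Algebra.adjoin ℂ {x, y} ↔ ∀ b, (B.repr z b : K) ∈ Algebra.adjoin ℂ {x} := by
  have h3 : Algebra.adjoin ℂ {x, y} =
      (Algebra.adjoin (Algebra.adjoin ℂ {x}) {y}).restrictScalars ℂ :=
    Algebra.adjoin_union_eq_adjoin_adjoin ℂ {x} {y}
  obtain ⟨g, hg, hdeg, h0, -⟩ := h.exists_monic
  constructor
  · intro hz b
    rw [h3, Subalgebra.mem_restrictScalars] at hz
    obtain ⟨p, rfl⟩ := mem_adjoin_singleton_iff_aeval.1 hz
    have hlt : (p %ₘ g).natDegree < 5 := hdeg ▸ Polynomial.natDegree_modByMonic_lt p hg 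
      (by intro h; simp [h] at hdeg)
    have h1 : aeval y p = ∑ b : Fin 5, algebraMap (Algebra.adjoin ℂ {x}) ℂ⟮x⟯ 
        ((p %ₘ g).coeff b) • B b := by
      conv_lhs => rw [← Polynomial.modByMonic_add_div p g]
      rw [map_add, map_mul, h0, zero_mul, add_zero, Polynomial.aeval_eq_sum_range' hlt,
        ← Fin.sum_univ_eq_sum_range (fun i => (p %ₘ g).coeff i • y ^ i)]
      refine Finset.sum_congr rfl fun b _ => ?_
      rw [hB, algebraMap_smul]
    change ((B.repr (aeval y p) b : ℂ⟮x⟯) : K) ∈ _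
    rw [h1, B.repr_sum_self]
    exact ((p %ₘ g).coeff b).2
  · intro hz
    rw [← B.sum_repr z]
    refine sum_mem fun b _ => ?_
    rw [hB, Algebra.smul_def]
    exact mul_mem (Algebra.adjoin_mono (by simp) (hz b))
      (pow_mem (Algebra.subset_adjoin (by simp)) _)

end IsPlaneChart

end PlaneChart
end

noncomputable section

/-! ## The curve at infinity -/

section Infinity

open Polynomial
open scoped IntermediateField IntermediateField.algebraAdjoinAdjoin

variable {K : Type*} [Field K] [Algebra ℂ K]

lemma MvPolynomial.IsHomogeneous.aeval_smul_eq {σ R A : Type*} [Fintype σ] [CommRing R] [CommRing A]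
    [Algebra R A] {Φ : MvPolynomial σ R} {d : ℕ} (hΦ : Φ.IsHomogeneous d) (c : A) (v : σ → A) :
    MvPolynomial.aeval (fun i => c * v i) Φ = c ^ d * MvPolynomial.aeval v Φ := by
  rw [MvPolynomial.aeval_def, MvPolynomial.aeval_def, MvPolynomial.eval₂_eq', MvPolynomial.eval₂_eq',
    Finset.mul_sum]
  refine Finset.sum_congr rfl fun m hm => ?_
  have h := hΦ (MvPolynomial.mem_support_iff.1 hm)
  rw [Finsupp.weight_apply, Finsupp.sum_fintype _ _ (by simp)] at h
  simp only [mul_pow, Finset.prod_mul_distrib]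
  rw [Finset.prod_pow_eq_pow_sum, show ∑ i, m i = d by simpa using h]
  ring

/-- The local ring, at the line at infinity, of the coordinate ring `ℂ[1/x, y/x]`. -/
def infinityRing (x y : K) : Submodule ℂ K where
  carrier := {z | ∃ q : ℂ[X], q.eval 0 ≠ 0 ∧ aeval x⁻¹ q * z ∈ Algebra.adjoin ℂ {x⁻¹, y * x⁻¹}}
  zero_mem' := ⟨1, by simp, by simp [zero_mem]⟩
  add_mem' := by
    rintro a b ⟨p, hp, ha⟩ ⟨q, hq, hb⟩
    refine ⟨p * q, by simp [hp, hq], ?_⟩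
    have h1 : ∀ r : ℂ[X], aeval x⁻¹ r ∈ Algebra.adjoin ℂ {x⁻¹, y * x⁻¹} := fun r =>
      Algebra.adjoin_mono (by simp) (aeval_mem_adjoin_singleton ℂ x⁻¹ (p := r))
    convert add_mem (mul_mem (h1 q) ha) (mul_mem (h1 p) hb) using 1
    rw [map_mul]; ring
  smul_mem' := by
    rintro c a ⟨p, hp, ha⟩
    refine ⟨p, hp, ?_⟩
    rw [mul_smul_comm]
    exact Subalgebra.smul_mem _ ha c

lemma mem_infinityRing {x y z : K} : z ∈ infinityRing x y ↔
    ∃ q : ℂ[X], q.eval 0 ≠ 0 ∧ aeval x⁻¹ q * z ∈ Algebra.adjoin ℂ {x⁻¹, y * x⁻¹} := Iff.rfl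

lemma aeval_mem_place {v : Place ℂ K} {u : K} (hu : u ∈ v.1) (q : ℂ[X]) :
    aeval u q ∈ v.1 :=
  normalization_le_place hu ⟨aeval u q, mem_normalization.2 (isIntegral_algebraMap
    (R := Algebra.adjoin ℂ {u}) (x := ⟨_, aeval_mem_adjoin_singleton ℂ u⟩))⟩

lemma adjoin_infinity_eq (x y : K) : Algebra.adjoin ℂ {x⁻¹, y * x⁻¹} =
    (Algebra.adjoin (Algebra.adjoin ℂ {x⁻¹}) {y * x⁻¹}).restrictScalars ℂ :=
  Algebra.adjoin_union_eq_adjoin_adjoin ℂ {x⁻¹} {y * x⁻¹}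

namespace IsPlaneChart

variable {Φ : MvPolynomial (Fin 3) ℂ} {x y : K} (h : IsPlaneChart Φ x y)

include h

lemma ne_zero : x ≠ 0 := fun h0 => by
  have := h.transcendental
  rw [h0] at this
  exact this (isAlgebraic_zero)

lemma transcendental_inv : Transcendental ℂ x⁻¹ := fun h0 => h.transcendental (by
  have := IsAlgebraic.inv h0
  rwa [inv_inv] at this)

lemma adjoin_infinity_eq_top : IntermediateField.adjoin ℂ {x⁻¹, y * x⁻¹} = ⊤ := by
  rw [eq_top_iff, ← h.adjoin_eq_top, IntermediateField.adjoin_le_iff]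
  have hx : x ∈ IntermediateField.adjoin ℂ {x⁻¹, y * x⁻¹} := by
    have := inv_mem (IntermediateField.subset_adjoin ℂ {x⁻¹, y * x⁻¹} (Set.mem_insert x⁻¹ _))
    rwa [inv_inv] at this
  have hy : y * x⁻¹ ∈ IntermediateField.adjoin ℂ {x⁻¹, y * x⁻¹} :=
    IntermediateField.subset_adjoin ℂ _ (by simp)
  rintro z (rfl | hz)
  · exact hx
  · rw [Set.mem_singleton_iff.1 hz]
    have := mul_mem hy hx
    rwa [inv_mul_cancel_right₀ h.ne_zero] at this

lemma aeval_infinity_eq_zero : MvPolynomial.aeval ![1, y * x⁻¹, x⁻¹] Φ = 0 := by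
  have h1 := h.isHomogeneous.aeval_smul_eq x⁻¹ ![x, y, 1]
  rw [h.aeval_eq_zero, mul_zero] at h1
  rw [← h1]
  congr 2
  ext i
  have := h.ne_zero
  fin_cases i <;> simp [this, mul_comm]

lemma exists_monic_infinity : ∃ g : (Algebra.adjoin ℂ {x⁻¹})[X], g.Monic ∧ g.natDegree = 5 ∧
    aeval (y * x⁻¹) g = 0 ∧ aeval (y * x⁻¹) (derivative g) =
      MvPolynomial.aeval ![1, y * x⁻¹, x⁻¹] (MvPolynomial.pderiv 1 Φ) := by
  let a : Algebra.adjoin ℂ {x⁻¹} := ⟨x⁻¹, Algebra.self_mem_adjoin_singleton ℂ x⁻¹⟩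
  refine ⟨MvPolynomial.aeval ![C 1, X, C a] Φ, monic_aeval_form h.isHomogeneous h.eval_eq_one _ _,
    natDegree_aeval_form h.isHomogeneous h.eval_eq_one _ _, ?_, ?_⟩
  · rw [aeval_aeval_form]
    simpa [a] using h.aeval_infinity_eq_zero
  · rw [derivative_aeval_form, aeval_aeval_form]
    simp [a]

lemma isIntegral_infinity : IsIntegral (Algebra.adjoin ℂ {x⁻¹}) (y * x⁻¹) := by
  obtain ⟨g, hg, -, h0, -⟩ := h.exists_monic_infinity
  exact ⟨g, hg, h0⟩

/-- If the line at infinity is transversal to the curve, then the derivative is a unit there. -/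
lemma exists_mul_derivative_infinity
    (hsep : (MvPolynomial.aeval ![1, X, 0] Φ : ℂ[X]).Separable) :
    ∃ a ∈ Algebra.adjoin ℂ {x⁻¹, y * x⁻¹}, ∃ b ∈ Algebra.adjoin ℂ {x⁻¹, y * x⁻¹},
      a * MvPolynomial.aeval ![1, y * x⁻¹, x⁻¹] (MvPolynomial.pderiv 1 Φ) + x⁻¹ * b = 1 := by
  obtain ⟨p, q, hpq⟩ := hsep
  have hder : derivative (MvPolynomial.aeval ![1, X, 0] Φ : ℂ[X]) =
      MvPolynomial.aeval ![1, X, 0] (MvPolynomial.pderiv 1 Φ) := by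
    have := derivative_aeval_form (R := ℂ) Φ 1 0
    simpa using this
  -- Modulo 1/x, the value of a form near infinity depends only on its restriction to the line at
  -- infinity. This transports the Bézout relation of `hsep` to the curve.
  have hmod : ∀ Ψ : MvPolynomial (Fin 3) ℂ, ∃ b ∈ Algebra.adjoin ℂ {x⁻¹, y * x⁻¹},
      aeval (y * x⁻¹) (MvPolynomial.aeval ![1, X, 0] Ψ : ℂ[X]) =
        MvPolynomial.aeval ![1, y * x⁻¹, x⁻¹] Ψ + x⁻¹ * b := by
    have hw : x⁻¹ ∈ Algebra.adjoin ℂ {x⁻¹, y * x⁻¹} := Algebra.subset_adjoin (by simp)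
    have hs : y * x⁻¹ ∈ Algebra.adjoin ℂ {x⁻¹, y * x⁻¹} := Algebra.subset_adjoin (by simp)
    have hall : ∀ Ψ : MvPolynomial (Fin 3) ℂ, MvPolynomial.aeval ![1, y * x⁻¹, x⁻¹] Ψ ∈
        Algebra.adjoin ℂ {x⁻¹, y * x⁻¹} := by
      intro Ψ
      induction Ψ using MvPolynomial.induction_on with
      | C a => simp
      | add p q hp hq => rw [map_add]; exact add_mem hp hq
      | mul_X p i hp =>
        rw [map_mul, MvPolynomial.aeval_X]
        refine mul_mem hp ?_
        fin_cases i
        · exact one_mem _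
        · exact hs
        · exact hw
    intro Ψ
    induction Ψ using MvPolynomial.induction_on with
    | C a => exact ⟨0, zero_mem _, by simp⟩
    | add p q hp hq =>
      obtain ⟨a, ha, ha'⟩ := hp
      obtain ⟨b, hb, hb'⟩ := hq
      exact ⟨a + b, add_mem ha hb, by simp only [map_add, ha', hb']; ring⟩
    | mul_X p i hp =>
      obtain ⟨a, ha, ha'⟩ := hp
      simp only [map_mul, MvPolynomial.aeval_X, ha']
      fin_cases i
      · exact ⟨a, ha, by simp⟩
      · refine ⟨a * (y * x⁻¹), mul_mem ha hs, by simp; ring⟩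
      · refine ⟨-(MvPolynomial.aeval ![1, y * x⁻¹, x⁻¹] p), neg_mem (hall p), by simp; ring⟩
  obtain ⟨b₀, hb₀, e₀⟩ := hmod Φ
  obtain ⟨b₁, hb₁, e₁⟩ := hmod (MvPolynomial.pderiv 1 Φ)
  rw [h.aeval_infinity_eq_zero, zero_add] at e₀
  have hp : ∀ p : ℂ[X], aeval (y * x⁻¹) p ∈ Algebra.adjoin ℂ {x⁻¹, y * x⁻¹} := fun p =>
    Algebra.adjoin_mono (by simp) (aeval_mem_adjoin_singleton ℂ (y * x⁻¹) (p := p))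
  refine ⟨aeval (y * x⁻¹) q, hp q, aeval (y * x⁻¹) p * b₀ + aeval (y * x⁻¹) q * b₁,
    add_mem (mul_mem (hp p) hb₀) (mul_mem (hp q) hb₁), ?_⟩
  have := congrArg (aeval (y * x⁻¹)) hpq
  rw [hder, map_add, map_mul, map_mul, e₀, e₁, map_one] at this
  linear_combination this

/-- If the line at infinity is transversal to the curve, the curve is normal there. -/
lemma exists_mul_normalization_inv_mem
    (hsep : (MvPolynomial.aeval ![1, X, 0] Φ : ℂ[X]).Separable) :
    ∃ q : ℂ[X], q.eval 0 ≠ 0 ∧ ∀ z ∈ normalization x⁻¹,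
      aeval x⁻¹ q * z ∈ Algebra.adjoin ℂ {x⁻¹, y * x⁻¹} := by
  obtain ⟨a, ha, b, hb, hab⟩ := h.exists_mul_derivative_infinity hsep
  obtain ⟨g, hg, -, hgy, hder⟩ := h.exists_monic_infinity
  have hfin := normalization_finite h.transcendental_inv h.isIntegral_infinity
    h.adjoin_infinity_eq_top
  let A := Algebra.adjoin ℂ {x⁻¹}
  let w : A := ⟨x⁻¹, Algebra.self_mem_adjoin_singleton ℂ x⁻¹⟩
  let N : Submodule A K := Subalgebra.toSubmodule (integralClosure A K)
  let R : Submodule A K := Subalgebra.toSubmodule (Algebra.adjoin A {y * x⁻¹})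
  have hNfg : N.FG := Module.Finite.iff_fg.1 hfin
  have hR : ∀ z, z ∈ R ↔ z ∈ Algebra.adjoin ℂ {x⁻¹, y * x⁻¹} := fun z => by
    rw [adjoin_infinity_eq]; rfl
  have hRN : ∀ z ∈ Algebra.adjoin ℂ {x⁻¹, y * x⁻¹}, z ∈ normalization x⁻¹ := by
    intro z hz
    have : Algebra.adjoin ℂ {x⁻¹, y * x⁻¹} ≤ normalization x⁻¹ := by
      rw [Algebra.adjoin_le_iff]
      rintro z (rfl | hz)
      · exact self_mem_normalization _
      · rw [Set.mem_singleton_iff.1 hz]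
        exact h.isIntegral_infinity
    exact this hz
  -- Nakayama: the derivative is a unit modulo w = 1/x and multiplies N into R, so N = R + wN. Hence
  -- some r ≡ 1 mod w satisfies rN ⊆ R.
  have hle : N ≤ R ⊔ Ideal.span {w} • N := by
    intro z hz
    have e : z = a * (MvPolynomial.aeval ![1, y * x⁻¹, x⁻¹] (MvPolynomial.pderiv 1 Φ) * z) +
        x⁻¹ * (b * z) := by
      linear_combination - z * hab
    rw [e]
    refine Submodule.add_mem_sup ((hR _).2 (mul_mem ha ?_)) ?_
    · rw [← hder]
      exact aeval_derivative_mul_mem h.transcendental_inv h.adjoin_infinity_eq_top hg hgy hz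
    · exact Submodule.smul_mem_smul (Ideal.mem_span_singleton_self w)
        ((mul_mem (hRN b hb) hz : b * z ∈ normalization x⁻¹) : b * z ∈ N)
  obtain ⟨r, hr, hrN⟩ := Submodule.exists_sub_one_mem_and_smul_le_of_fg_of_le_sup hNfg le_rfl hle
  obtain ⟨t, ht⟩ := Ideal.mem_span_singleton'.1 hr
  obtain ⟨t', ht'⟩ := mem_adjoin_singleton_iff_aeval.1 t.2
  refine ⟨1 + t' * X, by simp, fun z hz => (hR _).1 ?_⟩
  have h1 : aeval x⁻¹ (1 + t' * X) = (r : K) := by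
    have := congrArg Subtype.val ht
    simp only [map_add, map_mul, aeval_X, map_one, ht']
    change (t : K) * x⁻¹ = r - 1 at this
    rw [this]; ring
  rw [h1]
  exact hrN (Submodule.smul_mem_pointwise_smul z r N hz)

/-- A denominator of z over ℂ[1/x] factors as a power of 1/x times q with q(0) ≠ 0. The power is
superfluous: where x is also integral, 1/x is a unit, and at the other places z is integral by
assumption. So qz is in the normalization of ℂ[1/x], and normality near infinity finishes.
Conversely, such a q is a unit wherever 1/x has value below 1. -/
theorem integralAtInfinity_eq (hsep : (MvPolynomial.aeval ![1, X, 0] Φ : ℂ[X]).Separable) :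
    integralAtInfinity (normalization x) = infinityRing x y := by
  have hx0 := h.ne_zero
  ext z
  rw [mem_integralAtInfinity, mem_infinityRing]
  simp only [normalization_le_place_iff]
  constructor
  · intro hz
    obtain ⟨d, hd, hdz⟩ := exists_mul_mem_normalization h.isIntegral_infinity
      h.adjoin_infinity_eq_top z
    obtain ⟨p, hp⟩ := mem_adjoin_singleton_iff_aeval.1 d.2
    have hp0 : p ≠ 0 := by
      rintro rfl
      exact hd (Subtype.ext (by rw [← hp, map_zero]; rfl))
    obtain ⟨q, hpq, hq⟩ := Polynomial.exists_eq_pow_rootMultiplicity_mul_and_not_dvd p hp0 0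
    rw [C_0, sub_zero] at hpq hq
    have hq0 : q.eval 0 ≠ 0 := by
      rwa [Polynomial.X_dvd_iff, Polynomial.coeff_zero_eq_eval_zero] at hq
    have hqz : aeval x⁻¹ q * z ∈ normalization x⁻¹ := by
      refine mem_normalization_of_mem_places fun v hv => ?_
      rw [normalization_le_place_iff] at hv
      by_cases hxv : x ∈ v.1
      · have h1 := normalization_le_place hv ⟨_, hdz⟩
        simp only [← hp] at h1
        rw [hpq, map_mul, map_pow, aeval_X] at h1
        have h2 := mul_mem (pow_mem hxv (p.rootMultiplicity 0)) h1
        convert h2 using 1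
        rw [← mul_assoc, ← mul_assoc, ← mul_pow, mul_inv_cancel₀ hx0, one_pow, one_mul]
      · exact mul_mem (aeval_mem_place hv q) (hz v hxv)
    obtain ⟨q', hq', hmul⟩ := h.exists_mul_normalization_inv_mem hsep
    refine ⟨q' * q, by simp [hq0, hq'], ?_⟩
    rw [map_mul, mul_assoc]
    exact hmul _ hqz
  · rintro ⟨q, hq, hqz⟩ v hv
    have hw : x⁻¹ ∈ v.1 := (v.1.mem_or_inv_mem x).resolve_left hv
    have hwlt : v.1.valuation x⁻¹ < 1 := by
      rw [map_inv₀]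
      apply inv_lt_one_of_one_lt₀
      rw [← not_le, v.1.valuation_le_one_iff]
      exact hv
    have h1 : aeval x⁻¹ q * z ∈ v.1 := by
      have hle : Algebra.adjoin ℂ {x⁻¹, y * x⁻¹} ≤ normalization x⁻¹ := by
        rw [Algebra.adjoin_le_iff]
        rintro z (rfl | hz)
        · exact self_mem_normalization _
        · rw [Set.mem_singleton_iff.1 hz]
          exact h.isIntegral_infinity
      exact normalization_le_place hw ⟨_, hle hqz⟩
    have hval : v.1.valuation (aeval x⁻¹ q) = 1 := by
      have e : aeval x⁻¹ q = aeval x⁻¹ q.divX * x⁻¹ + algebraMap ℂ K (q.coeff 0) := by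
        conv_lhs => rw [← Polynomial.divX_mul_X_add q]
        simp
      have hc : v.1.valuation (algebraMap ℂ K (q.coeff 0)) = 1 := by
        rw [Polynomial.coeff_zero_eq_eval_zero]
        refine le_antisymm ((v.1.valuation_le_one_iff _).2 (v.2.1 _)) ?_
        have h2 := (v.1.valuation_le_one_iff _).2 (v.2.1 (q.eval 0)⁻¹)
        rw [map_inv₀, map_inv₀] at h2
        exact (inv_le_one₀ (by
          rw [zero_lt_iff, Valuation.ne_zero_iff]
          simpa using hq)).1 h2
      rw [e, Valuation.map_add_eq_of_lt_right _ ?_, hc]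
      rw [hc, map_mul]
      exact mul_lt_one_of_nonneg_of_lt_one_right
        ((v.1.valuation_le_one_iff _).2 (aeval_mem_place hw _)) zero_le hwlt
    rw [← v.1.valuation_le_one_iff] at h1 ⊢
    rwa [map_mul, hval, one_mul] at h1

end IsPlaneChart

end Infinity
end

noncomputable section

/-! ## Laurent expansions at infinity -/

section Laurent

open Polynomial
open scoped IntermediateField IntermediateField.algebraAdjoinAdjoin LaurentSeries

lemma algebraMap_laurentSeries (a : ℂ) : algebraMap ℂ ℂ⸨X⸩ a = HahnSeries.C a := by
  rw [HahnSeries.algebraMap_apply']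
  exact HahnSeries.ofPowerSeries_C a

lemma aeval_single_one (q : ℂ[X]) :
    aeval (HahnSeries.single (1 : ℤ) (1 : ℂ)) q =
      HahnSeries.ofPowerSeries ℤ ℂ (q : PowerSeries ℂ) := by
  induction q using Polynomial.induction_on' with
  | add p q hp hq => simp only [map_add, hp, hq, Polynomial.coe_add]
  | monomial n a =>
    have h1 : PowerSeries.monomial n a = PowerSeries.C a * (PowerSeries.X : PowerSeries ℂ) ^ n := by
      ext m
      simp [PowerSeries.coeff_monomial, PowerSeries.coeff_X_pow]
    rw [aeval_monomial, Polynomial.coe_monomial, h1, map_mul, algebraMap_laurentSeries,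
      HahnSeries.ofPowerSeries_C, map_pow, HahnSeries.ofPowerSeries_X]

lemma coeff_aeval_single_neg_one (p : ℂ[X]) (j : ℤ) :
    (aeval (HahnSeries.single (-1 : ℤ) (1 : ℂ)) p).coeff j =
      if j ≤ 0 then p.coeff (-j).toNat else 0 := by
  induction p using Polynomial.induction_on' with
  | add p q hp hq =>
    simp only [map_add, HahnSeries.coeff_add, hp, hq, Polynomial.coeff_add]
    split_ifs <;> simp
  | monomial n a =>
    rw [aeval_monomial, HahnSeries.single_pow, algebraMap_laurentSeries, HahnSeries.C_mul_eq_smul]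
    simp only [smul_eq_mul, one_pow, HahnSeries.coeff_smul,
      HahnSeries.coeff_single, Polynomial.coeff_monomial, nsmul_eq_mul, mul_ite, mul_one, mul_zero]
    split_ifs <;> first | rfl | omega

lemma exists_powerSeries_of_coeff_eq_zero (f : ℂ⸨X⸩) (b : ℕ)
    (hf : ∀ j : ℤ, j < b → f.coeff j = 0) :
    ∃ g : PowerSeries ℂ, f = HahnSeries.ofPowerSeries ℤ ℂ (PowerSeries.X ^ b * g) := by
  refine ⟨PowerSeries.mk fun n => f.coeff (n + b), ?_⟩
  ext j
  rw [PowerSeries.coeff_coe]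
  split_ifs with hj
  · exact hf j (by omega)
  · rw [PowerSeries.coeff_X_pow_mul']
    split_ifs with hb
    · rw [PowerSeries.coeff_mk]; congr 1; omega
    · exact hf j (by omega)

variable {K : Type*} [Field K] [Algebra ℂ K]

/-- Expansion at x = ∞ in the local parameter 1/x: non-positive exponents are the polynomial part in
x, positive ones measure vanishing at infinity. -/
lemma exists_laurent_expansion {x : K} (hx : Transcendental ℂ x) :
    ∃ σ : ℂ⟮x⟯ →ₐ[ℂ] ℂ⸨X⸩,
      σ (IntermediateField.AdjoinSimple.gen ℂ x) = HahnSeries.single (-1 : ℤ) (1 : ℂ) := by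
  have hinj : Function.Injective (aeval (R := ℂ) (HahnSeries.single (-1 : ℤ) (1 : ℂ))) := by
    rw [injective_iff_map_eq_zero]
    intro p hp
    ext n
    have := coeff_aeval_single_neg_one p (-n)
    rw [hp] at this
    simpa using this.symm
  refine ⟨(RatFunc.liftAlgHom _ (nonZeroDivisors_le_comap_nonZeroDivisors_of_injective _ hinj)).comp
    (RatFunc.algEquivOfTranscendental x hx).symm.toAlgHom, ?_⟩
  have h1 : (RatFunc.algEquivOfTranscendental x hx).symm
      (IntermediateField.AdjoinSimple.gen ℂ x) = algebraMap ℂ[X] (RatFunc ℂ) X := by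
    simp
  simp only [AlgHom.comp_apply]
  change RatFunc.liftAlgHom _ _ ((RatFunc.algEquivOfTranscendental x hx).symm
      (IntermediateField.AdjoinSimple.gen ℂ x)) = _
  rw [h1]
  have := RatFunc.liftAlgHom_apply_div (aeval (R := ℂ) (HahnSeries.single (-1 : ℤ) (1 : ℂ)))
    (nonZeroDivisors_le_comap_nonZeroDivisors_of_injective _ hinj) X 1
  simpa using this

/-- A rational function of `x` that vanishes at infinity to order at least `b`. -/
def VanishesAtInfinity (x : K) (b : ℕ) (r : K) : Prop :=
  ∃ q p : ℂ[X], q.eval 0 ≠ 0 ∧ aeval x⁻¹ q * r = x⁻¹ ^ b * aeval x⁻¹ p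

variable {x : K} {σ : ℂ⟮x⟯ →ₐ[ℂ] ℂ⸨X⸩}
  (hσ : σ (IntermediateField.AdjoinSimple.gen ℂ x) = HahnSeries.single (-1 : ℤ) (1 : ℂ))

include hσ

lemma laurent_inv_gen : σ (IntermediateField.AdjoinSimple.gen ℂ x)⁻¹ =
    HahnSeries.single (1 : ℤ) (1 : ℂ) := by
  rw [map_inv₀, hσ, HahnSeries.inv_single]; simp

lemma coeff_eq_zero_of_vanishesAtInfinity {r : ℂ⟮x⟯} {b : ℕ} (hr : VanishesAtInfinity x b (r : K))
    (j : ℤ) (hj : j < b) : (σ r).coeff j = 0 := by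
  obtain ⟨q, p, hq, hqr⟩ := hr
  have h1 : aeval (IntermediateField.AdjoinSimple.gen ℂ x)⁻¹ q * r =
      (IntermediateField.AdjoinSimple.gen ℂ x)⁻¹ ^ b *
        aeval (IntermediateField.AdjoinSimple.gen ℂ x)⁻¹ p := by
    apply Subtype.ext
    have hc : ∀ q : ℂ[X], ((aeval (IntermediateField.AdjoinSimple.gen ℂ x)⁻¹ q : ℂ⟮x⟯) : K) =
        aeval x⁻¹ q := fun q => by
      have := Polynomial.aeval_algHom_apply (IntermediateField.val ℂ⟮x⟯)
        (IntermediateField.AdjoinSimple.gen ℂ x)⁻¹ q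
      rw [← IntermediateField.coe_val, ← this]
      simp
    simp only [MulMemClass.coe_mul, SubmonoidClass.coe_pow, hc]
    simpa using hqr
  have h2 := congrArg σ h1
  rw [map_mul, map_mul, map_pow, ← Polynomial.aeval_algHom_apply, ← Polynomial.aeval_algHom_apply,
    laurent_inv_gen hσ, aeval_single_one, aeval_single_one, ← HahnSeries.ofPowerSeries_X,
    ← map_pow, ← map_mul] at h2
  have hu : (q : PowerSeries ℂ)⁻¹ * (q : PowerSeries ℂ) = 1 := by
    apply PowerSeries.inv_mul_cancel
    simpa [Polynomial.coeff_zero_eq_eval_zero] using hq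
  have h3 : σ r = HahnSeries.ofPowerSeries ℤ ℂ
      (PowerSeries.X ^ b * ((q : PowerSeries ℂ)⁻¹ * (p : PowerSeries ℂ))) := by
    have := congrArg (fun t => HahnSeries.ofPowerSeries ℤ ℂ (q : PowerSeries ℂ)⁻¹ * t) h2
    simp only [← mul_assoc, ← map_mul, hu, map_one, one_mul] at this
    rw [this]
    congr 1; ring
  rw [h3, PowerSeries.coeff_coe]
  split_ifs with h0
  · rfl
  · rw [PowerSeries.coeff_X_pow_mul', if_neg (by omega)]

lemma coeff_aeval_gen (p : ℂ[X]) (j : ℤ) :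
    (σ (aeval (IntermediateField.AdjoinSimple.gen ℂ x) p)).coeff j =
      if j ≤ 0 then p.coeff (-j).toNat else 0 := by
  rw [← Polynomial.aeval_algHom_apply, hσ, coeff_aeval_single_neg_one]

/-- Write r as a quotient of polynomials in w = 1/x and split the power wᵉ off the denominator.
Comparing power series shows that w^(e+b) divides the numerator. -/
lemma vanishesAtInfinity_of_coeff_eq_zero (hx : x ≠ 0) {r : ℂ⟮x⟯} {b : ℕ}
    (hr : ∀ j : ℤ, j < b → (σ r).coeff j = 0) : VanishesAtInfinity x b (r : K) := by
  have hw : ∀ q : ℂ[X], ((aeval (IntermediateField.AdjoinSimple.gen ℂ x)⁻¹ q : ℂ⟮x⟯) : K) =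
      aeval x⁻¹ q := fun q => by
    have := Polynomial.aeval_algHom_apply (IntermediateField.val ℂ⟮x⟯)
      (IntermediateField.AdjoinSimple.gen ℂ x)⁻¹ q
    rw [← IntermediateField.coe_val, ← this]
    simp
  have hmem : (r : K) ∈ ℂ⟮x⁻¹⟯ := by
    have hle : ℂ⟮x⟯ ≤ ℂ⟮x⁻¹⟯ := by
      rw [IntermediateField.adjoin_simple_le_iff]
      have := inv_mem (IntermediateField.mem_adjoin_simple_self ℂ x⁻¹)
      rwa [inv_inv] at this
    exact hle r.2
  obtain ⟨n, d, hnd⟩ := (IntermediateField.mem_adjoin_simple_iff ℂ _).1 hmem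
  by_cases hd : aeval x⁻¹ d = 0
  · rw [hd, div_zero] at hnd
    exact ⟨1, 0, by simp, by simp [hnd]⟩
  have hd0 : d ≠ 0 := by rintro rfl; simp at hd
  obtain ⟨q, hdq, hq⟩ := Polynomial.exists_eq_pow_rootMultiplicity_mul_and_not_dvd d hd0 0
  rw [C_0, sub_zero] at hdq hq
  set e := d.rootMultiplicity 0
  have hq0 : q.eval 0 ≠ 0 := by
    rwa [Polynomial.X_dvd_iff, Polynomial.coeff_zero_eq_eval_zero] at hq
  have h1 : aeval (IntermediateField.AdjoinSimple.gen ℂ x)⁻¹ (X ^ e * q) * r =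
      aeval (IntermediateField.AdjoinSimple.gen ℂ x)⁻¹ n := by
    apply Subtype.ext
    rw [MulMemClass.coe_mul, hw, hw, ← hdq, hnd, mul_div_cancel₀ _ hd]
  have h2 := congrArg σ h1
  obtain ⟨g, hg⟩ := exists_powerSeries_of_coeff_eq_zero _ _ hr
  rw [map_mul, ← Polynomial.aeval_algHom_apply, ← Polynomial.aeval_algHom_apply,
    laurent_inv_gen hσ, aeval_single_one, aeval_single_one, hg, ← map_mul] at h2
  have h3 := HahnSeries.ofPowerSeries_injective h2
  have h4 : (X : ℂ[X]) ^ (e + b) ∣ n := by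
    rw [Polynomial.X_pow_dvd_iff]
    intro i hi
    rw [← Polynomial.coeff_coe, ← h3, Polynomial.coe_mul, Polynomial.coe_pow, Polynomial.coe_X]
    rw [show (PowerSeries.X : PowerSeries ℂ) ^ e * (q : PowerSeries ℂ) * (PowerSeries.X ^ b * g) =
      PowerSeries.X ^ (e + b) * ((q : PowerSeries ℂ) * g) by ring]
    rw [PowerSeries.coeff_X_pow_mul', if_neg (by omega)]
  obtain ⟨m, hm⟩ := h4
  refine ⟨q, m, hq0, ?_⟩
  have h5 := congrArg (Subtype.val) h1
  rw [MulMemClass.coe_mul, hw, hw, hm] at h5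
  simp only [map_mul, map_pow, aeval_X, pow_add] at h5
  have hxe : (x⁻¹) ^ e ≠ 0 := pow_ne_zero _ (inv_ne_zero hx)
  apply mul_left_cancel₀ hxe
  linear_combination h5

lemma exists_polynomial_sub_vanishesAtInfinity (hx : x ≠ 0) {r : ℂ⟮x⟯} {b : ℕ}
    (hr : ∀ j : ℤ, 0 < j → j < b → (σ r).coeff j = 0) :
    ∃ p : ℂ[X], VanishesAtInfinity x b ((r : K) - aeval x p) := by
  -- Below the order all coefficients vanish, so the part with non-positive exponents is a
  -- polynomial in x of degree at most N.
  set N := (σ r).order.natAbs with hN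
  let p : ℂ[X] := ∑ i ∈ Finset.range (N + 1), monomial i ((σ r).coeff (-i))
  have hp : ∀ n : ℕ, p.coeff n = (σ r).coeff (-n) := by
    intro n
    simp only [p, Polynomial.finsetSum_coeff, Polynomial.coeff_monomial]
    rw [Finset.sum_ite_eq']
    split_ifs with h
    · rfl
    · rw [HahnSeries.coeff_eq_zero_of_lt_order]
      rw [Finset.mem_range] at h
      omega
  refine ⟨p, ?_⟩
  have := vanishesAtInfinity_of_coeff_eq_zero hσ hx
    (r := r - aeval (IntermediateField.AdjoinSimple.gen ℂ x) p) (b := b) (fun j hj => by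
      rw [map_sub, HahnSeries.coeff_sub, coeff_aeval_gen hσ]
      split_ifs with h0
      · rw [hp, sub_eq_zero]; congr 1; omega
      · rw [hr j (by omega) hj, sub_zero])
  convert this using 2
  rw [AddSubgroupClass.coe_sub]
  congr 1
  have := Polynomial.aeval_algHom_apply (IntermediateField.val ℂ⟮x⟯)
    (IntermediateField.AdjoinSimple.gen ℂ x) p
  rw [← IntermediateField.coe_val, ← this]
  simp

end Laurent
end

noncomputable section

/-! ## The genus of a plane quintic in terms of the normalization of an affine chart -/

section GenusFormula

open Polynomial
open scoped IntermediateField IntermediateField.algebraAdjoinAdjoin LaurentSeries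

variable {K : Type*} [Field K] [Algebra ℂ K]

lemma exists_sum_of_mem_adjoin {A L : Type*} [CommRing A] [CommRing L] [Algebra A L] [Nontrivial A]
    {s : L} {g : A[X]} {n : ℕ} (hg : g.Monic) (hdeg : g.natDegree = n) (hn : n ≠ 0)
    (h0 : aeval s g = 0) {z : L} (hz : z ∈ Algebra.adjoin A {s}) :
    ∃ a : Fin n → A, z = ∑ b : Fin n, algebraMap A L (a b) * s ^ (b : ℕ) := by
  obtain ⟨p, rfl⟩ := mem_adjoin_singleton_iff_aeval.1 hz
  have hlt : (p %ₘ g).natDegree < n := hdeg ▸ Polynomial.natDegree_modByMonic_lt p hg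
    (by rintro rfl; simp at hdeg; exact hn hdeg.symm)
  refine ⟨fun b => (p %ₘ g).coeff b, ?_⟩
  conv_lhs => rw [← Polynomial.modByMonic_add_div p g]
  rw [map_add, map_mul, h0, zero_mul, add_zero, Polynomial.aeval_eq_sum_range' hlt,
    ← Fin.sum_univ_eq_sum_range (fun i => (p %ₘ g).coeff i • s ^ i)]
  exact Finset.sum_congr rfl fun b _ => Algebra.smul_def _ _

namespace IsPlaneChart

variable {Φ : MvPolynomial (Fin 3) ℂ} {x y : K} (h : IsPlaneChart Φ x y)

include h

/-- Near infinity the ring is spanned by the powers (y/x)ᵇ, b ≤ 4, over the local ring of ℂ[1/x] at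
0. In terms of yᵇ the coefficient acquires the factor x⁻ᵇ. -/
lemma mem_infinityRing_iff (B : Module.Basis (Fin 5) ℂ⟮x⟯ K) (hB : ∀ b : Fin 5, B b = y ^ (b : ℕ))
    (z : K) : z ∈ infinityRing x y ↔ ∀ b : Fin 5, VanishesAtInfinity x b (B.repr z b : K) := by
  have hx0 := h.ne_zero
  rw [mem_infinityRing]
  constructor
  · rintro ⟨q, hq, hqz⟩ b
    obtain ⟨g, hg, hdeg, h0, -⟩ := h.exists_monic_infinity
    rw [adjoin_infinity_eq, Subalgebra.mem_restrictScalars] at hqz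
    obtain ⟨a, ha⟩ := exists_sum_of_mem_adjoin hg hdeg (by norm_num) h0 hqz
    have hp : ∀ b, ∃ p : ℂ[X], aeval x⁻¹ p = (a b : K) := fun b =>
      mem_adjoin_singleton_iff_aeval.1 (a b).2
    choose p hp using hp
    have hv : ∀ q : ℂ[X], ((aeval (IntermediateField.AdjoinSimple.gen ℂ x)⁻¹ q : ℂ⟮x⟯) : K) =
        aeval x⁻¹ q := fun q => by
      have := Polynomial.aeval_algHom_apply (IntermediateField.val ℂ⟮x⟯)
        (IntermediateField.AdjoinSimple.gen ℂ x)⁻¹ q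
      rw [← IntermediateField.coe_val, ← this]
      simp
    set w : ℂ⟮x⟯ := (IntermediateField.AdjoinSimple.gen ℂ x)⁻¹ with hw
    have hwK : (w : K) = x⁻¹ := by simp [hw]
    have e : aeval w q • z = ∑ b : Fin 5, (w ^ (b : ℕ) * aeval w (p b)) • B b := by
      rw [Algebra.smul_def]
      change ((aeval w q : ℂ⟮x⟯) : K) * z = _
      rw [hv, ha]
      refine Finset.sum_congr rfl fun b _ => ?_
      rw [Algebra.smul_def, hB]
      change (a b : K) * _ = ((w ^ (b : ℕ) * aeval w (p b) : ℂ⟮x⟯) : K) * _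
      rw [MulMemClass.coe_mul, SubmonoidClass.coe_pow, hv, hp, hwK, mul_pow]
      ring
    have e2 := congrArg (fun t => B.repr t b) e
    simp only [map_smul, Finsupp.smul_apply, smul_eq_mul] at e2
    rw [B.repr_sum_self] at e2
    refine ⟨q, p b, hq, ?_⟩
    have e3 := congrArg Subtype.val e2
    rw [MulMemClass.coe_mul, MulMemClass.coe_mul, SubmonoidClass.coe_pow, hv, hv, hwK] at e3
    exact e3
  · intro hz
    rw [← mem_infinityRing, ← B.sum_repr z]
    refine sum_mem fun b _ => ?_
    obtain ⟨q, p, hq, hqp⟩ := hz b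
    refine mem_infinityRing.2 ⟨q, hq, ?_⟩
    rw [hB, Algebra.smul_def]
    change aeval x⁻¹ q * ((B.repr z b : K) * y ^ (b : ℕ)) ∈ _
    have e : aeval x⁻¹ q * ((B.repr z b : K) * y ^ (b : ℕ)) =
        aeval x⁻¹ p * (y * x⁻¹) ^ (b : ℕ) := by
      rw [← mul_assoc, hqp, mul_pow]; ring
    rw [e]
    exact mul_mem (Algebra.adjoin_mono (by simp) (aeval_mem_adjoin_singleton ℂ x⁻¹ (p := p)))
      (pow_mem (Algebra.subset_adjoin (by simp)) _)

/-- The arithmetic genus of a plane quintic is `6`. -/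
theorem finrank_quotient_affine_sup_infinity :
    Module.finrank ℂ (K ⧸ (Subalgebra.toSubmodule (Algebra.adjoin ℂ {x, y}) ⊔
      infinityRing x y)) = 6 := by
  obtain ⟨B, hB⟩ := h.exists_basis
  obtain ⟨σ, hσ⟩ := exists_laurent_expansion h.transcendental
  have hsmul : ∀ (c : ℂ) (z : K), c • z = algebraMap ℂ ℂ⟮x⟯ c • z := fun c z => by
    rw [algebraMap_smul]
  -- In the coefficient of yᵇ, exponents ≤ 0 belong to ℂ[x, y] and exponents ≥ b to the ring at
  -- infinity. The exponents 1, …, b - 1 survive, indexed from 0 and hence shifted by 1; there are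
  -- none for b = 0, 1. In total 0+0+1+2+3 = 6.
  let Λ : K →ₗ[ℂ] ((i : (b : Fin 5) × Fin (b - 1)) → ℂ) :=
    LinearMap.pi fun i =>
      { toFun := fun z => (σ (B.repr z i.1)).coeff ((i.2 : ℕ) + 1)
        map_add' := fun a b => by simp
        map_smul' := fun c z => by
          rw [hsmul, map_smul, Finsupp.smul_apply, smul_eq_mul, map_mul, AlgHom.commutes,
            algebraMap_laurentSeries, HahnSeries.C_mul_eq_smul, HahnSeries.coeff_smul]
          rfl }
  have hΛ : ∀ z i, Λ z i = (σ (B.repr z i.1)).coeff ((i.2 : ℕ) + 1) := fun _ _ => rfl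
  have hker : LinearMap.ker Λ =
      Subalgebra.toSubmodule (Algebra.adjoin ℂ {x, y}) ⊔ infinityRing x y := by
    apply le_antisymm
    · intro z hz
      have hz' : ∀ b : Fin 5, ∃ p : ℂ[X], VanishesAtInfinity x b ((B.repr z b : K) - aeval x p) := by
        intro b
        refine exists_polynomial_sub_vanishesAtInfinity hσ h.ne_zero fun j hj hjb => ?_
        have := congrFun (LinearMap.mem_ker.1 hz) ⟨b, ⟨(j - 1).toNat, by omega⟩⟩
        rw [hΛ] at this
        simp only [Pi.zero_apply] at this
        rwa [show (((j - 1).toNat : ℕ) : ℤ) + 1 = j by omega] at this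
      choose p hp using hz'
      have hgen : ∀ p : ℂ[X], ((aeval (IntermediateField.AdjoinSimple.gen ℂ x) p : ℂ⟮x⟯) : K) =
          aeval x p := fun p => by
        have := Polynomial.aeval_algHom_apply (IntermediateField.val ℂ⟮x⟯)
          (IntermediateField.AdjoinSimple.gen ℂ x) p
        rw [← IntermediateField.coe_val, ← this]
        simp
      have e : z = ∑ b, aeval (IntermediateField.AdjoinSimple.gen ℂ x) (p b) • B b +
          ∑ b, (B.repr z b - aeval (IntermediateField.AdjoinSimple.gen ℂ x) (p b)) • B b := by
        rw [← Finset.sum_add_distrib]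
        conv_lhs => rw [← B.sum_repr z]
        exact Finset.sum_congr rfl fun b _ => by rw [← add_smul, add_sub_cancel]
      rw [e]
      refine Submodule.add_mem_sup ?_ ?_
      · rw [Subalgebra.mem_toSubmodule, h.mem_adjoin_iff B hB]
        intro b
        rw [B.repr_sum_self, hgen]
        exact aeval_mem_adjoin_singleton ℂ x
      · rw [h.mem_infinityRing_iff B hB]
        intro b
        rw [B.repr_sum_self, AddSubgroupClass.coe_sub, hgen]
        exact hp b
    · refine sup_le ?_ ?_
      · intro z hz
        rw [LinearMap.mem_ker]
        ext i
        rw [hΛ]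
        obtain ⟨p, hp⟩ := mem_adjoin_singleton_iff_aeval.1 ((h.mem_adjoin_iff B hB z).1 hz i.1)
        have : B.repr z i.1 = aeval (IntermediateField.AdjoinSimple.gen ℂ x) p := by
          apply Subtype.ext
          rw [← hp]
          have := Polynomial.aeval_algHom_apply (IntermediateField.val ℂ⟮x⟯)
            (IntermediateField.AdjoinSimple.gen ℂ x) p
          rw [← IntermediateField.coe_val, ← this]
          simp
        rw [this, coeff_aeval_gen hσ, if_neg (by omega)]
        rfl
      · intro z hz
        rw [LinearMap.mem_ker]
        ext i
        rw [hΛ]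
        refine coeff_eq_zero_of_vanishesAtInfinity hσ ((h.mem_infinityRing_iff B hB z).1 hz i.1) _ ?_
        have := i.2.2
        omega
  have hsurj : Function.Surjective Λ := by
    intro t
    refine ⟨∑ i, t i • ((IntermediateField.AdjoinSimple.gen ℂ x)⁻¹ ^ ((i.2 : ℕ) + 1) • B i.1), ?_⟩
    ext i
    rw [map_sum, Finset.sum_apply, Finset.sum_eq_single i]
    · rw [Λ.map_smul, Pi.smul_apply, hΛ, map_smul, Finsupp.smul_apply, B.repr_self,
        Finsupp.single_eq_same, smul_eq_mul, smul_eq_mul, mul_one, map_pow, laurent_inv_gen hσ,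
        HahnSeries.single_pow]
      simp
    · rintro j - hji
      rw [Λ.map_smul, Pi.smul_apply, hΛ, map_smul, Finsupp.smul_apply, B.repr_self, smul_eq_mul,
        smul_eq_mul, Finsupp.single_apply]
      split_ifs with hb
      · rw [mul_one, map_pow, laurent_inv_gen hσ, HahnSeries.single_pow]
        rw [HahnSeries.coeff_single, if_neg, mul_zero]
        intro hc
        apply hji
        obtain ⟨i1, i2⟩ := i
        obtain ⟨j1, j2⟩ := j
        simp only at hb
        subst hb
        simp only [nsmul_eq_mul, mul_one] at hc
        congr 1
        apply Fin.ext
        push_cast at hc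
        omega
      · simp
    · exact fun hi => absurd (Finset.mem_univ i) hi
  rw [← hker, (Λ.quotKerEquivOfSurjective hsurj).finrank_eq, Module.finrank_pi]
  simp [Fintype.card_sigma, Fin.sum_univ_five]

lemma isDedekindDomain_normalization : IsDedekindDomain (normalization x) :=
  _root_.isDedekindDomain_normalization h.transcendental h.isIntegral h.adjoin_eq_top

lemma adjoin_le_normalization : Algebra.adjoin ℂ {x, y} ≤ normalization x := by
  rw [Algebra.adjoin_le_iff]
  rintro z (rfl | hz)
  · exact self_mem_normalization _
  · rw [Set.mem_singleton_iff.1 hz]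
    exact h.isIntegral

theorem functionFieldGenus_eq (hsep : (MvPolynomial.aeval ![1, X, 0] Φ : ℂ[X]).Separable) :
    functionFieldGenus ℂ K = Module.finrank ℂ
      (K ⧸ (Subalgebra.toSubmodule (normalization x) ⊔ infinityRing x y)) := by
  have := h.isDedekindDomain_normalization
  have := isFractionRing_normalization h.isIntegral h.adjoin_eq_top
  have := _root_.isDedekindDomain_normalization h.transcendental_inv h.isIntegral_infinity
    h.adjoin_infinity_eq_top
  have := isFractionRing_normalization h.isIntegral_infinity h.adjoin_infinity_eq_top
  rw [functionFieldGenus_eq_finrank_quotient (normalization x) (normalization x⁻¹)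
    (fun v => ?_) (fun z hz => mem_normalization_of_mem_places hz), h.integralAtInfinity_eq hsep]
  simp only [normalization_le_place_iff]
  exact v.1.mem_or_inv_mem x

/-- The geometric genus drops from `6` by the colength of the coordinate ring of the affine chart
in its normalization. -/
theorem functionFieldGenus_add_finrank
    (hsep : (MvPolynomial.aeval ![1, X, 0] Φ : ℂ[X]).Separable) :
    FiniteDimensional ℂ (normalization x ⧸ (Subalgebra.toSubmodule (Algebra.adjoin ℂ {x, y})).comap
      (normalization x).val.toLinearMap) ∧
    functionFieldGenus ℂ K + Module.finrank ℂ (normalization x ⧸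
      (Subalgebra.toSubmodule (Algebra.adjoin ℂ {x, y})).comap
        (normalization x).val.toLinearMap) = 6 := by
  set R := Subalgebra.toSubmodule (Algebra.adjoin ℂ {x, y}) with hR
  set S := Subalgebra.toSubmodule (normalization x) with hS
  set T := infinityRing x y with hT
  have hRS : R ≤ S := h.adjoin_le_normalization
  have h6 : Module.finrank ℂ (K ⧸ (R ⊔ T)) = 6 := h.finrank_quotient_affine_sup_infinity
  have hfin : FiniteDimensional ℂ (K ⧸ (R ⊔ T)) := FiniteDimensional.of_finrank_pos (by omega)
  -- An element of S ∩ T has no poles at all, so it is constant.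
  have hST : ∀ z, z ∈ S → z ∈ T → z ∈ R := by
    intro z hzS hzT
    rw [hT, ← h.integralAtInfinity_eq hsep, mem_integralAtInfinity] at hzT
    obtain ⟨c, hc⟩ := mem_range_of_mem_all_places (z := z) fun v => by
      by_cases hv : ∀ d : normalization x, (d : K) ∈ v.1
      · exact hv ⟨z, hzS⟩
      · exact hzT v hv
    rw [← hc]
    exact Subalgebra.algebraMap_mem _ c
  -- Exactness of 0 → S/R → K/(R + T) → K/(S + T) → 0; injectivity on the left is `hST`.
  let L : normalization x →ₗ[ℂ] K ⧸ (R ⊔ T) :=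
    (R ⊔ T).mkQ ∘ₗ (normalization x).val.toLinearMap
  have hker : LinearMap.ker L = R.comap (normalization x).val.toLinearMap := by
    ext z
    rw [LinearMap.mem_ker, Submodule.mem_comap]
    change (R ⊔ T).mkQ (z : K) = 0 ↔ (z : K) ∈ R
    rw [Submodule.mkQ_apply, Submodule.Quotient.mk_eq_zero, Submodule.mem_sup]
    constructor
    · rintro ⟨r, hr, t, ht, e⟩
      have : t ∈ R := hST t (by
        rw [← sub_eq_iff_eq_add'.2 e.symm]
        exact sub_mem z.2 (hRS hr)) ht
      rw [← e]
      exact add_mem hr this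
    · intro hz
      exact ⟨z, hz, 0, zero_mem _, add_zero _⟩
  have hrange : LinearMap.range L = (S ⊔ T).map (R ⊔ T).mkQ := by
    rw [LinearMap.range_comp]
    have h1 : LinearMap.range (normalization x).val.toLinearMap = S := by
      ext z
      constructor
      · rintro ⟨a, rfl⟩; exact a.2
      · intro hz; exact ⟨⟨z, hz⟩, rfl⟩
    rw [h1, Submodule.map_sup]
    have h2 : T.map (R ⊔ T).mkQ = ⊥ := by
      rw [← LinearMap.le_ker_iff_map, Submodule.ker_mkQ]
      exact le_sup_right
    rw [h2, sup_bot_eq]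
  have e1 := L.quotKerEquivRange
  rw [hker] at e1
  have hfin2 : FiniteDimensional ℂ (normalization x ⧸ R.comap (normalization x).val.toLinearMap) :=
    e1.symm.finiteDimensional
  refine ⟨hfin2, ?_⟩
  rw [h.functionFieldGenus_eq hsep, e1.finrank_eq, ← h6,
    ← Submodule.finrank_quotient_add_finrank (LinearMap.range L), hrange]
  congr 1
  exact (Submodule.quotientQuotientEquivQuotient (R ⊔ T) (S ⊔ T)
    (sup_le_sup_right hRS T)).finrank_eq.symm

end IsPlaneChart

end GenusFormula
end

noncomputable section

/-! ## Square-zero ideals in some artinian local algebras -/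

/-- Nakayama for a nilpotent ideal, by iterating the inclusion. -/
lemma Ideal.eq_bot_of_le_pow_succ {A : Type*} [CommRing A] {m : Ideal A} {M i : ℕ} (hM : m ^ M = ⊥)
    (h : m ^ i ≤ m ^ (i + 1)) : m ^ i = ⊥ := by
  have key : ∀ j, m ^ i ≤ m ^ (i + j) := by
    intro j
    induction j with
    | zero => simp
    | succ j ih =>
      calc m ^ i ≤ m ^ (i + 1) := h
        _ = m ^ i * m := pow_succ _ _
        _ ≤ m ^ (i + j) * m := Ideal.mul_mono_left ih
        _ = m ^ (i + (j + 1)) := by rw [← pow_succ]; rfl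
  rw [eq_bot_iff, ← hM]
  exact (key M).trans (Ideal.pow_le_pow_right (Nat.le_add_left _ _))

section Artinian

variable {A : Type*} [CommRing A] [Algebra ℂ A] {m : Ideal A}

lemma exists_sub_smul_pow_mem {X : A} (hX : ∀ z ∈ m, ∃ c : ℂ, z - c • X ∈ m ^ 2) (i : ℕ)
    (hi : i ≠ 0) (hXm : X ∈ m) : ∀ z ∈ m ^ i, ∃ c : ℂ, z - c • X ^ i ∈ m ^ (i + 1) := by
  induction i with
  | zero => exact absurd rfl hi
  | succ i ih =>
    by_cases h0 : i = 0
    · subst h0; simpa using hX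
    intro z hz
    rw [pow_succ] at hz
    refine Submodule.mul_induction_on hz ?_ ?_
    · intro a ha b hb
      obtain ⟨c, hc⟩ := ih h0 a ha
      obtain ⟨d, hd⟩ := hX b hb
      refine ⟨c * d, ?_⟩
      have e : a * b - (c * d) • X ^ (i + 1) = (a - c • X ^ i) * b +
          (c • X ^ i) * (b - d • X) := by
        simp only [Algebra.smul_def, map_mul]; ring
      rw [e]
      refine add_mem ?_ ?_
      · rw [pow_succ]; exact Ideal.mul_mem_mul hc hb
      · rw [show i + 1 + 1 = i + 2 by ring, pow_add]
        refine Ideal.mul_mem_mul ?_ hd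
        rw [Algebra.smul_def]
        exact Ideal.mul_mem_left _ _ (Ideal.pow_mem_pow hXm i)
    · rintro a b ⟨c, hc⟩ ⟨d, hd⟩
      refine ⟨c + d, ?_⟩
      convert add_mem hc hd using 1
      rw [add_smul]; ring

/-- In a quotient of `ℂ[X]/(X^(l+1))`, a square-zero ideal has at most half the dimension. -/
lemma finrank_le_of_sq_eq_bot_of_principal {M l : ℕ} (hM : m ^ M = ⊥)
    (hA : ∀ a : A, ∃ c : ℂ, a - algebraMap ℂ A c ∈ m) {X : A} (hXm : X ∈ m)
    (hX : ∀ z ∈ m, ∃ c : ℂ, z - c • X ∈ m ^ 2) (hXl : X ^ (l + 1) ∈ m ^ (l + 2)) :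
    FiniteDimensional ℂ A ∧
      ∀ I : Ideal A, I * I = ⊥ → 2 * Module.finrank ℂ I ≤ l + 1 := by
  have hpow := fun i hi => exists_sub_smul_pow_mem hX i hi hXm
  -- Powers of X generate mⁱ modulo mⁱ⁺¹. The hypothesis on the power l + 1 therefore collapses the
  -- filtration at that step.
  have hl : m ^ (l + 1) = ⊥ := by
    refine Ideal.eq_bot_of_le_pow_succ hM fun z hz => ?_
    obtain ⟨c, hc⟩ := hpow (l + 1) (by omega) z hz
    have := add_mem hc (Ideal.mul_mem_left _ (algebraMap ℂ A c) hXl)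
    rwa [← Algebra.smul_def, sub_add_cancel] at this
  have hspan : ∀ i ≤ l + 1, ∀ a : A,
      ∃ w ∈ Submodule.span ℂ (Set.range fun j : Fin (l + 1) => X ^ (j : ℕ)), a - w ∈ m ^ i := by
    intro i
    induction i with
    | zero => intro _ a; exact ⟨0, zero_mem _, by simp⟩
    | succ i ih =>
      intro hi a
      obtain ⟨w, hw, haw⟩ := ih (by omega) a
      have : ∃ c : ℂ, a - w - c • X ^ i ∈ m ^ (i + 1) := by
        by_cases h0 : i = 0
        · subst h0
          obtain ⟨c, hc⟩ := hA (a - w)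
          refine ⟨c, ?_⟩
          simpa [Algebra.smul_def] using hc
        · exact hpow i h0 _ haw
      obtain ⟨c, hc⟩ := this
      refine ⟨w + c • X ^ i, add_mem hw (Submodule.smul_mem _ _ (Submodule.subset_span
        ⟨⟨i, by omega⟩, rfl⟩)), ?_⟩
      convert hc using 1; ring
  have htop : Submodule.span ℂ (Set.range fun j : Fin (l + 1) => X ^ (j : ℕ)) = ⊤ := by
    rw [eq_top_iff]
    intro a _
    obtain ⟨w, hw, haw⟩ := hspan (l + 1) le_rfl a
    rw [hl, Ideal.mem_bot, sub_eq_zero] at haw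
    rwa [haw]
  have hfin : FiniteDimensional ℂ A := by
    refine Module.Finite.iff_fg.2 ?_ |> fun h : Module.Finite ℂ (⊤ : Submodule ℂ A) =>
      Module.Finite.equiv Submodule.topEquiv
    rw [← htop]
    exact Submodule.fg_span (Set.finite_range _)
  refine ⟨hfin, fun I hI => ?_⟩
  have hAle : Module.finrank ℂ A ≤ l + 1 := by
    have := finrank_range_le_card (R := ℂ) (fun j : Fin (l + 1) => X ^ (j : ℕ))
    rwa [Set.finrank, htop, finrank_top, Fintype.card_fin] at this
  have hsurj : Function.Surjective (Polynomial.aeval (R := ℂ) X) := by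
    intro a
    have ha : a ∈ Submodule.span ℂ (Set.range fun j : Fin (l + 1) => X ^ (j : ℕ)) :=
      htop ▸ Submodule.mem_top
    have hle : Submodule.span ℂ (Set.range fun j : Fin (l + 1) => X ^ (j : ℕ)) ≤
        LinearMap.range (Polynomial.aeval (R := ℂ) X).toLinearMap := by
      rw [Submodule.span_le]
      rintro _ ⟨j, rfl⟩
      exact ⟨Polynomial.X ^ (j : ℕ), by simp⟩
    exact hle ha
  have : IsPrincipalIdealRing A :=
    IsPrincipalIdealRing.of_surjective (Polynomial.aeval (R := ℂ) X).toRingHom hsurj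
  obtain ⟨z, hz⟩ := (IsPrincipalIdealRing.principal I).principal
  have hzI : z ∈ I := hz ▸ Submodule.mem_span_singleton_self z
  -- I = (z) is the image of multiplication by z, and I² = 0 puts it inside the kernel. Rank–nullity
  -- then gives 2 dim I ≤ dim A.
  let L : A →ₗ[ℂ] A := LinearMap.mulLeft ℂ z
  have hrange : LinearMap.range L = I.restrictScalars ℂ := by
    ext a
    rw [Submodule.restrictScalars_mem, hz, Submodule.mem_span_singleton]
    constructor
    · rintro ⟨b, rfl⟩; exact ⟨b, by simp [L, mul_comm]⟩
    · rintro ⟨b, rfl⟩; exact ⟨b, by simp [L, mul_comm]⟩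
  have hker : I.restrictScalars ℂ ≤ LinearMap.ker L := by
    intro a ha
    rw [LinearMap.mem_ker]
    have : z * a ∈ I * I := Ideal.mul_mem_mul hzI ha
    rw [hI, Ideal.mem_bot] at this
    exact this
  have h1 := L.finrank_range_add_finrank_ker
  have h2 := Submodule.finrank_mono hker
  rw [hrange] at h1
  have h3 : Module.finrank ℂ (I.restrictScalars ℂ) = Module.finrank ℂ I := rfl
  omega

/-- The bound on the square of the maximal ideal used at singularities of type `D`. -/
lemma finrank_le_of_le_sq {M k : ℕ} (hk : 4 ≤ k) (hM : m ^ M = ⊥) {x y : A} (hx : x ∈ m)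
    (hy : y ∈ m) (hxy : ∀ z ∈ m, ∃ c d : ℂ, z - (c • x + d • y) ∈ m ^ 2)
    (h1 : x ^ 2 * y + y ^ (k - 1) ∈ m ^ (k + 3))
    (h2 : x ^ 2 + x * y + (k - 1 : ℂ) • y ^ (k - 2) ∈ m ^ (k + 3)) (I : Ideal A) (hI : I ≤ m ^ 2) :
    FiniteDimensional ℂ I ∧ Module.finrank ℂ I ≤ k - 1 := by
  -- This removes truncated subtraction: from here on, `k` is the index of the singularity minus 4.
  obtain ⟨k, rfl⟩ : ∃ n, k = n + 4 := ⟨k - 4, by omega⟩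
  simp only [show k + 4 - 1 = k + 3 by omega, show k + 4 - 2 = k + 2 by omega,
    show k + 4 + 3 = k + 7 by omega] at h1 h2 ⊢
  push_cast at h2
  rw [show (k : ℂ) + 4 - 1 = k + 3 by ring] at h2
  have hpm : ∀ {i j : ℕ} {z : A}, j ≤ i → z ∈ m ^ i → z ∈ m ^ j := fun hij hz =>
    Ideal.pow_le_pow_right hij hz
  have hyp : ∀ i, y ^ i ∈ m ^ i := fun i => Ideal.pow_mem_pow hy i
  have hs : ∀ {i : ℕ} {z : A} (c : ℂ), z ∈ m ^ i → c • z ∈ m ^ i := fun c hz => by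
    rw [Algebra.smul_def]; exact Ideal.mul_mem_left _ _ hz
  have hmul : ∀ {i j : ℕ} {a b : A}, a ∈ m ^ i → b ∈ m ^ j → a * b ∈ m ^ (i + j) :=
    fun ha hb => by rw [pow_add]; exact Ideal.mul_mem_mul ha hb
  have hx1 : x ∈ m ^ 1 := by simpa using hx
  have hy1 : y ∈ m ^ 1 := by simpa using hy
  -- `x y² ≡ -(k-2) y^(k-1)`
  have h3 : x * y ^ 2 + (k + 2 : ℂ) • y ^ (k + 3) ∈ m ^ (k + 7) := by
    have e : x * y ^ 2 + (k + 2 : ℂ) • y ^ (k + 3) =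
        y * (x ^ 2 + x * y + (k + 3 : ℂ) • y ^ (k + 2)) - (x ^ 2 * y + y ^ (k + 3)) := by
      simp only [Algebra.smul_def, map_add, map_natCast, map_ofNat]; ring
    rw [e]
    exact sub_mem (Ideal.mul_mem_left _ _ h2) h1
  -- Elimination of x: in y(x²y + y^(k+3)) the term x²y² is rewritten twice by the relation for xy².
  have h4 : y ^ (k + 4) + ((k + 2) ^ 2 : ℂ) • y ^ (2 * k + 4) ∈ m ^ (k + 7) := by
    have e : y ^ (k + 4) + ((k + 2) ^ 2 : ℂ) • y ^ (2 * k + 4) =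
        y * (x ^ 2 * y + y ^ (k + 3)) - x * (x * y ^ 2 + (k + 2 : ℂ) • y ^ (k + 3)) +
        (k + 2 : ℂ) • (y ^ (k + 1) * (x * y ^ 2 + (k + 2 : ℂ) • y ^ (k + 3))) := by
      simp only [Algebra.smul_def, map_add, map_natCast, map_ofNat, map_pow]; ring
    rw [e]
    exact add_mem (sub_mem (Ideal.mul_mem_left _ _ h1) (Ideal.mul_mem_left _ _ h3))
      (hs _ (Ideal.mul_mem_left _ _ h3))
  -- For `D_4` the two exponents coincide and the coefficients add up to 1 + 4 = 5 ≠ 0. Otherwise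
  -- the second term has higher order.
  have h5 : y ^ (k + 4) ∈ m ^ (k + 5) := by
    by_cases hk0 : k = 0
    · subst hk0
      have e : y ^ (0 + 4) = (5⁻¹ : ℂ) • (y ^ (0 + 4) + (((0 : ℕ) + 2) ^ 2 : ℂ) • y ^ (2 * 0 + 4)) := by
        have e4 : y ^ 4 + (4 : ℂ) • y ^ 4 = (5 : ℂ) • y ^ 4 := by
          rw [show (5 : ℂ) = 1 + 4 by norm_num, add_smul, one_smul]
        rw [show (2 * 0 + 4) = 4 by rfl,
          show (((0 : ℕ) : ℂ) + 2) ^ 2 = 4 by norm_num, e4, smul_smul]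
        norm_num
      rw [e]
      exact hs _ (hpm (by omega) h4)
    · have := sub_mem (hpm (by omega) h4) (hs ((k + 2) ^ 2 : ℂ) (hpm (by omega) (hyp (2 * k + 4))) :
        _ ∈ m ^ (k + 5))
      rwa [add_sub_cancel_right] at this
  -- Relation `h2` eliminates x² from m²/m³. It contributes -3y² only for `D_4`, where y^(k+2) is
  -- itself quadratic.
  have hstep2 : ∀ z ∈ m ^ 2, ∃ c d : ℂ, z - (c • (x * y) + d • y ^ 2) ∈ m ^ 3 := by
    intro z hz
    rw [pow_two] at hz
    refine Submodule.mul_induction_on hz ?_ ?_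
    · intro a ha b hb
      obtain ⟨c, d, ha'⟩ := hxy a ha
      obtain ⟨c', d', hb'⟩ := hxy b hb
      have hmain : ∃ u v : ℂ, x ^ 2 - (u • (x * y) + v • y ^ 2) ∈ m ^ 3 := by
        by_cases hk0 : k = 0
        · subst hk0
          refine ⟨-1, -3, ?_⟩
          convert hpm (show 3 ≤ 0 + 7 by omega) h2 using 1
          simp only [Algebra.smul_def, map_add, map_neg, map_one, map_ofNat, map_natCast]
          push_cast; ring
        · refine ⟨-1, 0, ?_⟩
          convert sub_mem (hpm (show 3 ≤ k + 7 by omega) h2)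
            (hs (k + 3 : ℂ) (hpm (show 3 ≤ k + 2 by omega) (hyp (k + 2)))) using 1
          simp only [neg_smul, one_smul, zero_smul]; ring
      obtain ⟨u, v, huv⟩ := hmain
      refine ⟨c * d' + d * c' + c * c' * u, d * d' + c * c' * v, ?_⟩
      have e : a * b - ((c * d' + d * c' + c * c' * u) • (x * y) + (d * d' + c * c' * v) • y ^ 2) =
          (a - (c • x + d • y)) * b + (c • x + d • y) * (b - (c' • x + d' • y)) +
          (c * c') • (x ^ 2 - (u • (x * y) + v • y ^ 2)) := by
        simp only [Algebra.smul_def, map_add, map_mul]; ring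
      rw [e]
      refine add_mem (add_mem ?_ ?_) (hs _ huv)
      · exact hmul ha' (by simpa using hb : b ∈ m ^ 1)
      · exact hmul (i := 1) (add_mem (hs _ hx1) (hs _ hy1)) hb'
    · rintro a b ⟨c, d, hc⟩ ⟨c', d', hd⟩
      refine ⟨c + c', d + d', ?_⟩
      convert add_mem hc hd using 1
      simp only [add_smul]; ring
  have hxy2 : x * y ^ 2 ∈ m ^ (k + 3) := by
    have := sub_mem (hpm (by omega) h3) (hs (k + 2 : ℂ) (hyp (k + 3)))
    rwa [add_sub_cancel_right] at this
  -- Thus from degree 3 on, each graded piece of the m-adic filtration is spanned by the power of y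
  -- alone.
  have hxyi : ∀ i, 3 ≤ i → x * y ^ i ∈ m ^ (i + 2) := by
    intro i hi
    obtain ⟨i, rfl⟩ : ∃ n, i = n + 3 := ⟨i - 3, by omega⟩
    by_cases hk0 : k = 0
    · subst hk0
      have e : x * y ^ (i + 3) = y ^ (i + 1) * (x * y ^ 2 + (((0 : ℕ) : ℂ) + 2) • y ^ (0 + 3)) -
          (((0 : ℕ) : ℂ) + 2) • (y ^ i * y ^ (0 + 4)) := by
        simp only [Algebra.smul_def]; ring
      rw [e]
      exact sub_mem (hpm (by omega) (hmul (hyp (i + 1)) h3)) (hs _ (hpm (by omega)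
        (hmul (hyp i) h5)))
    · have e : x * y ^ (i + 3) = y ^ (i + 1) * (x * y ^ 2) := by ring
      rw [e]
      exact hpm (by omega) (hmul (hyp (i + 1)) hxy2)
  have hstep : ∀ i, 3 ≤ i → ∀ z ∈ m ^ i, ∃ c : ℂ, z - c • y ^ i ∈ m ^ (i + 1) := by
    intro i hi
    induction i, hi using Nat.le_induction with
    | base =>
      intro z hz
      rw [pow_succ] at hz
      refine Submodule.mul_induction_on hz ?_ ?_
      · intro a ha b hb
        obtain ⟨c, d, ha'⟩ := hstep2 a ha
        obtain ⟨c', d', hb'⟩ := hxy b hb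
        have hw : ∃ u : ℂ, x ^ 2 * y - u • y ^ 3 ∈ m ^ 4 := by
          by_cases hk0 : k = 0
          · subst hk0
            refine ⟨-1, ?_⟩
            convert hpm (show 4 ≤ 0 + 7 by omega) h1 using 1
            simp
          · refine ⟨0, ?_⟩
            convert sub_mem (hpm (show 4 ≤ k + 7 by omega) h1)
              (hpm (show 4 ≤ k + 3 by omega) (hyp (k + 3))) using 1
            simp
        have hw' : ∃ u : ℂ, x * y ^ 2 - u • y ^ 3 ∈ m ^ 4 := by
          by_cases hk0 : k = 0
          · subst hk0
            refine ⟨-2, ?_⟩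
            convert hpm (show 4 ≤ 0 + 7 by omega) h3 using 1
            simp
          · refine ⟨0, ?_⟩
            convert hpm (show 4 ≤ k + 3 by omega) hxy2 using 1
            simp
        obtain ⟨u, hu⟩ := hw
        obtain ⟨v, hv⟩ := hw'
        refine ⟨c * c' * u + (c * d' + d * c') * v + d * d', ?_⟩
        have e : a * b - (c * c' * u + (c * d' + d * c') * v + d * d') • y ^ 3 =
            (a - (c • (x * y) + d • y ^ 2)) * b +
            (c • (x * y) + d • y ^ 2) * (b - (c' • x + d' • y)) +
            (c * c') • (x ^ 2 * y - u • y ^ 3) + (c * d' + d * c') • (x * y ^ 2 - v • y ^ 3) := by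
          simp only [Algebra.smul_def, map_add, map_mul]; ring
        rw [e]
        refine add_mem (add_mem (add_mem ?_ ?_) (hs _ hu)) (hs _ hv)
        · exact hmul ha' (by simpa using hb : b ∈ m ^ 1)
        · exact hmul (i := 2) (add_mem (hs _ (hmul hx1 hy1)) (hs _ (hyp 2))) hb'
      · rintro a b ⟨c, hc⟩ ⟨d, hd⟩
        refine ⟨c + d, ?_⟩
        convert add_mem hc hd using 1
        rw [add_smul]; ring
    | succ i hi ih =>
      intro z hz
      rw [pow_succ] at hz
      refine Submodule.mul_induction_on hz ?_ ?_
      · intro a ha b hb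
        obtain ⟨c, ha'⟩ := ih a ha
        obtain ⟨c', d', hb'⟩ := hxy b hb
        refine ⟨c * d', ?_⟩
        have e : a * b - (c * d') • y ^ (i + 1) =
            (a - c • y ^ i) * b + (c • y ^ i) * (b - (c' • x + d' • y)) +
            (c * c') • (x * y ^ i) := by
          simp only [Algebra.smul_def, map_mul]; ring
        rw [e]
        refine add_mem (add_mem ?_ ?_) (hs _ (hxyi i hi))
        · exact hmul ha' (by simpa using hb : b ∈ m ^ 1)
        · exact hmul (i := i) (hs _ (hyp i)) hb'
      · rintro a b ⟨c, hc⟩ ⟨d, hd⟩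
        refine ⟨c + d, ?_⟩
        convert add_mem hc hd using 1
        rw [add_smul]; ring
  have hbot : m ^ (k + 4) = ⊥ := by
    refine Ideal.eq_bot_of_le_pow_succ hM fun z hz => ?_
    obtain ⟨c, hc⟩ := hstep (k + 4) (by omega) z hz
    have := add_mem hc (hs c h5)
    rwa [sub_add_cancel] at this
  -- The family xy, y², …, y^(k+3) spans m², because m^(k+4) = 0. It has k + 3 members, the index of
  -- the singularity minus one.
  let v : Fin (k + 3) → A := fun j => if (j : ℕ) = 0 then x * y else y ^ ((j : ℕ) + 1)
  have hv : ∀ i, i ≤ k + 1 → ∀ z ∈ m ^ 2, ∃ w ∈ Submodule.span ℂ (Set.range v),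
      z - w ∈ m ^ (i + 3) := by
    intro i
    induction i with
    | zero =>
      intro _ z hz
      obtain ⟨c, d, hcd⟩ := hstep2 z hz
      refine ⟨c • (x * y) + d • y ^ 2, add_mem (Submodule.smul_mem _ _ (Submodule.subset_span
        ⟨⟨0, by omega⟩, rfl⟩)) (Submodule.smul_mem _ _ (Submodule.subset_span
        ⟨⟨1, by omega⟩, rfl⟩)), hcd⟩
    | succ i ih =>
      intro hi z hz
      obtain ⟨w, hw, hzw⟩ := ih (by omega) z hz
      obtain ⟨c, hc⟩ := hstep (i + 3) (by omega) _ hzw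
      refine ⟨w + c • y ^ (i + 3), add_mem hw (Submodule.smul_mem _ _ (Submodule.subset_span
        ⟨⟨i + 2, by omega⟩, by simp [v]⟩)), ?_⟩
      convert hc using 1; ring
  have hle : I.restrictScalars ℂ ≤ Submodule.span ℂ (Set.range v) := by
    intro z hz
    obtain ⟨w, hw, hzw⟩ := hv (k + 1) le_rfl z (hI hz)
    rw [show k + 1 + 3 = k + 4 by ring, hbot, Ideal.mem_bot, sub_eq_zero] at hzw
    rwa [hzw]
  have hfin : FiniteDimensional ℂ (Submodule.span ℂ (Set.range v)) :=
    FiniteDimensional.span_of_finite ℂ (Set.finite_range v)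
  have hfinI : FiniteDimensional ℂ (I.restrictScalars ℂ) := Submodule.finiteDimensional_of_le hle
  refine ⟨hfinI, (Submodule.finrank_mono hle).trans ?_⟩
  have := finrank_range_le_card (R := ℂ) v
  rwa [Fintype.card_fin] at this

end Artinian
end

noncomputable section

/-! ## Local bounds for the quotient of a ring extension by the base ring -/

lemma exists_sub_one_mem_and_mem {P ι : Type*} [CommRing P] [DecidableEq ι] (S : Finset ι) (M : ι → Ideal P)
    (hM : ∀ i ∈ S, ∀ j ∈ S, i ≠ j → IsCoprime (M i) (M j)) {i : ι} (hi : i ∈ S) :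
    ∃ e : P, e - 1 ∈ M i ∧ ∀ j ∈ S, j ≠ i → e ∈ M j := by
  have h : IsCoprime (M i) (∏ j ∈ S.erase i, M j) := IsCoprime.prod_right fun j hj =>
    hM i hi j (Finset.mem_of_mem_erase hj) (Finset.ne_of_mem_erase hj).symm
  obtain ⟨a, ha, b, hb, hab⟩ := Ideal.isCoprime_iff_exists.1 h
  refine ⟨b, ?_, fun j hj hji => ?_⟩
  · have : b - 1 = -a := by rw [← hab]; ring
    rw [this]; exact neg_mem ha
  · exact Ideal.le_of_dvd (Finset.dvd_prod_of_mem M (Finset.mem_erase.2 ⟨hji, hj⟩)) hb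

/-- In the valuation ring obtained by localizing at Q, one of two elements divides the other; the
denominator outside Q is cleared. -/
lemma exists_notMem_mul_eq_mul {E : Type*} [CommRing E] [IsDedekindDomain E] {Q : Ideal E}
    (hQ : Q.IsPrime) {u v : E} (hu : u ≠ 0) (hv : v ≠ 0) :
    (∃ e b, e ∉ Q ∧ e * v = b * u) ∨ ∃ e b, e ∉ Q ∧ e * u = b * v := by
  have hgen : ∀ (u v : E) (n m : ℕ) (J J' : Ideal E), ¬ J ≤ Q → n ≤ m →
      Ideal.span {u} = Q ^ n * J → Ideal.span {v} = Q ^ m * J' → ∃ e b, e ∉ Q ∧ e * v = b * u := by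
    intro u v n m J J' hJ hnm hn hm
    obtain ⟨e, heJ, heQ⟩ := SetLike.not_le_iff_exists.1 hJ
    have hv0 : v ∈ Ideal.span {v} := Ideal.mem_span_singleton_self v
    rw [hm] at hv0
    have hle : Q ^ m * J' ≤ Q ^ m := Ideal.mul_le_left
    have hv : v ∈ Q ^ m := hle hv0
    have hvn : v ∈ Q ^ n := Ideal.pow_le_pow_right hnm hv
    have h0 : v * e ∈ Q ^ n * J := Ideal.mul_mem_mul hvn heJ
    have h1 : e * v ∈ Ideal.span {u} := by rw [mul_comm, hn]; exact h0
    obtain ⟨b, hb⟩ := Ideal.mem_span_singleton'.1 h1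
    exact ⟨e, b, heQ, hb.symm⟩
  obtain ⟨n, J, hJ, hn⟩ := Ideal.exists_span_singleton_eq_pow_mul hQ hu
  obtain ⟨m, J', hJ', hm⟩ := Ideal.exists_span_singleton_eq_pow_mul hQ hv
  rcases le_total n m with h | h
  · exact .inl (hgen u v n m J J' hJ h hn hm)
  · exact .inr (hgen v u m n J' J hJ' h hm hn)

/-! ### Colength bounds from square-zero ideals, and their assembly over the points -/

section LocalGlobal

variable {P : Type*} [CommRing P] [Algebra ℂ P]

/-- Let I₀ be the preimage of hE in P. Division by h maps I₀ onto E and h to 1, so E modulo the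
image of P is a quotient of I₀/(h, ker). That ideal has square zero because (he)(he') = h(hee') and
hee' comes from P. Truncation modulo a high power of M makes the bound accessible to formal
computations. -/
lemma finrank_quotient_smul_le_of_sq_eq_bot [IsNoetherianRing P] {E : Type*} [CommRing E]
    [IsDomain E] [Algebra P E] [Algebra ℂ E] [IsScalarTower ℂ P E] (M : Ideal P) {h : P}
    (hh : algebraMap P E h ≠ 0) (hE : ∀ e : E, ∃ p, algebraMap P E p = algebraMap P E h * e)
    {D n₀ : ℕ}
    (bd : ∀ n, n₀ ≤ n → ∀ I : Ideal (P ⧸ (Ideal.span {h} ⊔ RingHom.ker (algebraMap P E) ⊔ M ^ n)),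
      I * I = ⊥ → FiniteDimensional ℂ I ∧ Module.finrank ℂ I ≤ D) (N : ℕ) :
    FiniteDimensional ℂ ((E ⧸ (1 : Submodule P E)) ⧸
      (M ^ N • ⊤ : Submodule P (E ⧸ (1 : Submodule P E)))) ∧
    Module.finrank ℂ ((E ⧸ (1 : Submodule P E)) ⧸
      (M ^ N • ⊤ : Submodule P (E ⧸ (1 : Submodule P E)))) ≤ D := by
  let I₀ : Ideal P :=
    { carrier := {r | ∃ e : E, algebraMap P E r = algebraMap P E h * e}
      zero_mem' := ⟨0, by simp⟩
      add_mem' := by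
        rintro a b ⟨e, he⟩ ⟨e', he'⟩
        exact ⟨e + e', by rw [map_add, he, he', mul_add]⟩
      smul_mem' := by
        rintro c a ⟨e, he⟩
        exact ⟨algebraMap P E c * e, by rw [smul_eq_mul, map_mul, he]; ring⟩ }
  choose ψ hψ using fun r : I₀ => (r.2 : ∃ e : E, algebraMap P E r = algebraMap P E h * e)
  have huniq : ∀ (r : I₀) (e : E), algebraMap P E r = algebraMap P E h * e → ψ r = e :=
    fun r e he => mul_left_cancel₀ hh ((hψ r).symm.trans he)
  let ψl : I₀ →ₗ[P] E :=
    { toFun := ψ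
      map_add' := fun a b => huniq _ _ (by
        rw [Submodule.coe_add, map_add, hψ, hψ, mul_add])
      map_smul' := fun c a => huniq _ _ (by
        rw [Submodule.coe_smul, smul_eq_mul, map_mul, hψ, RingHom.id_apply, Algebra.smul_def]
        ring) }
  let Q := (E ⧸ (1 : Submodule P E)) ⧸ (M ^ N • ⊤ : Submodule P (E ⧸ (1 : Submodule P E)))
  let q : E →ₗ[P] Q := (Submodule.mkQ _).comp (Submodule.mkQ _)
  have hq1 : ∀ p : P, q (algebraMap P E p) = 0 := by
    intro p
    have : (Submodule.mkQ (1 : Submodule P E)) (algebraMap P E p) = 0 := by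
      rw [Submodule.mkQ_apply, Submodule.Quotient.mk_eq_zero]
      exact Submodule.mem_one.2 ⟨p, rfl⟩
    simp only [q, LinearMap.comp_apply, this, map_zero]
  have hqM : ∀ c ∈ M ^ N, ∀ e : E, q (c • e) = 0 := by
    intro c hc e
    simp only [q, LinearMap.comp_apply, map_smul]
    rw [← map_smul, Submodule.mkQ_apply, Submodule.Quotient.mk_eq_zero]
    exact Submodule.smul_mem_smul hc trivial
  -- Artin–Rees: for n ≥ k + N, an element of I₀ in Mⁿ lies in M^N I₀, so it dies in the quotient by
  -- M^N after division by h. This is why the bound is required for all large n.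
  obtain ⟨k, hk⟩ := Ideal.exists_pow_inf_eq_pow_smul M I₀
  set n := max n₀ (k + N) with hn
  let J := Ideal.span {h} ⊔ RingHom.ker (algebraMap P E) ⊔ M ^ n
  have hI₀h : Ideal.span {h} ⊔ RingHom.ker (algebraMap P E) ≤ I₀ := by
    refine sup_le ?_ ?_
    · rw [Ideal.span_singleton_le_iff_mem]
      exact ⟨1, by rw [mul_one]⟩
    · intro r hr
      exact ⟨0, by rw [mul_zero]; exact hr⟩
  have hker : ∀ r : I₀, (r : P) ∈ J → q (ψl r) = 0 := by
    rintro ⟨r, hr⟩ hrJ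
    obtain ⟨a, ha, b, hb, rfl⟩ := Submodule.mem_sup.1 hrJ
    have hbI : b ∈ I₀ := by
      have := I₀.sub_mem hr (hI₀h ha)
      rwa [add_sub_cancel_left] at this
    have e : (⟨a + b, hr⟩ : I₀) = ⟨a, hI₀h ha⟩ + ⟨b, hbI⟩ := rfl
    rw [e, map_add, map_add]
    have h1 : q (ψl ⟨a, hI₀h ha⟩) = 0 := by
      obtain ⟨c, hc, d, hd, rfl⟩ := Submodule.mem_sup.1 ha
      obtain ⟨c, rfl⟩ := Ideal.mem_span_singleton'.1 hc
      have : ψl ⟨c * h + d, hI₀h ha⟩ = algebraMap P E c := huniq _ _ (by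
        have hd : algebraMap P E d = 0 := hd
        simp only [map_add, map_mul, hd, add_zero, mul_comm])
      rw [this, hq1]
    have h2 : q (ψl ⟨b, hbI⟩) = 0 := by
      have hb' : b ∈ M ^ N • (M ^ k • ⊤ ⊓ I₀ : Ideal P) := by
        have hkn := hk n (by omega)
        have hb1 : b ∈ (M ^ n • ⊤ ⊓ I₀ : Ideal P) := ⟨by simpa using hb, hbI⟩
        rw [hkn] at hb1
        exact Submodule.smul_mono_left (Ideal.pow_le_pow_right (by omega)) hb1
      have hb2 : b ∈ M ^ N • I₀ := Submodule.smul_mono le_rfl inf_le_right hb'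
      have : ∀ b ∈ M ^ N • I₀, ∃ hbI : b ∈ I₀, q (ψl ⟨b, hbI⟩) = 0 := by
        intro b hb
        refine Submodule.smul_induction_on hb ?_ ?_
        · intro c hc d hd
          refine ⟨I₀.mul_mem_left c hd, ?_⟩
          have : (⟨c • d, I₀.mul_mem_left c hd⟩ : I₀) = c • ⟨d, hd⟩ := rfl
          rw [this, map_smul, hqM c hc]
        · rintro x y ⟨hxI, hx⟩ ⟨hyI, hy⟩
          refine ⟨I₀.add_mem hxI hyI, ?_⟩
          have : (⟨x + y, I₀.add_mem hxI hyI⟩ : I₀) = ⟨x, hxI⟩ + ⟨y, hyI⟩ := rfl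
          rw [this, map_add, map_add, hx, hy, add_zero]
      exact (this b hb2).2
    rw [h1, h2, add_zero]
  let Ib : Ideal (P ⧸ J) := I₀.map (Ideal.Quotient.mk J)
  have hIb : Ib * Ib = ⊥ := by
    rw [← Ideal.map_mul, Ideal.map_eq_bot_iff_le_ker, Ideal.mk_ker, Ideal.mul_le]
    rintro r ⟨e, he⟩ s ⟨e', he'⟩
    obtain ⟨p, hp⟩ := hE (e * e')
    have h1 : r * s - p * h ∈ RingHom.ker (algebraMap P E) := by
      rw [RingHom.mem_ker, map_sub, map_mul, map_mul, he, he', hp]; ring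
    have h2 : r * s = p * h + (r * s - p * h) := by ring
    rw [h2]
    exact Ideal.mem_sup_left (Submodule.add_mem_sup
      (Ideal.mul_mem_left _ _ (Ideal.mem_span_singleton_self h)) h1)
  obtain ⟨hfd, hfr⟩ := bd n (le_max_left _ _) Ib hIb
  let ρ : I₀ →ₗ[ℂ] Ib :=
    { toFun := fun r => ⟨Ideal.Quotient.mk J r, Ideal.mem_map_of_mem _ r.2⟩
      map_add' := fun a b => Subtype.ext (by simp)
      map_smul' := fun c a => Subtype.ext (by
        change Ideal.Quotient.mk J (c • (a : P)) = c • Ideal.Quotient.mk J (a : P)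
        exact map_smul (Ideal.Quotient.mkₐ ℂ J) c (a : P)) }
  have hρ : Function.Surjective ρ := by
    rintro ⟨x, hx⟩
    obtain ⟨r, hr, rfl⟩ := (Ideal.mem_map_iff_of_surjective _ Ideal.Quotient.mk_surjective).1 hx
    exact ⟨⟨r, hr⟩, rfl⟩
  -- The choice of a linear section is harmless, as `hker` shows that division by h kills the
  -- ambiguity.
  obtain ⟨s, hs⟩ := ρ.exists_rightInverse_of_surjective (LinearMap.range_eq_top.2 hρ)
  let τ : Ib →ₗ[ℂ] Q := ((q.comp ψl).restrictScalars ℂ).comp s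
  have hτ : Function.Surjective τ := by
    intro t
    obtain ⟨t, rfl⟩ := Submodule.mkQ_surjective _ t
    obtain ⟨e, rfl⟩ := Submodule.mkQ_surjective _ t
    obtain ⟨p, hp⟩ := hE e
    refine ⟨ρ ⟨p, e, hp⟩, ?_⟩
    have h1 : ρ (s (ρ ⟨p, e, hp⟩) - ⟨p, e, hp⟩) = 0 := by
      rw [map_sub, sub_eq_zero]; exact LinearMap.congr_fun hs _
    have h2 := hker (s (ρ ⟨p, e, hp⟩) - ⟨p, e, hp⟩) (by
      have := congrArg Subtype.val h1
      exact Ideal.Quotient.eq_zero_iff_mem.1 this)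
    rw [map_sub, map_sub, sub_eq_zero] at h2
    have h3 : ψl ⟨p, e, hp⟩ = e := huniq _ _ hp
    rw [h3] at h2
    exact h2
  have := hfd
  refine ⟨Module.Finite.of_surjective τ hτ, ?_⟩
  have := LinearMap.finrank_le_finrank_of_surjective (f := τ) hτ
  exact this.trans hfr

variable {Q : Type*} [AddCommGroup Q] [Module P Q] [Module ℂ Q] [IsScalarTower ℂ P Q]

/-- For pairwise coprime ideals the intersection of the M_i Q is (∏ M_i) Q, which is zero here. So Q
embeds in the product of the Q/M_i Q. -/
lemma finrank_le_sum_finrank_quotient {ι : Type*} (S : Finset ι) (M : ι → Ideal P)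
    (hM : ∀ i ∈ S, ∀ j ∈ S, i ≠ j → IsCoprime (M i) (M j))
    (h0 : ∀ p ∈ ∏ i ∈ S, M i, ∀ t : Q, p • t = 0) (b : ι → ℕ)
    (hb : ∀ i ∈ S, FiniteDimensional ℂ (Q ⧸ (M i • ⊤ : Submodule P Q)) ∧
      Module.finrank ℂ (Q ⧸ (M i • ⊤ : Submodule P Q)) ≤ b i) :
    Module.finrank ℂ Q ≤ ∑ i ∈ S, b i := by
  classical
  let F : Q →ₗ[ℂ] (∀ i : S, Q ⧸ (M i • ⊤ : Submodule P Q)) :=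
    LinearMap.pi fun i => (Submodule.mkQ (M i • ⊤ : Submodule P Q)).restrictScalars ℂ
  have hfd := fun i : S => (hb i i.2).1
  have hF : Function.Injective F := by
    rw [← LinearMap.ker_eq_bot, LinearMap.ker_eq_bot']
    intro t ht
    have hmem : ∀ i ∈ S, t ∈ (M i • ⊤ : Submodule P Q) := fun i hi => by
      have := congrFun ht ⟨i, hi⟩
      exact (Submodule.Quotient.mk_eq_zero _).1 this
    have key : ∀ T ⊆ S, t ∈ ((∏ i ∈ T, M i) • ⊤ : Submodule P Q) := by
      intro T
      induction T using Finset.induction_on with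
      | empty => intro _; simp
      | insert i T hi ih =>
        intro hT
        have hiS := hT (Finset.mem_insert_self i T)
        have hTS := (Finset.subset_insert i T).trans hT
        have hc : IsCoprime (M i) (∏ j ∈ T, M j) := IsCoprime.prod_right fun j hj =>
          hM i hiS j (hTS hj) (fun h => hi (h ▸ hj))
        obtain ⟨a, ha, c, hc, hac⟩ := Ideal.isCoprime_iff_exists.1 hc
        rw [Finset.prod_insert hi, ← one_smul P t, ← hac, add_smul]
        refine add_mem ?_ ?_
        · rw [mul_smul]
          exact Submodule.smul_mem_smul ha (ih hTS)
        · rw [mul_comm, mul_smul]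
          exact Submodule.smul_mem_smul hc (hmem i hiS)
    refine Submodule.smul_induction_on (key S subset_rfl) (fun p hp t _ => h0 p hp t) ?_
    intro x y hx hy
    rw [hx, hy, add_zero]
  calc Module.finrank ℂ Q ≤ Module.finrank ℂ (∀ i : S, Q ⧸ (M i • ⊤ : Submodule P Q)) :=
        LinearMap.finrank_le_finrank_of_injective hF
    _ = ∑ i : S, Module.finrank ℂ (Q ⧸ (M i • ⊤ : Submodule P Q)) := Module.finrank_pi_fintype ℂ
    _ ≤ ∑ i : S, b i := Finset.sum_le_sum fun i _ => (hb i i.2).2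
    _ = ∑ i ∈ S, b i := Finset.sum_coe_sort S b

/-- Elements outside M_i Q, multiplied by elements that are 1 modulo M_i and 0 modulo the other
ideals, are linearly independent. -/
lemma card_le_finrank [FiniteDimensional ℂ Q] {ι : Type*} (S : Finset ι) (M : ι → Ideal P)
    (hM : ∀ i ∈ S, ∀ j ∈ S, i ≠ j → IsCoprime (M i) (M j))
    (hne : ∀ i ∈ S, (M i • ⊤ : Submodule P Q) ≠ ⊤) :
    S.card ≤ Module.finrank ℂ Q := by
  classical
  choose e he1 he2 using fun i : S => exists_sub_one_mem_and_mem S M hM i.2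
  have ht : ∀ i : S, ∃ t : Q, t ∉ (M i • ⊤ : Submodule P Q) := fun i => by
    by_contra! h
    exact hne i i.2 (eq_top_iff.2 fun x _ => h x)
  choose t ht using ht
  have hli : LinearIndependent ℂ fun i : S => e i • t i := by
    rw [Fintype.linearIndependent_iff]
    intro c hc i
    by_contra hci
    refine ht i ?_
    have h1 : c i • e i • t i ∈ (M i • ⊤ : Submodule P Q) := by
      rw [← Finset.add_sum_erase _ _ (Finset.mem_univ i)] at hc
      rw [eq_neg_of_add_eq_zero_left hc]
      refine neg_mem (sum_mem fun j hj => ?_)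
      rw [← smul_algebra_smul_comm (c j) (e j) (t j)]
      exact Submodule.smul_mem_smul (he2 j i i.2 fun h => Finset.ne_of_mem_erase hj
        (Subtype.ext h.symm)) trivial
    have h2 : e i • t i ∈ (M i • ⊤ : Submodule P Q) := by
      have := Submodule.smul_of_tower_mem (M i • ⊤ : Submodule P Q) (c i)⁻¹ h1
      rwa [smul_smul, inv_mul_cancel₀ hci, one_smul] at this
    have h3 := sub_mem h2 (Submodule.smul_mem_smul (he1 i) trivial :
      (e i - 1) • t i ∈ (M i • ⊤ : Submodule P Q))
    rwa [sub_smul, one_smul, sub_sub_cancel] at h3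
  simpa using hli.fintype_card_le_finrank

end LocalGlobal

/-! ### Singular points contribute to the colength -/

section Singular

open MvPolynomial

variable {E : Type*} [CommRing E] [IsDedekindDomain E]
  [Algebra (MvPolynomial (Fin 2) ℂ) E] [Module.Finite (MvPolynomial (Fin 2) ℂ) E]

/-- Otherwise, by Nakayama, some s ≡ 1 mod M multiplies E into the image of P, so P/ker and E agree
near z. At a prime Q of E over M one of the coordinates centred at z divides the other: p v = q u on
the curve, with p(z) ≠ 0. The derivative of p v - q u along v takes the value p(z) at z, but it must
vanish there. -/
lemma smul_top_ne_top_of_pderiv_eq_zero (z : Fin 2 → ℂ)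
    (hz : ∀ g, algebraMap (MvPolynomial (Fin 2) ℂ) E g = 0 →
      eval z g = 0 ∧ ∀ i, eval z (pderiv i g) = 0) :
    ((RingHom.ker (eval z)) • ⊤ : Submodule (MvPolynomial (Fin 2) ℂ)
      (E ⧸ (1 : Submodule (MvPolynomial (Fin 2) ℂ) E))) ≠ ⊤ := by
  intro htop
  set M := RingHom.ker (eval z) with hM
  let al := algebraMap (MvPolynomial (Fin 2) ℂ) E
  obtain ⟨s, hs1, hs⟩ := Submodule.exists_sub_one_mem_and_smul_eq_zero_of_fg_of_le_smul M ⊤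
    (Module.Finite.fg_top (R := MvPolynomial (Fin 2) ℂ)
      (M := E ⧸ (1 : Submodule (MvPolynomial (Fin 2) ℂ) E))) htop.ge
  have hsE : ∀ e : E, ∃ p, al p = al s * e := by
    intro e
    have := hs (Submodule.Quotient.mk e) trivial
    rw [← Submodule.Quotient.mk_smul, Submodule.Quotient.mk_eq_zero, Submodule.mem_one] at this
    obtain ⟨p, hp⟩ := this
    exact ⟨p, by rw [show al p = s • e from hp, Algebra.smul_def]⟩
  -- A prime of E over M exists: otherwise some t ≡ 1 mod M kills E, so it lies in the kernel and
  -- vanishes at z.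
  have hne : M.map al ≠ ⊤ := by
    intro h
    obtain ⟨t, ht1, ht⟩ := Submodule.exists_sub_one_mem_and_smul_eq_zero_of_fg_of_le_smul M ⊤
      (Module.Finite.fg_top (R := MvPolynomial (Fin 2) ℂ) (M := E)) (by
        rw [Ideal.smul_top_eq_map]
        change _ ≤ Submodule.restrictScalars _ (M.map al)
        rw [h]; exact le_rfl)
    have h1 := (hz t (by simpa [Algebra.smul_def] using ht 1 trivial)).1
    have h2 : eval z (t - 1) = 0 := ht1
    rw [map_sub, h1, map_one] at h2
    norm_num at h2
  obtain ⟨Q, hQ, hMQ⟩ := Ideal.exists_le_maximal _ hne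
  have hMQ' : ∀ p ∈ M, al p ∈ Q := fun p hp => hMQ (Ideal.mem_map_of_mem _ hp)
  have hsQ : al s ∉ Q := by
    intro h
    have h1 := hMQ' _ hs1
    rw [map_sub, map_one] at h1
    have := sub_mem h h1
    rw [sub_sub_cancel] at this
    exact hQ.ne_top ((Ideal.eq_top_iff_one _).2 this)
  -- a relation `p v = q u` with `p ∉ M` is impossible
  have hrel : ∀ i j : Fin 2, i ≠ j → ∀ e b : E, e ∉ Q →
      e * al (X j - C (z j)) = b * al (X i - C (z i)) → False := by
    intro i j hij e b he heb
    obtain ⟨p, hp⟩ := hsE e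
    obtain ⟨q, hq⟩ := hsE b
    have hpM : p ∉ M := fun h => by
      have := hMQ' p h
      rw [hp] at this
      exact (hQ.isPrime.mem_or_mem this).elim hsQ he
    have h0 : al (p * (X j - C (z j)) - q * (X i - C (z i))) = 0 := by
      rw [map_sub, map_mul al p, map_mul al q, hp, hq, mul_assoc, heb]; ring
    have := (hz _ h0).2 j
    simp [Derivation.leibniz, pderiv_X_of_ne hij] at this
    exact hpM this
  have hne0 : ∀ j : Fin 2, al (X j - C (z j)) ≠ 0 := by
    intro j h0
    have := (hz _ h0).2 j
    simp at this
  rcases exists_notMem_mul_eq_mul hQ.isPrime (hne0 0) (hne0 1) with ⟨e, b, he, heb⟩ | ⟨e, b, he, heb⟩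
  · exact hrel 0 1 (by decide) e b he heb
  · exact hrel 1 0 (by decide) e b he heb

end Singular

end

noncomputable section

/-! ## The Tjurina ideal of an affine chart lies in the conductor -/

open MvPolynomial

/-- The ideal generated by a polynomial and its partial derivatives. -/
def tjurinaIdeal (f : MvPolynomial (Fin 2) ℂ) : Ideal (MvPolynomial (Fin 2) ℂ) :=
  Ideal.span {f, pderiv 0 f, pderiv 1 f}

lemma mem_tjurinaIdeal_self (f : MvPolynomial (Fin 2) ℂ) : f ∈ tjurinaIdeal f :=
  Ideal.subset_span (by simp)

lemma pderiv_mem_tjurinaIdeal (f : MvPolynomial (Fin 2) ℂ) (i : Fin 2) :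
    pderiv i f ∈ tjurinaIdeal f :=
  Ideal.subset_span (by fin_cases i <;> simp)

/-- The affine equation `Φ(x, y, 1)`. -/
def affineEquation (Φ : MvPolynomial (Fin 3) ℂ) : MvPolynomial (Fin 2) ℂ :=
  aeval ![X 0, X 1, 1] Φ

lemma pderiv_zero_affineEquation (Φ : MvPolynomial (Fin 3) ℂ) :
    pderiv 0 (affineEquation Φ) = aeval ![X 0, X 1, 1] (pderiv 0 Φ) := by
  have h := Derivation.map_mvPolynomial_aeval (pderiv (R := ℂ) (0 : Fin 2))
    ![(X 0 : MvPolynomial (Fin 2) ℂ), X 1, 1] Φ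
  rw [Fin.sum_univ_three] at h
  simpa [affineEquation, pderiv_X_of_ne] using h

lemma pderiv_one_affineEquation (Φ : MvPolynomial (Fin 3) ℂ) :
    pderiv 1 (affineEquation Φ) = aeval ![X 0, X 1, 1] (pderiv 1 Φ) := by
  have h := Derivation.map_mvPolynomial_aeval (pderiv (R := ℂ) (1 : Fin 2))
    ![(X 0 : MvPolynomial (Fin 2) ℂ), X 1, 1] Φ
  rw [Fin.sum_univ_three] at h
  simpa [affineEquation, pderiv_X_of_ne] using h

/-- The square-zero ideals of the quotient by `J` have dimension at most `D`. -/
def SquareZeroBound (J : Ideal (MvPolynomial (Fin 2) ℂ)) (D : ℕ) : Prop :=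
  ∀ I : Ideal (MvPolynomial (Fin 2) ℂ ⧸ J), I * I = ⊥ →
    FiniteDimensional ℂ I ∧ Module.finrank ℂ I ≤ D

/-- Local form of an upper bound for the contribution of the singular point `z` of `f = 0` to the
difference between the arithmetic and the geometric genus. -/
def LocalBound (f : MvPolynomial (Fin 2) ℂ) (z : Fin 2 → ℂ) (D : ℕ) : Prop :=
  ∃ h ∈ tjurinaIdeal f, h ∉ Ideal.span {f} ∧ ∃ n₀, ∀ n, n₀ ≤ n →
    SquareZeroBound (Ideal.span {h} ⊔ Ideal.span {f} ⊔ RingHom.ker (eval z) ^ n) D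

/-- Nullstellensatz: a product of the maximal ideals at the zeros of J lies in the radical, some
power of which lies in J. -/
lemma exists_prod_ker_eval_pow_le (J : Ideal (MvPolynomial (Fin 2) ℂ)) (S : Finset (Fin 2 → ℂ))
    (hS : ∀ z, (∀ p ∈ J, eval z p = 0) → z ∈ S) :
    ∃ N, ∏ z ∈ S, RingHom.ker (eval z) ^ N ≤ J := by
  obtain ⟨N, hN⟩ := J.exists_radical_pow_le_of_fg (IsNoetherian.noetherian _)
  refine ⟨N, le_trans ?_ hN⟩
  rw [Finset.prod_pow]
  refine Ideal.pow_right_mono ?_ N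
  rw [← vanishingIdeal_zeroLocus_eq_radical (K := ℂ)]
  intro p hp z hz
  have hzS := hS z fun q hq => by simpa using hz q hq
  have := Ideal.le_of_dvd (Finset.dvd_prod_of_mem (fun z => RingHom.ker (eval z)) hzS) hp
  simpa using this

lemma isCoprime_ker_eval {z w : Fin 2 → ℂ} (h : z ≠ w) :
    IsCoprime (RingHom.ker (eval z)) (RingHom.ker (eval w)) := by
  obtain ⟨i, hi⟩ := Function.ne_iff.1 h
  have hi' : w i - z i ≠ 0 := sub_ne_zero.2 hi.symm
  refine Ideal.isCoprime_iff_exists.2 ⟨C (w i - z i)⁻¹ * (X i - C (z i)), ?_,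
    C (w i - z i)⁻¹ * (C (w i) - X i), ?_, ?_⟩
  · simp [RingHom.mem_ker]
  · simp [RingHom.mem_ker]
  · rw [← mul_add, show X i - C (z i) + (C (w i) - X i) = C (w i - z i) by rw [C_sub]; ring,
      ← C_mul, inv_mul_cancel₀ hi', C_1]

variable {K : Type*} [Field K] [Algebra ℂ K]

namespace IsPlaneChart

variable {Φ : MvPolynomial (Fin 3) ℂ} {x y : K} (h : IsPlaneChart Φ x y)

include h

lemma aeval_affineEquation : aeval ![x, y] (affineEquation Φ) = 0 := by
  rw [affineEquation, ← AlgHom.comp_apply, ← h.aeval_eq_zero]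
  congr 1
  ext i; fin_cases i <;> simp

lemma aeval_eq_zero_iff (p : MvPolynomial (Fin 2) ℂ) :
    aeval ![x, y] p = 0 ↔ affineEquation Φ ∣ p := by
  refine ⟨h.dvd_of_aeval_eq_zero p, ?_⟩
  rintro ⟨q, rfl⟩
  rw [map_mul, h.aeval_affineEquation, zero_mul]

/-- As a polynomial in y the derivative has degree below 5, and its coefficient of y⁴ is 5, so it is
not a multiple of the equation. -/
lemma aeval_pderiv_one_ne_zero : aeval ![x, y] (pderiv 1 (affineEquation Φ)) ≠ 0 := by
  intro h0
  let p : Polynomial (Polynomial ℂ) := aeval ![Polynomial.C Polynomial.X, Polynomial.X,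
    Polynomial.C 1] Φ
  have hm : p.Monic := monic_aeval_form h.isHomogeneous h.eval_eq_one _ _
  have hd : p.natDegree = 5 := natDegree_aeval_form h.isHomogeneous h.eval_eq_one _ _
  have h1 : Polynomial.derivative p = 0 := by
    apply h.eq_zero_of_natDegree_lt
    · exact (Polynomial.natDegree_derivative_lt (by omega)).trans_eq hd
    · rw [derivative_aeval_form, ← h0, pderiv_one_affineEquation, ← AlgHom.comp_apply,
        ← AlgHom.comp_apply]
      congr 1
      ext i; fin_cases i <;> simp
  have h2 := congrArg (fun q => Polynomial.coeff q 4) h1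
  simp only [Polynomial.coeff_derivative, Polynomial.coeff_zero] at h2
  have h3 : p.coeff 5 = 1 := by rw [← hd]; exact hm
  norm_num [h3] at h2

lemma aeval_pderiv_one_mul_mem {z : K} (hz : z ∈ normalization x) :
    aeval ![x, y] (pderiv 1 (affineEquation Φ)) * z ∈ Algebra.adjoin ℂ {x, y} := by
  obtain ⟨g, hg, -, hgy, hgd⟩ := h.exists_monic
  have := aeval_derivative_mul_mem h.transcendental h.adjoin_eq_top hg hgy hz
  rw [hgd] at this
  rw [pderiv_one_affineEquation, ← AlgHom.comp_apply]
  convert this using 2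
  refine congrArg (fun φ => φ (pderiv 1 Φ)) (algHom_ext fun i => ?_ :
    (aeval ![x, y]).comp (aeval ![X 0, X 1, 1]) = aeval ![x, y, 1])
  fin_cases i <;> simp

/-- The chart obtained by projecting from the point `[t : 1 : 0]`. -/
lemma shear {t : ℂ} (ht : eval ![t, 1, 0] Φ ≠ 0) :
    IsPlaneChart (C (eval ![t, 1, 0] Φ)⁻¹ * aeval ![X 0 + C t * X 1, X 1, X 2] Φ)
      (x - algebraMap ℂ K t * y) y where
  isHomogeneous := by
    have h1 := h.isHomogeneous.aeval ![(X 0 + C t * X 1 : MvPolynomial (Fin 3) ℂ), X 1, X 2] (n := 1) (fun i => by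
      fin_cases i
      · exact (isHomogeneous_X _ _).add (by simpa using (isHomogeneous_C _ t).mul (isHomogeneous_X ℂ 1))
      · exact isHomogeneous_X _ _
      · exact isHomogeneous_X _ _)
    have h2 := (isHomogeneous_C (Fin 3) (eval ![t, 1, 0] Φ)⁻¹).mul h1
    rwa [one_mul, zero_add] at h2
  eval_eq_one := by
    rw [map_mul, eval_C]
    have : eval ![0, 1, 0] (aeval ![X 0 + C t * X 1, X 1, X 2] Φ) = eval ![t, 1, 0] Φ := by
      rw [← coe_aeval_eq_eval, ← coe_aeval_eq_eval, RingHom.coe_coe, RingHom.coe_coe,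
        ← AlgHom.comp_apply]
      congr 1
      ext i; fin_cases i <;> simp
    rw [this, inv_mul_cancel₀ ht]
  aeval_eq_zero := by
    rw [map_mul, ← AlgHom.comp_apply]
    have : (aeval ![x - algebraMap ℂ K t * y, y, 1]).comp (aeval ![X 0 + C t * X 1, X 1, X 2]) =
        aeval ![x, y, 1] := by
      ext i; fin_cases i <;> simp
    rw [this, h.aeval_eq_zero, mul_zero]
  dvd_of_aeval_eq_zero := by
    intro p hp
    let σ : MvPolynomial (Fin 2) ℂ →ₐ[ℂ] MvPolynomial (Fin 2) ℂ := aeval ![X 0 - C t * X 1, X 1]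
    let τ : MvPolynomial (Fin 2) ℂ →ₐ[ℂ] MvPolynomial (Fin 2) ℂ := aeval ![X 0 + C t * X 1, X 1]
    have hτσ : τ (σ p) = p := by
      rw [← AlgHom.comp_apply]
      conv_rhs => rw [← AlgHom.id_apply (R := ℂ) p]
      congr 1
      ext i; fin_cases i <;> simp [σ, τ]
    have h1 : aeval ![x, y] (σ p) = 0 := by
      rw [← hp, ← AlgHom.comp_apply]
      congr 1
      ext i; fin_cases i <;> simp [σ]
    have h2 := map_dvd τ (h.dvd_of_aeval_eq_zero _ h1)
    rw [hτσ, ← AlgHom.comp_apply] at h2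
    have h3 : τ.comp (aeval ![X 0, X 1, 1]) =
        (aeval ![X 0, X 1, 1]).comp (aeval ![X 0 + C t * X 1, X 1, X 2]) := by
      ext i; fin_cases i <;> simp [τ]
    rw [h3, AlgHom.comp_apply] at h2
    rw [map_mul]
    have hu : IsUnit (aeval ![X 0, X 1, 1] (C (eval ![t, 1, 0] Φ)⁻¹ : MvPolynomial (Fin 3) ℂ) :
        MvPolynomial (Fin 2) ℂ) :=
      (((isUnit_iff_ne_zero.2 (inv_ne_zero ht)).map C).map _)
    exact hu.mul_left_dvd.2 h2
  adjoin_eq_top := by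
    rw [eq_top_iff, ← h.adjoin_eq_top, IntermediateField.adjoin_le_iff]
    have hy : y ∈ IntermediateField.adjoin ℂ {x - algebraMap ℂ K t * y, y} :=
      IntermediateField.subset_adjoin _ _ (by simp)
    rintro z (rfl | hz)
    · have h1 : z - algebraMap ℂ K t * y ∈ IntermediateField.adjoin ℂ {z - algebraMap ℂ K t * y, y} :=
        IntermediateField.subset_adjoin _ _ (by simp)
      have := add_mem h1 (mul_mem (IntermediateField.algebraMap_mem _ t) hy)
      rwa [sub_add_cancel] at this
    · rw [Set.mem_singleton_iff.1 hz]; exact hy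

lemma exists_eval_ne_zero : ∃ t : ℂ, t ≠ 0 ∧ eval ![t, 1, 0] Φ ≠ 0 := by
  let q : Polynomial ℂ := aeval ![Polynomial.X, 1, 0] Φ
  have hq : ∀ t, q.eval t = eval ![t, 1, 0] Φ := by
    intro t
    rw [← Polynomial.coe_aeval_eq_eval, ← coe_aeval_eq_eval, RingHom.coe_coe, ← AlgHom.comp_apply]
    congr 1
    ext i; fin_cases i <;> simp
  have hq0 : q ≠ 0 := fun h0 => by
    have := hq 0
    rw [h0, h.eval_eq_one] at this
    simp at this
  obtain ⟨t, ht⟩ := Set.Infinite.exists_notMem_finset Set.infinite_univ (insert 0 q.roots.toFinset)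
  simp only [Finset.mem_insert, Multiset.mem_toFinset, not_or] at ht
  refine ⟨t, ht.2.1, fun h0 => ht.2.2 ?_⟩
  rw [Polynomial.mem_roots hq0, Polynomial.IsRoot, hq, h0]

/-- Dedekind's theorem only concerns the derivative along the projection. Projecting from [t:1:0]
instead puts t f_x + f_y, up to a constant, in the conductor; subtracting f_y leaves f_x. -/
lemma aeval_pderiv_zero_mul_mem {z : K} (hz : z ∈ normalization x) :
    aeval ![x, y] (pderiv 0 (affineEquation Φ)) * z ∈ Algebra.adjoin ℂ {x, y} := by
  obtain ⟨t, ht, hc⟩ := h.exists_eval_ne_zero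
  have h' := h.shear hc
  set u := x - algebraMap ℂ K t * y with hu
  have hadj : Algebra.adjoin ℂ {u, y} ≤ Algebra.adjoin ℂ {x, y} := by
    have hy : y ∈ Algebra.adjoin ℂ {x, y} := Algebra.subset_adjoin (by simp)
    have hx : x ∈ Algebra.adjoin ℂ {x, y} := Algebra.subset_adjoin (by simp)
    rw [Algebra.adjoin_le_iff]
    rintro w (rfl | hw)
    · exact sub_mem hx (mul_mem (Subalgebra.algebraMap_mem _ t) hy)
    · rw [Set.mem_singleton_iff.1 hw]; exact hy
  -- Both projections are finite on the same affine curve: where u is integral, so is y, hence also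
  -- x = u + ty.
  have hzu : z ∈ normalization u := by
    refine mem_normalization_of_mem_places fun v hv => ?_
    have hyv := hv ⟨y, h'.adjoin_le_normalization (Algebra.subset_adjoin (by simp))⟩
    have huv := hv ⟨u, self_mem_normalization u⟩
    have hxv : x ∈ v.1 := by
      have := add_mem huv (mul_mem (v.2.1 t) hyv)
      simpa [hu] using this
    exact normalization_le_place hxv ⟨z, hz⟩
  have h1 := hadj (h'.aeval_pderiv_one_mul_mem hzu)
  have h2 := h.aeval_pderiv_one_mul_mem hz
  have key : aeval ![u, y] (pderiv 1 (affineEquation (C (eval ![t, 1, 0] Φ)⁻¹ *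
      aeval ![X 0 + C t * X 1, X 1, X 2] Φ))) =
      algebraMap ℂ K (eval ![t, 1, 0] Φ)⁻¹ * (algebraMap ℂ K t *
        aeval ![x, y] (pderiv 0 (affineEquation Φ)) + aeval ![x, y] (pderiv 1 (affineEquation Φ))) := by
    have e1 : affineEquation (C (eval ![t, 1, 0] Φ)⁻¹ *
      aeval ![X 0 + C t * X 1, X 1, X 2] Φ) = C (eval ![t, 1, 0] Φ)⁻¹ *
        aeval ![X 0 + C t * X 1, X 1, 1] Φ := by
      rw [affineEquation, map_mul, ← AlgHom.comp_apply]
      congr 1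
      · simp [algebraMap_eq]
      · congr 1
        ext i; fin_cases i <;> simp
    have e2 := Derivation.map_mvPolynomial_aeval (pderiv (R := ℂ) (1 : Fin 2))
      ![(X 0 + C t * X 1 : MvPolynomial (Fin 2) ℂ), X 1, 1] Φ
    rw [Fin.sum_univ_three] at e2
    have e3 : (aeval ![u, y]).comp (aeval ![(X 0 + C t * X 1 : MvPolynomial (Fin 2) ℂ), X 1, 1]) =
        (aeval ![x, y]).comp (aeval ![X 0, X 1, 1]) := by
      ext i; fin_cases i <;> simp [hu]
    have e4 := fun p => DFunLike.congr_fun e3 p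
    simp only [AlgHom.comp_apply] at e4
    rw [e1, pderiv_C_mul, e2, pderiv_zero_affineEquation, pderiv_one_affineEquation]
    have e5 : pderiv (R := ℂ) (1 : Fin 2) (X 0 + C t * X 1) = C t := by
      simp
    simp only [Matrix.cons_val_zero, Matrix.cons_val_one, Matrix.cons_val, e5, pderiv_X_self,
      Derivation.map_one_eq_zero, smul_eq_mul, mul_zero, add_zero, mul_one, map_add, map_mul, e4,
      aeval_C]
    ring
  rw [key] at h1
  have hc' : algebraMap ℂ K (eval ![t, 1, 0] Φ) ≠ 0 := by simpa using hc
  have ht' : algebraMap ℂ K t ≠ 0 := by simpa using ht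
  have h3 := mul_mem (Subalgebra.algebraMap_mem (Algebra.adjoin ℂ {x, y}) t⁻¹)
    (sub_mem (mul_mem (Subalgebra.algebraMap_mem (Algebra.adjoin ℂ {x, y}) (eval ![t, 1, 0] Φ)) h1) h2)
  convert h3 using 1
  rw [map_inv₀, map_inv₀]
  field_simp
  ring

lemma aeval_tjurinaIdeal_mul_mem {p : MvPolynomial (Fin 2) ℂ} (hp : p ∈ tjurinaIdeal (affineEquation Φ))
    {z : K} (hz : z ∈ normalization x) : aeval ![x, y] p * z ∈ Algebra.adjoin ℂ {x, y} := by
  have hmem : ∀ q : MvPolynomial (Fin 2) ℂ, aeval ![x, y] q ∈ Algebra.adjoin ℂ {x, y} := by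
    intro q
    induction q using MvPolynomial.induction_on with
    | C a => simp
    | add p q hp hq => rw [map_add]; exact add_mem hp hq
    | mul_X p i hp =>
      rw [map_mul]
      refine mul_mem hp (Algebra.subset_adjoin ?_)
      fin_cases i <;> simp
  refine Submodule.span_induction ?_ ?_ ?_ ?_ hp
  · rintro q (rfl | rfl | rfl)
    · rw [h.aeval_affineEquation, zero_mul]; exact zero_mem _
    · exact h.aeval_pderiv_zero_mul_mem hz
    · exact h.aeval_pderiv_one_mul_mem hz
  · simp
  · intro a b _ _ ha hb
    rw [map_add, add_mul]; exact add_mem ha hb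
  · intro a b _ hb
    rw [smul_eq_mul, map_mul, mul_assoc]; exact mul_mem (hmem a) hb

end IsPlaneChart

end

noncomputable section

/-! ## The genus and the singular points of an affine chart -/

open MvPolynomial

namespace IsPlaneChart

variable {K : Type*} [Field K] [Algebra ℂ K]
  {Φ : MvPolynomial (Fin 3) ℂ} {x y : K} (h : IsPlaneChart Φ x y)

include h

/-- Here δ is the dimension of Q = S/R viewed over ℂ[X₀, X₁]. The lower bound holds because each
singular point is in the support of Q. For the upper bound, the Tjurina ideal annihilates Q and
contains a product of powers of the maximal ideals at the singular points, so Q splits into local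
parts bounded by `LocalBound`. -/
theorem functionFieldGenus_bounds
    (hsep : (aeval ![1, Polynomial.X, 0] Φ : Polynomial ℂ).Separable)
    (S : Finset (Fin 2 → ℂ)) (hS : ∀ z, z ∈ S ↔ eval z (affineEquation Φ) = 0 ∧
      ∀ i, eval z (pderiv i (affineEquation Φ)) = 0)
    (b : (Fin 2 → ℂ) → ℕ) (hb : ∀ z ∈ S, LocalBound (affineEquation Φ) z (b z)) :
    ∃ δ, functionFieldGenus ℂ K + δ = 6 ∧ S.card ≤ δ ∧ δ ≤ ∑ z ∈ S, b z := by
  classical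
  obtain ⟨hfin, hgen⟩ := h.functionFieldGenus_add_finrank hsep
  set f := affineEquation Φ with hf
  have hxm : x ∈ normalization x := self_mem_normalization x
  have hym : y ∈ normalization x := h.adjoin_le_normalization (Algebra.subset_adjoin (by simp))
  let ρ : MvPolynomial (Fin 2) ℂ →ₐ[ℂ] normalization x := aeval ![⟨x, hxm⟩, ⟨y, hym⟩]
  let : Algebra (MvPolynomial (Fin 2) ℂ) (normalization x) := ρ.toAlgebra
  have hal : ∀ p, (algebraMap (MvPolynomial (Fin 2) ℂ) (normalization x) p : K) =
      aeval ![x, y] p := by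
    intro p
    change (normalization x).val (ρ p) = _
    rw [← AlgHom.comp_apply]
    congr 1
    ext i; fin_cases i <;> simp [ρ]
  have : IsScalarTower ℂ (MvPolynomial (Fin 2) ℂ) (normalization x) :=
    IsScalarTower.of_algebraMap_eq fun c => (ρ.commutes c).symm
  have hker : RingHom.ker (algebraMap (MvPolynomial (Fin 2) ℂ) (normalization x)) =
      Ideal.span {f} := by
    ext p
    rw [RingHom.mem_ker, Ideal.mem_span_singleton, ← h.aeval_eq_zero_iff, ← hal]
    exact ⟨fun hp => by rw [hp]; rfl, fun hp => Subtype.ext hp⟩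
  have hadj : ∀ z ∈ Algebra.adjoin ℂ {x, y}, ∃ p : MvPolynomial (Fin 2) ℂ, aeval ![x, y] p = z := by
    intro z hz
    have : Algebra.adjoin ℂ {x, y} ≤ (aeval (R := ℂ) ![x, y]).range := by
      rw [Algebra.adjoin_le_iff]
      rintro w (rfl | hw)
      · exact ⟨X 0, by simp⟩
      · exact ⟨X 1, by simpa using (Set.mem_singleton_iff.1 hw).symm⟩
    exact this hz
  have hcond : ∀ p ∈ tjurinaIdeal f, ∀ e : normalization x, ∃ q,
      algebraMap (MvPolynomial (Fin 2) ℂ) (normalization x) q =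
        algebraMap (MvPolynomial (Fin 2) ℂ) (normalization x) p * e := by
    intro p hp e
    obtain ⟨q, hq⟩ := hadj _ (h.aeval_tjurinaIdeal_mul_mem hp e.2)
    exact ⟨q, Subtype.ext (by rw [hal, hq, Subalgebra.coe_mul, hal])⟩
  have := h.isDedekindDomain_normalization
  have hfinE : Module.Finite (MvPolynomial (Fin 2) ℂ) (normalization x) := by
    obtain ⟨s, hs⟩ := (normalization_finite h.transcendental h.isIntegral h.adjoin_eq_top).fg_top
    let ι : integralClosure (Algebra.adjoin ℂ {x}) K → normalization x := fun e => ⟨e.1, e.2⟩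
    have key : ∀ e ∈ Submodule.span (Algebra.adjoin ℂ {x})
        (s : Set (integralClosure (Algebra.adjoin ℂ {x}) K)),
        ι e ∈ Submodule.span (MvPolynomial (Fin 2) ℂ) (s.image ι : Set (normalization x)) := by
      intro e he
      induction he using Submodule.span_induction with
      | mem a ha => exact Submodule.subset_span (Finset.mem_coe.2 (Finset.mem_image_of_mem ι ha))
      | zero => exact zero_mem _
      | add a b _ _ ha hb => exact add_mem ha hb
      | smul a b _ hb =>
        obtain ⟨p, hp⟩ := hadj a (Algebra.adjoin_mono (by simp) a.2)
        have hab : ι (a • b) = p • ι b := by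
          apply Subtype.ext
          rw [Algebra.smul_def p, Subalgebra.coe_mul, hal, hp]
          rfl
        rw [hab]
        exact Submodule.smul_mem _ p hb
    refine ⟨⟨s.image ι, eq_top_iff.2 fun e _ => ?_⟩⟩
    exact key ⟨e.1, e.2⟩ (hs ▸ Submodule.mem_top)
  -- comparison of the two quotients
  let U : Submodule ℂ (normalization x) := (Subalgebra.toSubmodule (Algebra.adjoin ℂ {x, y})).comap
    (normalization x).val.toLinearMap
  have hU : U = (1 : Submodule (MvPolynomial (Fin 2) ℂ) (normalization x)).restrictScalars ℂ := by
    ext e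
    rw [Submodule.restrictScalars_mem, Submodule.mem_one]
    change (e : K) ∈ Algebra.adjoin ℂ {x, y} ↔ _
    constructor
    · intro he
      obtain ⟨p, hp⟩ := hadj _ he
      exact ⟨p, Subtype.ext (by rw [hal, hp])⟩
    · rintro ⟨p, rfl⟩
      rw [hal]
      have : (aeval (R := ℂ) ![x, y]).range ≤ Algebra.adjoin ℂ {x, y} := by
        rw [← Algebra.adjoin_range_eq_range_aeval]
        refine Algebra.adjoin_mono ?_
        rintro _ ⟨i, rfl⟩
        fin_cases i <;> simp
      exact this ⟨p, rfl⟩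
  let Q := normalization x ⧸ (1 : Submodule (MvPolynomial (Fin 2) ℂ) (normalization x))
  let eq : (normalization x ⧸ U) ≃ₗ[ℂ] Q :=
    (Submodule.quotEquivOfEq _ _ hU).trans
      (Submodule.Quotient.restrictScalarsEquiv ℂ _)
  have hfinQ : FiniteDimensional ℂ Q := @Module.Finite.equiv _ _ _ _ _ _ _ _ hfin eq
  refine ⟨Module.finrank ℂ Q, by rw [← eq.finrank_eq]; exact hgen, ?_, ?_⟩
  · refine card_le_finrank S (fun z => RingHom.ker (eval z))
      (fun z _ w _ hzw => isCoprime_ker_eval hzw) fun z hz => ?_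
    refine smul_top_ne_top_of_pderiv_eq_zero z fun g hg => ?_
    have hg' : g ∈ Ideal.span {f} := hker ▸ hg
    obtain ⟨c, rfl⟩ := Ideal.mem_span_singleton'.1 hg'
    obtain ⟨h0, h1⟩ := (hS z).1 hz
    refine ⟨by rw [map_mul, h0, mul_zero], fun i => ?_⟩
    rw [Derivation.leibniz]
    simp [h0, h1]
  · obtain ⟨N, hN⟩ := exists_prod_ker_eval_pow_le (tjurinaIdeal f) S fun z hz =>
      (hS z).2 ⟨hz _ (mem_tjurinaIdeal_self f), fun i => hz _ (pderiv_mem_tjurinaIdeal f i)⟩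
    refine finrank_le_sum_finrank_quotient (P := MvPolynomial (Fin 2) ℂ) S
      (fun z => RingHom.ker (eval z) ^ N)
      (fun z _ w _ hzw => (isCoprime_ker_eval hzw).pow) ?_ b ?_
    · intro p hp t
      obtain ⟨e, rfl⟩ := Submodule.Quotient.mk_surjective _ t
      rw [← Submodule.Quotient.mk_smul, Submodule.Quotient.mk_eq_zero, Submodule.mem_one]
      obtain ⟨q, hq⟩ := hcond p (hN hp) e
      exact ⟨q, by rw [hq, Algebra.smul_def]⟩
    · intro z hz
      obtain ⟨p, hp, hpf, n₀, hI⟩ := hb z hz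
      rw [← hker] at hI
      exact finrank_quotient_smul_le_of_sq_eq_bot _ (fun h0 => hpf (hker ▸ h0)) (hcond p hp) hI N

end IsPlaneChart

end

noncomputable section

/-! ## Formal charts -/

namespace MvPowerSeries

/-- The maximal ideal of `ℂ⟦x, y⟧`. -/
def augmentation : Ideal (MvPowerSeries (Fin 2) ℂ) :=
  RingHom.ker (constantCoeff (σ := Fin 2) (R := ℂ))

lemma mem_augmentation {s : MvPowerSeries (Fin 2) ℂ} : s ∈ augmentation ↔ constantCoeff s = 0 :=
  Iff.rfl

lemma X_mem_augmentation (i : Fin 2) : X i ∈ augmentation := by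
  rw [mem_augmentation, constantCoeff_X]

lemma augmentation_eq_maximalIdeal :
    augmentation = IsLocalRing.maximalIdeal (MvPowerSeries (Fin 2) ℂ) := by
  ext s
  rw [mem_augmentation, IsLocalRing.mem_maximalIdeal, mem_nonunits_iff, isUnit_iff_constantCoeff,
    isUnit_iff_ne_zero, not_not]

lemma augmentation_eq_span : augmentation = Ideal.span {X 0, X 1} := by
  classical
  refine le_antisymm (fun s hs => ?_) ?_
  -- The part free of the first variable has no constant term, so it is divisible by the second; the
  -- rest is divisible by the first.
  · let a : MvPowerSeries (Fin 2) ℂ := fun d => if d 0 = 0 then coeff d s else 0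
    have ha : ∀ d, coeff d a = if d 0 = 0 then coeff d s else 0 := fun d => rfl
    have h1 : X 1 ∣ a := by
      rw [X_dvd_iff]
      intro d hd
      rw [ha]
      split_ifs with h0
      · have : d = 0 := by ext i; fin_cases i <;> simpa
        rw [this, coeff_zero_eq_constantCoeff_apply, mem_augmentation.1 hs]
      · rfl
    have h0 : X 0 ∣ s - a := by
      rw [X_dvd_iff]
      intro d hd
      rw [map_sub, ha, if_pos hd, sub_self]
    have e : s = (s - a) + a := by ring
    rw [e]
    exact add_mem (Ideal.mem_of_dvd _ h0 (Ideal.subset_span (by simp)))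
      (Ideal.mem_of_dvd _ h1 (Ideal.subset_span (by simp)))
  · rw [Ideal.span_le]
    rintro _ (rfl | rfl) <;> exact X_mem_augmentation _

lemma coeff_eq_zero_of_mem_augmentation_pow {n : ℕ} {s : MvPowerSeries (Fin 2) ℂ}
    (hs : s ∈ augmentation ^ n) {d : Fin 2 →₀ ℕ} (hd : d.degree < n) : coeff d s = 0 := by
  have : (n : ℕ∞) ≤ s.order := by
    clear hd
    induction n generalizing s with
    | zero => simp
    | succ n ih =>
      rw [pow_succ] at hs
      refine Submodule.mul_induction_on hs ?_ ?_
      · intro a ha b hb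
        refine le_trans ?_ le_order_mul
        rw [Nat.cast_succ]
        exact add_le_add (ih ha) (one_le_order_iff_constCoeff_eq_zero.2 hb)
      · intro a b ha hb
        exact (le_min ha hb).trans min_order_le_add
  exact coeff_of_lt_order (lt_of_lt_of_le (by exact_mod_cast hd) this)

lemma exists_sub_C_mem_augmentation (s : MvPowerSeries (Fin 2) ℂ) :
    s - C (constantCoeff s) ∈ augmentation := by
  rw [mem_augmentation, map_sub, constantCoeff_C, sub_self]

end MvPowerSeries

open MvPowerSeries (augmentation)

/-- A formal chart of the affine plane at the point `z`. -/
structure IsFormalChart (θ : MvPolynomial (Fin 2) ℂ →ₐ[ℂ] MvPowerSeries (Fin 2) ℂ)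
    (z : Fin 2 → ℂ) : Prop where
  mem_augmentation : ∀ i, θ (MvPolynomial.X i - MvPolynomial.C (z i)) ∈ augmentation
  le_span : augmentation ≤
    Ideal.span {θ (MvPolynomial.X 0 - MvPolynomial.C (z 0)),
      θ (MvPolynomial.X 1 - MvPolynomial.C (z 1))}

namespace IsFormalChart

open MvPolynomial

variable {θ : MvPolynomial (Fin 2) ℂ →ₐ[ℂ] MvPowerSeries (Fin 2) ℂ} {z : Fin 2 → ℂ}

lemma _root_.MvPolynomial.X_sub_C_mem_ker_eval (z : Fin 2 → ℂ) (i : Fin 2) :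
    (X i - C (z i) : MvPolynomial (Fin 2) ℂ) ∈ RingHom.ker (eval z) := by
  simp [RingHom.mem_ker]

variable (h : IsFormalChart θ z)

include h

lemma map_ker_eval_le : (RingHom.ker (eval z)).map θ ≤ augmentation := by
  have hev : (MvPowerSeries.constantCoeff (σ := Fin 2) (R := ℂ)).comp θ.toRingHom = eval z := by
    apply MvPolynomial.ringHom_ext
    · intro a
      have : θ (C a) = MvPowerSeries.C a := θ.commutes a
      simp [this]
    · intro i
      have := h.mem_augmentation i
      rw [MvPowerSeries.mem_augmentation, map_sub, map_sub, sub_eq_zero] at this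
      have h2 : θ (C (z i)) = MvPowerSeries.C (z i) := θ.commutes _
      rw [h2, MvPowerSeries.constantCoeff_C] at this
      simpa using this
  rw [Ideal.map_le_iff_le_comap]
  intro p hp
  rw [Ideal.mem_comap, MvPowerSeries.mem_augmentation]
  exact (RingHom.congr_fun hev p).trans hp

lemma map_ker_eval_pow (n : ℕ) : (RingHom.ker (eval z) ^ n).map θ = augmentation ^ n := by
  rw [Ideal.map_pow]
  congr 1
  refine le_antisymm h.map_ker_eval_le (h.le_span.trans ?_)
  rw [Ideal.span_le]
  rintro _ (rfl | rfl) <;> exact Ideal.mem_map_of_mem _ (X_sub_C_mem_ker_eval z _)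

lemma apply_mem {n : ℕ} {p : MvPolynomial (Fin 2) ℂ} (hp : p ∈ RingHom.ker (eval z) ^ n) :
    θ p ∈ augmentation ^ n := by
  rw [← h.map_ker_eval_pow]; exact Ideal.mem_map_of_mem _ hp

/-- Replacing each power series coefficient by its constant term changes the element only in the
next power of the maximal ideal. -/
lemma exists_sub_mem_succ (n : ℕ) {s : MvPowerSeries (Fin 2) ℂ} (hs : s ∈ augmentation ^ n) :
    ∃ p ∈ RingHom.ker (eval z) ^ n, s - θ p ∈ augmentation ^ (n + 1) := by
  rw [← h.map_ker_eval_pow, Ideal.map] at hs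
  induction hs using Submodule.span_induction with
  | mem a ha =>
    obtain ⟨p, hp, rfl⟩ := ha
    exact ⟨p, hp, by simp⟩
  | zero => exact ⟨0, zero_mem _, by simp⟩
  | add a b _ _ ha hb =>
    obtain ⟨p, hp, hp'⟩ := ha
    obtain ⟨q, hq, hq'⟩ := hb
    refine ⟨p + q, add_mem hp hq, ?_⟩
    rw [map_add, show a + b - (θ p + θ q) = (a - θ p) + (b - θ q) by ring]
    exact add_mem hp' hq'
  | smul a b hb hb' =>
    obtain ⟨p, hp, hp'⟩ := hb'
    have hb2 : θ p ∈ augmentation ^ n := h.apply_mem hp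
    refine ⟨C (MvPowerSeries.constantCoeff a) * p, Ideal.mul_mem_left _ _ hp, ?_⟩
    have h2 : θ (C (MvPowerSeries.constantCoeff a)) = MvPowerSeries.C (MvPowerSeries.constantCoeff a) :=
      θ.commutes _
    have e : a • b - θ (C (MvPowerSeries.constantCoeff a) * p) = a * (b - θ p) +
        (a - MvPowerSeries.C (MvPowerSeries.constantCoeff a)) * θ p := by
      rw [map_mul, h2, smul_eq_mul]; ring
    rw [e]
    refine add_mem (Ideal.mul_mem_left _ _ hp') ?_
    rw [mul_comm (a - _), pow_succ]
    exact Ideal.mul_mem_mul hb2 (MvPowerSeries.exists_sub_C_mem_augmentation a)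

lemma exists_sub_mem (n : ℕ) (s : MvPowerSeries (Fin 2) ℂ) : ∃ p, s - θ p ∈ augmentation ^ n := by
  induction n with
  | zero => exact ⟨0, by simp⟩
  | succ n ih =>
    obtain ⟨p, hp⟩ := ih
    obtain ⟨q, -, hq⟩ := h.exists_sub_mem_succ n hp
    exact ⟨p + q, by rwa [map_add, ← sub_sub]⟩

omit h in
/-- The expansion in the coordinates `x - z 0`, `y - z 1`. -/
lemma taylor (z : Fin 2 → ℂ) :
    IsFormalChart ((MvPolynomial.coeToMvPowerSeries.algHom ℂ).comp (aeval fun i => X i + C (z i))) z where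
  mem_augmentation i := by
    simpa [algebraMap_eq] using MvPowerSeries.X_mem_augmentation i
  le_span := by
    rw [MvPowerSeries.augmentation_eq_span, Ideal.span_le]
    rintro _ (rfl | rfl)
    · exact Ideal.subset_span (by simp [algebraMap_eq])
    · exact Ideal.subset_span (by simp [algebraMap_eq])

omit h in
lemma _root_.MvPolynomial.mem_ker_eval_pow_of_coeff {z : Fin 2 → ℂ} {n : ℕ}
    {p : MvPolynomial (Fin 2) ℂ}
    (hp : ∀ d : Fin 2 →₀ ℕ, d.degree < n → coeff d (aeval (fun i => X i + C (z i)) p) = 0) :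
    p ∈ RingHom.ker (eval z) ^ n := by
  let σ : MvPolynomial (Fin 2) ℂ →ₐ[ℂ] MvPolynomial (Fin 2) ℂ := aeval fun i => X i + C (z i)
  let τ : MvPolynomial (Fin 2) ℂ →ₐ[ℂ] MvPolynomial (Fin 2) ℂ := aeval fun i => X i - C (z i)
  have hτσ : τ (σ p) = p := by
    rw [← AlgHom.comp_apply]
    conv_rhs => rw [← AlgHom.id_apply (R := ℂ) p]
    congr 1
    ext i; simp [σ, τ]
  have h1 : σ p ∈ idealOfVars (Fin 2) ℂ ^ n := (mem_pow_idealOfVars_iff' _ _).2 hp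
  have h2 : (idealOfVars (Fin 2) ℂ).map τ ≤ RingHom.ker (eval z) := by
    rw [idealOfVars, Ideal.map_span, Ideal.span_le]
    rintro _ ⟨_, ⟨i, rfl⟩, rfl⟩
    simp [τ, RingHom.mem_ker]
  rw [← hτσ]
  have h3 := Ideal.mem_map_of_mem τ h1
  rw [Ideal.map_pow] at h3
  exact Ideal.pow_right_mono h2 n h3

omit h in
lemma taylor_mem_iff (z : Fin 2 → ℂ) (n : ℕ) (p : MvPolynomial (Fin 2) ℂ) :
    ((MvPolynomial.coeToMvPowerSeries.algHom ℂ).comp (aeval fun i => X i + C (z i))) p ∈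
      augmentation ^ n ↔ p ∈ RingHom.ker (eval z) ^ n := by
  refine ⟨fun hp => mem_ker_eval_pow_of_coeff fun d hd => ?_, fun hp => (taylor z).apply_mem hp⟩
  simpa [-aeval_eq_bind₁] using MvPowerSeries.coeff_eq_zero_of_mem_augmentation_pow hp hd

omit h in
lemma _root_.MvPolynomial.finiteDimensional_quotient_ker_eval_pow (z : Fin 2 → ℂ) (n : ℕ) :
    FiniteDimensional ℂ (MvPolynomial (Fin 2) ℂ ⧸ RingHom.ker (eval z) ^ n) := by
  let σ : MvPolynomial (Fin 2) ℂ →ₐ[ℂ] MvPolynomial (Fin 2) ℂ := aeval fun i => X i + C (z i)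
  let L : MvPolynomial (Fin 2) ℂ →ₗ[ℂ] ({d : Fin 2 →₀ ℕ | d.degree ≤ n} → ℂ) :=
    LinearMap.pi fun d => (lcoeff ℂ d.1).comp σ.toLinearMap
  have : Finite {d : Fin 2 →₀ ℕ | d.degree ≤ n} := Finsupp.finite_of_degree_le n
  have hker : LinearMap.ker L ≤ (RingHom.ker (eval z) ^ n).restrictScalars ℂ := by
    intro p hp
    exact mem_ker_eval_pow_of_coeff fun d hd => congrFun (LinearMap.mem_ker.1 hp) ⟨d, hd.le⟩
  have hfd : FiniteDimensional ℂ (MvPolynomial (Fin 2) ℂ ⧸ LinearMap.ker L) :=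
    Module.Finite.equiv L.quotKerEquivRange.symm
  have hsurj : Function.Surjective (Submodule.factor hker) := Submodule.factor_surjective hker
  have := Module.Finite.of_surjective _ hsurj
  exact Module.Finite.equiv (Submodule.Quotient.restrictScalarsEquiv ℂ
    (RingHom.ker (eval z) ^ n : Ideal (MvPolynomial (Fin 2) ℂ)))

/-- Dimension count: every formal chart induces a surjection between the same two truncated rings.
For the Taylor chart it is bijective, so the dimensions are equal and finite, and any other chart is
injective too. -/
lemma apply_mem_iff (n : ℕ) (p : MvPolynomial (Fin 2) ℂ) :
    θ p ∈ augmentation ^ n ↔ p ∈ RingHom.ker (eval z) ^ n := by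
  refine ⟨fun hp => ?_, h.apply_mem⟩
  have key : ∀ {θ : MvPolynomial (Fin 2) ℂ →ₐ[ℂ] MvPowerSeries (Fin 2) ℂ}, IsFormalChart θ z →
      ∃ L : (MvPolynomial (Fin 2) ℂ ⧸ RingHom.ker (eval z) ^ n) →ₗ[ℂ]
        (MvPowerSeries (Fin 2) ℂ ⧸ augmentation ^ n), Function.Surjective L ∧
        ∀ p, L (Ideal.Quotient.mk _ p) = Ideal.Quotient.mk _ (θ p) := by
    intro θ h
    have hle : RingHom.ker (eval z) ^ n ≤ (augmentation ^ n).comap θ := fun p hp => h.apply_mem hp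
    refine ⟨(Ideal.quotientMapₐ _ θ hle).toLinearMap, ?_, fun p => rfl⟩
    intro s
    obtain ⟨s, rfl⟩ := Ideal.Quotient.mk_surjective s
    obtain ⟨p, hp⟩ := h.exists_sub_mem n s
    exact ⟨Ideal.Quotient.mk _ p, (Ideal.Quotient.eq.2 hp).symm⟩
  obtain ⟨L₀, hL₀, hL₀'⟩ := key (taylor z)
  obtain ⟨L, hL, hL'⟩ := key h
  have hinj : Function.Injective L₀ := by
    rw [injective_iff_map_eq_zero]
    intro q hq
    obtain ⟨q, rfl⟩ := Ideal.Quotient.mk_surjective q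
    rw [hL₀', Ideal.Quotient.eq_zero_iff_mem, taylor_mem_iff] at hq
    exact Ideal.Quotient.eq_zero_iff_mem.2 hq
  have := finiteDimensional_quotient_ker_eval_pow z n
  let e := LinearEquiv.ofBijective L₀ ⟨hinj, hL₀⟩
  have := Module.Finite.equiv e
  have hLinj := (LinearMap.injective_iff_surjective_of_finrank_eq_finrank e.finrank_eq).2 hL
  rw [← Ideal.Quotient.eq_zero_iff_mem] at hp ⊢
  apply hLinj
  rw [hL', hp, map_zero]

end IsFormalChart

end

noncomputable section

/-! ## Local bounds at singularities of type A and D -/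

open MvPowerSeries (augmentation)

namespace MvPowerSeries

lemma mem_augmentation_iff_exists {s : MvPowerSeries (Fin 2) ℂ} (hs : s ∈ augmentation) :
    ∃ c d : ℂ, s - (c • X 0 + d • X 1) ∈ augmentation ^ 2 := by
  rw [augmentation_eq_span, Ideal.mem_span_pair] at hs
  obtain ⟨a, b, rfl⟩ := hs
  refine ⟨constantCoeff a, constantCoeff b, ?_⟩
  have e : a * X 0 + b * X 1 - (constantCoeff a • X 0 + constantCoeff b • X 1) =
      (a - C (constantCoeff a)) * X 0 + (b - C (constantCoeff b)) * X 1 := by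
    rw [smul_eq_C_mul, smul_eq_C_mul]; ring
  rw [e, pow_two]
  exact add_mem (Ideal.mul_mem_mul (exists_sub_C_mem_augmentation a) (X_mem_augmentation 0))
    (Ideal.mul_mem_mul (exists_sub_C_mem_augmentation b) (X_mem_augmentation 1))

lemma eq_zero_of_quadratic_mem {α β γ : ℂ}
    (h : C α * X 0 ^ 2 + C β * (X 0 * X 1) + C γ * X 1 ^ 2 ∈ augmentation ^ 3) :
    α = 0 ∧ β = 0 ∧ γ = 0 := by
  classical
  have e2 : ∀ i : Fin 2, (X i : MvPowerSeries (Fin 2) ℂ) ^ 2 = monomial (Finsupp.single i 2) 1 :=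
    fun i => X_pow_eq i 2
  have e11 : (X 0 * X 1 : MvPowerSeries (Fin 2) ℂ) =
      monomial (Finsupp.single 0 1 + Finsupp.single 1 1) 1 := by
    rw [X, X, monomial_mul_monomial, one_mul]
  rw [e2, e2, e11] at h
  have h1 := coeff_eq_zero_of_mem_augmentation_pow h (d := Finsupp.single 0 2) (by simp)
  have h2 := coeff_eq_zero_of_mem_augmentation_pow h
    (d := Finsupp.single 0 1 + Finsupp.single 1 1) (by simp)
  have h3 := coeff_eq_zero_of_mem_augmentation_pow h (d := Finsupp.single 1 2) (by simp)
  simp [coeff_C_mul, coeff_monomial, Finsupp.ext_iff, Fin.forall_fin_two] at h1 h2 h3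
  exact ⟨h1, h2, h3⟩

end MvPowerSeries

/-- An upper bound for the delta invariant of a singularity of the given type. -/
def ADType.deltaBound : ADType → ℕ
  | .A l _ => (l + 1) / 2
  | .D k _ => k - 1

namespace IsFormalChart

open MvPolynomial

variable {θ : MvPolynomial (Fin 2) ℂ →ₐ[ℂ] MvPowerSeries (Fin 2) ℂ} {z : Fin 2 → ℂ}
  (h : IsFormalChart θ z)

section

include h

/-- This yields honest polynomials in the Tjurina ideal that approximate a prescribed formal element
to any order. -/
lemma exists_mem_sub_mem {J : Ideal (MvPolynomial (Fin 2) ℂ)} {g : MvPowerSeries (Fin 2) ℂ}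
    (hg : g ∈ J.map θ) (N : ℕ) : ∃ p ∈ J, θ p - g ∈ augmentation ^ N := by
  rw [Ideal.map] at hg
  induction hg using Submodule.span_induction with
  | mem a ha =>
    obtain ⟨p, hp, rfl⟩ := ha
    exact ⟨p, hp, by simp⟩
  | zero => exact ⟨0, zero_mem _, by simp⟩
  | add a b _ _ ha hb =>
    obtain ⟨p, hp, hp'⟩ := ha
    obtain ⟨q, hq, hq'⟩ := hb
    refine ⟨p + q, add_mem hp hq, ?_⟩
    rw [map_add, show θ p + θ q - (a + b) = (θ p - a) + (θ q - b) by ring]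
    exact add_mem hp' hq'
  | smul a b _ hb =>
    obtain ⟨p, hp, hp'⟩ := hb
    obtain ⟨q, hq⟩ := h.exists_sub_mem N a
    refine ⟨q * p, Ideal.mul_mem_left _ _ hp, ?_⟩
    have e : θ (q * p) - a • b = a * (θ p - b) - θ p * (a - θ q) := by
      rw [map_mul, smul_eq_mul]; ring
    rw [e]
    exact sub_mem (Ideal.mul_mem_left _ _ hp') (Ideal.mul_mem_left _ _ hq)

/-- Modulo the n-th power of the maximal ideal, polynomials and power series have the same
quotients, so the bound can be checked on the normal form. -/
lemma squareZeroBound {f p : MvPolynomial (Fin 2) ℂ} {g : MvPowerSeries (Fin 2) ℂ}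
    (hf : Associated (θ f) g) {n D : ℕ}
    (hb : ∀ I : Ideal (MvPowerSeries (Fin 2) ℂ ⧸
      (Ideal.span {θ p} ⊔ Ideal.span {g} ⊔ augmentation ^ n)), I * I = ⊥ →
        FiniteDimensional ℂ I ∧ Module.finrank ℂ I ≤ D) :
    SquareZeroBound (Ideal.span {p} ⊔ Ideal.span {f} ⊔ RingHom.ker (eval z) ^ n) D := by
  set J := Ideal.span {θ p} ⊔ Ideal.span {g} ⊔ augmentation ^ n with hJ
  set J₀ := Ideal.span {p} ⊔ Ideal.span {f} ⊔ RingHom.ker (eval z) ^ n with hJ₀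
  have hg : Ideal.span {g} = Ideal.span {θ f} := by
    obtain ⟨u, hu⟩ := hf
    rw [← hu]
    exact Ideal.span_singleton_mul_right_unit u.isUnit _
  let π : MvPolynomial (Fin 2) ℂ →ₐ[ℂ] (MvPowerSeries (Fin 2) ℂ ⧸ J) :=
    (Ideal.Quotient.mkₐ ℂ J).comp θ
  have hπ : Function.Surjective π := by
    intro s
    obtain ⟨s, rfl⟩ := Ideal.Quotient.mk_surjective s
    obtain ⟨q, hq⟩ := h.exists_sub_mem n s
    exact ⟨q, (Ideal.Quotient.eq.2 (Ideal.mem_sup_right hq)).symm⟩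
  have hker : RingHom.ker π = J₀ := by
    ext q
    have : q ∈ RingHom.ker π ↔ θ q ∈ J := by
      rw [RingHom.mem_ker]
      exact Ideal.Quotient.eq_zero_iff_mem
    rw [this, hJ, hJ₀, hg]
    constructor
    · intro hq
      obtain ⟨a, ha, w, hw, e⟩ := Submodule.mem_sup.1 hq
      obtain ⟨b, hb, c, hc, rfl⟩ := Submodule.mem_sup.1 ha
      obtain ⟨b, rfl⟩ := Ideal.mem_span_singleton'.1 hb
      obtain ⟨c, rfl⟩ := Ideal.mem_span_singleton'.1 hc
      obtain ⟨b', hb'⟩ := h.exists_sub_mem n b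
      obtain ⟨c', hc'⟩ := h.exists_sub_mem n c
      have h1 : q - (b' * p + c' * f) ∈ RingHom.ker (eval z) ^ n := by
        rw [← h.apply_mem_iff]
        have e2 : θ (q - (b' * p + c' * f)) = θ p * (b - θ b') + θ f * (c - θ c') + w := by
          rw [map_sub, ← e]; simp only [map_add, map_mul]; ring
        rw [e2]
        exact add_mem (add_mem (Ideal.mul_mem_left _ _ hb') (Ideal.mul_mem_left _ _ hc')) hw
      rw [show q = (b' * p + c' * f) + (q - (b' * p + c' * f)) by ring]
      exact Submodule.add_mem_sup (Submodule.add_mem_sup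
        (Ideal.mul_mem_left _ _ (Ideal.mem_span_singleton_self p))
        (Ideal.mul_mem_left _ _ (Ideal.mem_span_singleton_self f))) h1
    · intro hq
      obtain ⟨a, ha, w, hw, rfl⟩ := Submodule.mem_sup.1 hq
      obtain ⟨b, hb, c, hc, rfl⟩ := Submodule.mem_sup.1 ha
      rw [map_add, map_add]
      refine Submodule.add_mem_sup (Submodule.add_mem_sup ?_ ?_) (h.apply_mem hw)
      · obtain ⟨b, rfl⟩ := Ideal.mem_span_singleton'.1 hb
        rw [map_mul]
        exact Ideal.mul_mem_left _ _ (Ideal.mem_span_singleton_self _)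
      · obtain ⟨c, rfl⟩ := Ideal.mem_span_singleton'.1 hc
        rw [map_mul]
        exact Ideal.mul_mem_left _ _ (Ideal.mem_span_singleton_self _)
  intro I hI
  let e : (MvPolynomial (Fin 2) ℂ ⧸ J₀) ≃ₐ[ℂ] (MvPowerSeries (Fin 2) ℂ ⧸ J) :=
    (Ideal.quotientEquivAlgOfEq ℂ hker.symm).trans (Ideal.quotientKerAlgEquivOfSurjective hπ)
  obtain ⟨hfd, hfr⟩ := hb (I.map e) (by rw [← Ideal.map_mul, hI, Ideal.map_bot])
  have hmap : (I.restrictScalars ℂ).map e.toLinearEquiv.toLinearMap =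
      (I.map e).restrictScalars ℂ := by
    ext s
    rw [Submodule.restrictScalars_mem, Ideal.mem_map_iff_of_surjective e e.surjective]
    rfl
  let e' : I.restrictScalars ℂ ≃ₗ[ℂ] (I.map e).restrictScalars ℂ :=
    (e.toLinearEquiv.submoduleMap (I.restrictScalars ℂ)).trans (LinearEquiv.ofEq _ _ hmap)
  have hfd' : Module.Finite ℂ ((I.map e).restrictScalars ℂ) := hfd
  refine ⟨Module.Finite.equiv e'.symm, ?_⟩
  have h1 : Module.finrank ℂ I = Module.finrank ℂ (I.map e) := e'.finrank_eq
  rw [h1]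
  exact hfr

omit h in
-- The Leibniz rule absorbs the unit and the chain rule the change of coordinates.
lemma pderiv_mem_map_tjurinaIdeal {f : MvPolynomial (Fin 2) ℂ} {g : MvPowerSeries (Fin 2) ℂ}
    (hf : Associated (θ f) g) (i : Fin 2) :
    MvPowerSeries.pderiv ℂ i g ∈ (tjurinaIdeal f).map θ := by
  obtain ⟨u, rfl⟩ := hf
  rw [Derivation.leibniz]
  have hθ : θ = aeval fun i => θ (X i) := by ext i; simp
  refine add_mem (Ideal.mul_mem_right _ _ (Ideal.mem_map_of_mem _ (mem_tjurinaIdeal_self f)))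
    (Ideal.mul_mem_left _ _ ?_)
  have h1 := Derivation.map_mvPolynomial_aeval (MvPowerSeries.pderiv ℂ i) (fun i => θ (X i)) f
  rw [← hθ] at h1
  rw [h1]
  refine sum_mem fun j _ => Ideal.mul_mem_right _ _ (Ideal.mem_map_of_mem _
    (pderiv_mem_tjurinaIdeal f j))

end

section Quotient

variable {J : Ideal (MvPowerSeries (Fin 2) ℂ)}

lemma map_mk_pow_eq_bot {n : ℕ} (hJ : augmentation ^ n ≤ J) :
    (augmentation.map (Ideal.Quotient.mk J)) ^ n = ⊥ := by
  rw [← Ideal.map_pow, Ideal.map_eq_bot_iff_le_ker, Ideal.mk_ker]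
  exact hJ

lemma mk_mem_map_pow {i : ℕ} {s : MvPowerSeries (Fin 2) ℂ} (hs : s ∈ augmentation ^ i) :
    Ideal.Quotient.mk J s ∈ (augmentation.map (Ideal.Quotient.mk J)) ^ i := by
  rw [← Ideal.map_pow]
  exact Ideal.mem_map_of_mem _ hs

lemma exists_mk_eq {r : MvPowerSeries (Fin 2) ℂ ⧸ J}
    (hr : r ∈ augmentation.map (Ideal.Quotient.mk J)) :
    ∃ s ∈ augmentation, Ideal.Quotient.mk J s = r :=
  (Ideal.mem_map_iff_of_surjective _ Ideal.Quotient.mk_surjective).1 hr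

lemma mk_sub_mem_map_sq {r : MvPowerSeries (Fin 2) ℂ ⧸ J}
    (hr : r ∈ augmentation.map (Ideal.Quotient.mk J)) :
    ∃ c d : ℂ, r - (c • Ideal.Quotient.mk J (MvPowerSeries.X 0) +
      d • Ideal.Quotient.mk J (MvPowerSeries.X 1)) ∈ (augmentation.map (Ideal.Quotient.mk J)) ^ 2 := by
  obtain ⟨s, hs, rfl⟩ := exists_mk_eq hr
  obtain ⟨c, d, h⟩ := MvPowerSeries.mem_augmentation_iff_exists hs
  exact ⟨c, d, mk_mem_map_pow h⟩

end Quotient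

include h

/-- Half the y-derivative of the normal form is y. Modulo an approximation of it, the local ring is
generated by x, and the equation controls x^(l+1). -/
lemma localBound_A {f : MvPolynomial (Fin 2) ℂ} {l : ℕ} (hl : 1 ≤ l)
    (hf : Associated (θ f) (ADType.A l hl).normalForm) : LocalBound f z ((l + 1) / 2) := by
  set g := (ADType.A l hl).normalForm with hg
  have hgdef : g = MvPowerSeries.X 1 ^ 2 + MvPowerSeries.X 0 ^ (l + 1) := rfl
  have hY : (MvPowerSeries.X 1 : MvPowerSeries (Fin 2) ℂ) ∈ (tjurinaIdeal f).map θ := by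
    have h1 := pderiv_mem_map_tjurinaIdeal hf 1
    have h2 : MvPowerSeries.pderiv ℂ 1 g = MvPowerSeries.C 2 * MvPowerSeries.X 1 := by
      rw [hgdef, map_add, Derivation.leibniz_pow, Derivation.leibniz_pow,
        MvPowerSeries.pderiv_X_self, MvPowerSeries.pderiv_X_of_ne (by decide)]
      simp only [map_ofNat, smul_eq_mul, nsmul_eq_mul]
      push_cast; ring
    rw [h2] at h1
    have h3 := Ideal.mul_mem_left _ (MvPowerSeries.C (2⁻¹ : ℂ)) h1
    rwa [← mul_assoc, ← map_mul, inv_mul_cancel₀ two_ne_zero, map_one, one_mul] at h3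
  have hXm : ∀ i, (MvPowerSeries.X i : MvPowerSeries (Fin 2) ℂ) ∈ augmentation :=
    MvPowerSeries.X_mem_augmentation
  have hg2 : g ∈ augmentation ^ 2 := by
    rw [hgdef]
    exact add_mem (Ideal.pow_mem_pow (hXm 1) 2)
      (Ideal.pow_le_pow_right (by omega) (Ideal.pow_mem_pow (hXm 0) (l + 1)))
  -- Precision l + 2 puts y in m^(l+2) in the quotient, so the relation x^(l+1) = -y² puts x^(l+1)
  -- there as well. The polynomial p is not a multiple of f, having the linear term y while f has
  -- order at least 2.
  obtain ⟨p, hp, hpY⟩ := h.exists_mem_sub_mem hY (l + 2)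
  refine ⟨p, hp, fun hpf => ?_, l + 2, fun n hn => h.squareZeroBound hf ?_⟩
  · obtain ⟨c, rfl⟩ := Ideal.mem_span_singleton'.1 hpf
    obtain ⟨u, hu⟩ := hf.symm
    have h1 : θ (c * f) ∈ augmentation ^ 2 := by
      rw [map_mul, ← hu]
      exact Ideal.mul_mem_left _ _ (Ideal.mul_mem_right _ _ hg2)
    have h2 := sub_mem h1 (Ideal.pow_le_pow_right (by omega) hpY : _ ∈ augmentation ^ 2)
    rw [sub_sub_cancel] at h2
    have := MvPowerSeries.coeff_eq_zero_of_mem_augmentation_pow h2 (d := Finsupp.single 1 1)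
      (by simp)
    simp [MvPowerSeries.coeff_index_single_self_X] at this
  · set J := Ideal.span {θ p} ⊔ Ideal.span {g} ⊔ augmentation ^ n
    intro I hI
    set m := augmentation.map (Ideal.Quotient.mk J) with hm
    have hpJ : θ p ∈ J := Ideal.mem_sup_left (Ideal.mem_sup_left (Ideal.mem_span_singleton_self _))
    have hgJ : g ∈ J := Ideal.mem_sup_left (Ideal.mem_sup_right (Ideal.mem_span_singleton_self _))
    have hYm : Ideal.Quotient.mk J (MvPowerSeries.X 1) ∈ m ^ (l + 2) := by
      have h1 := mk_mem_map_pow (J := J) hpY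
      rw [map_sub, Ideal.Quotient.eq_zero_iff_mem.2 hpJ, zero_sub] at h1
      exact neg_mem_iff.1 h1
    obtain ⟨hfd, hfr⟩ := finrank_le_of_sq_eq_bot_of_principal (m := m) (l := l)
      (map_mk_pow_eq_bot (n := n) (le_sup_right : augmentation ^ n ≤ J))
      (X := Ideal.Quotient.mk J (MvPowerSeries.X 0)) (fun a => by
        obtain ⟨s, rfl⟩ := Ideal.Quotient.mk_surjective a
        exact ⟨MvPowerSeries.constantCoeff s, Ideal.mem_map_of_mem _
          (MvPowerSeries.exists_sub_C_mem_augmentation s)⟩)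
      (Ideal.mem_map_of_mem _ (hXm 0)) (fun r hr => by
        obtain ⟨c, d, hcd⟩ := mk_sub_mem_map_sq hr
        refine ⟨c, ?_⟩
        have hd : d • Ideal.Quotient.mk J (MvPowerSeries.X 1) ∈ m ^ 2 :=
          Submodule.smul_of_tower_mem _ d (Ideal.pow_le_pow_right (by omega) hYm)
        have := add_mem hcd hd
        rwa [← sub_sub, sub_add_cancel] at this) (by
        have h1 : Ideal.Quotient.mk J (MvPowerSeries.X 0) ^ (l + 1) =
            - Ideal.Quotient.mk J (MvPowerSeries.X 1) ^ 2 := by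
          rw [eq_neg_iff_add_eq_zero, add_comm, ← map_pow, ← map_pow, ← map_add]
          exact Ideal.Quotient.eq_zero_iff_mem.2 hgJ
        rw [h1, pow_two]
        exact neg_mem (Ideal.mul_mem_left _ _ hYm))
    refine ⟨FiniteDimensional.finiteDimensional_submodule (I.restrictScalars ℂ), ?_⟩
    have := hfr I hI
    omega

/-- The element g is the y-derivative plus half the x-derivative of the normal form. Its quadratic
part x² + xy + γy² has discriminant 1 - 4γ, which is 1 or -11, so it is not a square. If s² is zero
in the quotient, the square of the linear part of s is a multiple of this form, so s has no linear
part. Hence square-zero ideals lie in m². -/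
lemma localBound_D {f : MvPolynomial (Fin 2) ℂ} {k : ℕ} (hk : 4 ≤ k)
    (hf : Associated (θ f) (ADType.D k hk).normalForm) : LocalBound f z (k - 1) := by
  set x : MvPowerSeries (Fin 2) ℂ := MvPowerSeries.X 0
  set y : MvPowerSeries (Fin 2) ℂ := MvPowerSeries.X 1
  have hx : x ∈ augmentation := MvPowerSeries.X_mem_augmentation 0
  have hy : y ∈ augmentation := MvPowerSeries.X_mem_augmentation 1
  set nf := (ADType.D k hk).normalForm with hnf
  have hnfdef : nf = x ^ 2 * y + y ^ (k - 1) := rfl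
  set g : MvPowerSeries (Fin 2) ℂ := x ^ 2 + x * y + (k - 1 : ℂ) • y ^ (k - 2) with hg
  have hgJ : g ∈ (tjurinaIdeal f).map θ := by
    have h0 : MvPowerSeries.pderiv ℂ 0 nf = MvPowerSeries.C 2 * (x * y) := by
      rw [hnfdef, map_add, Derivation.leibniz, Derivation.leibniz_pow, Derivation.leibniz_pow,
        MvPowerSeries.pderiv_X_self, MvPowerSeries.pderiv_X_of_ne (by decide)]
      simp only [smul_eq_mul, nsmul_eq_mul, map_ofNat, mul_one]
      push_cast; ring
    have h1 : MvPowerSeries.pderiv ℂ 1 nf = x ^ 2 + (k - 1 : ℂ) • y ^ (k - 2) := by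
      rw [hnfdef, map_add, Derivation.leibniz, Derivation.leibniz_pow, Derivation.leibniz_pow,
        MvPowerSeries.pderiv_X_self, MvPowerSeries.pderiv_X_of_ne (by decide),
        MvPowerSeries.smul_eq_C_mul]
      have e : ((k - 1 : ℕ) : MvPowerSeries (Fin 2) ℂ) = MvPowerSeries.C (k - 1 : ℂ) := by
        rw [← map_natCast (MvPowerSeries.C (σ := Fin 2) (R := ℂ)), Nat.cast_sub (by omega)]; simp
      simp only [smul_eq_mul, nsmul_eq_mul, mul_one, mul_zero, add_zero, e]
      rw [show k - 1 - 1 = k - 2 by omega]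
    have h2 := pderiv_mem_map_tjurinaIdeal hf 0
    have h3 := pderiv_mem_map_tjurinaIdeal hf 1
    rw [h0] at h2
    rw [h1] at h3
    have h4 := Ideal.mul_mem_left _ (MvPowerSeries.C (2⁻¹ : ℂ)) h2
    rw [← mul_assoc, ← map_mul, inv_mul_cancel₀ two_ne_zero, map_one, one_mul] at h4
    have := add_mem h3 h4
    rwa [hg, add_right_comm]
  have hmul : ∀ {i j : ℕ} {a b : MvPowerSeries (Fin 2) ℂ}, a ∈ augmentation ^ i →
      b ∈ augmentation ^ j → a * b ∈ augmentation ^ (i + j) :=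
    fun ha hb => by rw [pow_add]; exact Ideal.mul_mem_mul ha hb
  have hpm : ∀ {i j : ℕ} {a : MvPowerSeries (Fin 2) ℂ}, j ≤ i → a ∈ augmentation ^ i →
      a ∈ augmentation ^ j := fun hij ha => Ideal.pow_le_pow_right hij ha
  have hyp : ∀ i, y ^ i ∈ augmentation ^ i := fun i => Ideal.pow_mem_pow hy i
  have hnf3 : nf ∈ augmentation ^ 3 := by
    rw [hnfdef]
    exact add_mem (hmul (i := 2) (j := 1) (Ideal.pow_mem_pow hx 2) (by simpa using hy))
      (hpm (by omega) (hyp _))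
  -- The term (k - 1) y^(k-2) is quadratic only for k = 4, where its coefficient is 3.
  have hg3 : ∃ γ : ℂ, (γ = 0 ∨ γ = 3) ∧
      g - (x ^ 2 + x * y + MvPowerSeries.C γ * y ^ 2) ∈ augmentation ^ 3 := by
    rcases Nat.lt_or_ge 4 k with h5 | h5
    · refine ⟨0, Or.inl rfl, ?_⟩
      rw [hg, map_zero, zero_mul, add_zero, add_sub_cancel_left, MvPowerSeries.smul_eq_C_mul]
      exact Ideal.mul_mem_left _ _ (hpm (by omega) (hyp _))
    · obtain rfl : k = 4 := by omega
      refine ⟨3, Or.inr rfl, ?_⟩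
      rw [hg, MvPowerSeries.smul_eq_C_mul]
      norm_num
  obtain ⟨γ, hγ, hgγ⟩ := hg3
  have hg2 : g ∈ augmentation ^ 2 := by
    have h1 : x ^ 2 + x * y + MvPowerSeries.C γ * y ^ 2 ∈ augmentation ^ 2 :=
      add_mem (add_mem (Ideal.pow_mem_pow hx 2) (by rw [pow_two]; exact Ideal.mul_mem_mul hx hy))
        (Ideal.mul_mem_left _ _ (hyp 2))
    have := add_mem (hpm (by omega : 2 ≤ 3) hgγ) h1
    rwa [sub_add_cancel] at this
  obtain ⟨p, hp, hpg⟩ := h.exists_mem_sub_mem hgJ (k + 3)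
  have hpg3 : θ p - g ∈ augmentation ^ 3 := hpm (by omega) hpg
  -- The threshold 3 suffices because only quadratic parts are compared. The polynomial p is not a
  -- multiple of f, since f has order at least 3.
  refine ⟨p, hp, fun hpf => ?_, 3, fun n hn => h.squareZeroBound hf ?_⟩
  · obtain ⟨c, rfl⟩ := Ideal.mem_span_singleton'.1 hpf
    obtain ⟨u, hu⟩ := hf.symm
    have h1 : θ (c * f) ∈ augmentation ^ 3 := by
      rw [map_mul, ← hu]
      exact Ideal.mul_mem_left _ _ (Ideal.mul_mem_right _ _ hnf3)
    have h2 := sub_mem (sub_mem h1 hpg3) hgγ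
    have := (MvPowerSeries.eq_zero_of_quadratic_mem (α := 1) (β := 1) (γ := γ) (by
      convert h2 using 1; simp only [map_one, x, y]; ring)).1
    exact one_ne_zero this
  · set J := Ideal.span {θ p} ⊔ Ideal.span {nf} ⊔ augmentation ^ n
    intro I hI
    set m := augmentation.map (Ideal.Quotient.mk J) with hm
    have hpJ : θ p ∈ J := Ideal.mem_sup_left (Ideal.mem_sup_left (Ideal.mem_span_singleton_self _))
    have hnfJ : nf ∈ J := Ideal.mem_sup_left (Ideal.mem_sup_right (Ideal.mem_span_singleton_self _))
    refine finrank_le_of_le_sq (m := m) hk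
      (map_mk_pow_eq_bot (n := n) (le_sup_right : augmentation ^ n ≤ J))
      (x := Ideal.Quotient.mk J x) (y := Ideal.Quotient.mk J y) (Ideal.mem_map_of_mem _ hx)
      (Ideal.mem_map_of_mem _ hy) (fun r hr => mk_sub_mem_map_sq hr) ?_ ?_ I fun r hr => ?_
    · rw [← map_pow, ← map_mul, ← map_pow, ← map_add]
      change Ideal.Quotient.mk J nf ∈ _
      rw [Ideal.Quotient.eq_zero_iff_mem.2 hnfJ]
      exact zero_mem _
    · have h1 := mk_mem_map_pow (J := J) hpg
      rw [map_sub, Ideal.Quotient.eq_zero_iff_mem.2 hpJ, zero_sub] at h1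
      exact neg_mem_iff.1 h1
    · obtain ⟨s, rfl⟩ := Ideal.Quotient.mk_surjective r
      have hs2 : s * s ∈ J := by
        rw [← Ideal.Quotient.eq_zero_iff_mem, map_mul, ← Ideal.mem_bot, ← hI]
        exact Ideal.mul_mem_mul hr hr
      obtain ⟨a, ha, w, hw, e⟩ := Submodule.mem_sup.1 hs2
      obtain ⟨b, hb, c, hc, rfl⟩ := Submodule.mem_sup.1 ha
      obtain ⟨b, rfl⟩ := Ideal.mem_span_singleton'.1 hb
      obtain ⟨c, rfl⟩ := Ideal.mem_span_singleton'.1 hc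
      set β := MvPowerSeries.constantCoeff b
      have hw3 : w ∈ augmentation ^ 3 := hpm hn hw
      have h1 : s * s - MvPowerSeries.C β * (x ^ 2 + x * y + MvPowerSeries.C γ * y ^ 2) ∈
          augmentation ^ 3 := by
        have e1 : s * s - MvPowerSeries.C β * (x ^ 2 + x * y + MvPowerSeries.C γ * y ^ 2) =
            b * (θ p - g) + (b - MvPowerSeries.C β) * g +
            MvPowerSeries.C β * (g - (x ^ 2 + x * y + MvPowerSeries.C γ * y ^ 2)) + c * nf + w := by
          rw [← e]; ring
        rw [e1]
        refine add_mem (add_mem (add_mem (add_mem (Ideal.mul_mem_left _ _ hpg3) ?_)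
          (Ideal.mul_mem_left _ _ hgγ)) (Ideal.mul_mem_left _ _ hnf3)) hw3
        exact hmul (i := 1) (by simpa using MvPowerSeries.exists_sub_C_mem_augmentation b) hg2
      have hs : s ∈ augmentation := by
        have h2 : s * s ∈ augmentation := by
          have h3 : MvPowerSeries.C β * (x ^ 2 + x * y + MvPowerSeries.C γ * y ^ 2) ∈ augmentation := by
            rw [pow_two, pow_two]
            exact Ideal.mul_mem_left _ _ (add_mem (add_mem (Ideal.mul_mem_left _ _ hx)
              (Ideal.mul_mem_left _ _ hy)) (Ideal.mul_mem_left _ _ (Ideal.mul_mem_left _ _ hy)))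
          have := add_mem (by simpa using hpm (by omega : 1 ≤ 3) h1) h3
          rwa [sub_add_cancel] at this
        rw [MvPowerSeries.mem_augmentation, map_mul] at h2
        exact mul_self_eq_zero.1 h2
      obtain ⟨c, d, hcd⟩ := MvPowerSeries.mem_augmentation_iff_exists hs
      set q := s - (c • x + d • y) with hq
      have hsq : s = MvPowerSeries.C c * x + MvPowerSeries.C d * y + q := by
        rw [hq, MvPowerSeries.smul_eq_C_mul, MvPowerSeries.smul_eq_C_mul]; ring
      have h4 : MvPowerSeries.C (c ^ 2 - β) * x ^ 2 + MvPowerSeries.C (2 * c * d - β) * (x * y) +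
          MvPowerSeries.C (d ^ 2 - β * γ) * y ^ 2 ∈ augmentation ^ 3 := by
        have e1 : MvPowerSeries.C (c ^ 2 - β) * x ^ 2 + MvPowerSeries.C (2 * c * d - β) * (x * y) +
          MvPowerSeries.C (d ^ 2 - β * γ) * y ^ 2 =
            s * s - MvPowerSeries.C β * (x ^ 2 + x * y + MvPowerSeries.C γ * y ^ 2) -
            q * (s + (MvPowerSeries.C c * x + MvPowerSeries.C d * y)) := by
          rw [hsq]; simp only [map_sub, map_mul, map_pow, map_ofNat]; ring
        rw [e1]
        refine sub_mem h1 (hmul (i := 2) (j := 1) hcd ?_)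
        rw [pow_one]
        exact add_mem hs (add_mem (Ideal.mul_mem_left _ _ hx) (Ideal.mul_mem_left _ _ hy))
      obtain ⟨h5, h6, h7⟩ := MvPowerSeries.eq_zero_of_quadratic_mem h4
      have hcd0 : c = 0 ∧ d = 0 := by
        have hβ : β = c ^ 2 := by linear_combination -h5
        rw [hβ] at h6 h7
        have h8 : c * (2 * d - c) = 0 := by linear_combination h6
        rcases mul_eq_zero.1 h8 with h9 | h9
        · subst h9
          exact ⟨rfl, by simpa using h7⟩
        · have h10 : c = 2 * d := by linear_combination -h9
          subst h10
          have : d = 0 := by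
            rcases hγ with rfl | rfl
            · simpa using h7
            · have : d ^ 2 * (-11) = 0 := by linear_combination h7
              simpa using this
          simp [this]
      have hs2' : s ∈ augmentation ^ 2 := by
        rw [hsq, hcd0.1, hcd0.2]
        simpa using hcd
      exact mk_mem_map_pow hs2'

lemma localBound {f : MvPolynomial (Fin 2) ℂ} (t : ADType) (hf : Associated (θ f) t.normalForm) :
    LocalBound f z t.deltaBound := by
  cases t with
  | A l hl => exact h.localBound_A hl hf
  | D k hk => exact h.localBound_D hk hf

end IsFormalChart

end

noncomputable section

/-! ## Linear changes of coordinates and singular points -/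

open MvPolynomial
open scoped LinearAlgebra.Projectivization

/-- The form `F(X₀ e₀ + X₁ e₁ + X₂ e₂)`. -/
def pullbackForm (e : Module.Basis (Fin 3) ℂ (Fin 3 → ℂ)) (F : MvPolynomial (Fin 3) ℂ) :
    MvPolynomial (Fin 3) ℂ :=
  aeval (fun i => ∑ j, C (e j i) * X j) F

section Pullback

variable (e : Module.Basis (Fin 3) ℂ (Fin 3 → ℂ)) {F : MvPolynomial (Fin 3) ℂ}

lemma aeval_pullbackForm {A : Type*} [CommRing A] [Algebra ℂ A] (F : MvPolynomial (Fin 3) ℂ)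
    (w : Fin 3 → A) :
    aeval w (pullbackForm e F) = aeval (fun i => ∑ j, algebraMap ℂ A (e j i) * w j) F := by
  rw [pullbackForm, ← AlgHom.comp_apply]
  congr 1
  ext i
  simp

lemma eval_pullbackForm (F : MvPolynomial (Fin 3) ℂ) (w : Fin 3 → ℂ) :
    eval w (pullbackForm e F) = eval (∑ j, w j • e j) F := by
  have h := aeval_pullbackForm e F w
  change eval w _ = eval _ F at h
  refine h.trans ?_
  congr 2
  ext i
  simp [mul_comm]

lemma isHomogeneous_pullbackForm {d : ℕ} (hF : F.IsHomogeneous d) :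
    (pullbackForm e F).IsHomogeneous d := by
  have h := hF.aeval (fun i => ∑ j, C (e j i) * X j : Fin 3 → MvPolynomial (Fin 3) ℂ) (n := 1)
    (fun i => IsHomogeneous.sum _ _ _ fun j _ => by
      simpa using (isHomogeneous_C (Fin 3) (e j i)).mul (isHomogeneous_X ℂ j))
  rwa [one_mul] at h

lemma eval_pderiv_pullbackForm (F : MvPolynomial (Fin 3) ℂ) (w : Fin 3 → ℂ) (j : Fin 3) :
    eval w (pderiv j (pullbackForm e F)) =
      ∑ i, e j i * eval (∑ j, w j • e j) (pderiv i F) := by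
  have h := Derivation.map_mvPolynomial_aeval (pderiv (R := ℂ) j)
    (fun i => ∑ j, C (e j i) * X j : Fin 3 → MvPolynomial (Fin 3) ℂ) F
  rw [pullbackForm, h, map_sum]
  refine Finset.sum_congr rfl fun i _ => ?_
  have h1 : pderiv j (∑ j, C (e j i) * X j : MvPolynomial (Fin 3) ℂ) = C (e j i) := by
    rw [map_sum, Finset.sum_eq_single j]
    · simp
    · intro k _ hk
      simp [pderiv_X_of_ne hk]
    · simp
  rw [h1, smul_eq_mul, map_mul, eval_C, mul_comm, ← eval_pullbackForm e (pderiv i F) w]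
  rfl

lemma eval_affineEquation (Φ : MvPolynomial (Fin 3) ℂ) (z : Fin 2 → ℂ) :
    eval z (affineEquation Φ) = eval ![z 0, z 1, 1] Φ := by
  rw [affineEquation, ← coe_aeval_eq_eval, ← coe_aeval_eq_eval, RingHom.coe_coe, RingHom.coe_coe,
    ← AlgHom.comp_apply]
  congr 1
  ext i; fin_cases i <;> simp

lemma MvPolynomial.IsHomogeneous.eval_smul_eq {Φ : MvPolynomial (Fin 3) ℂ} {d : ℕ}
    (hΦ : Φ.IsHomogeneous d) (c : ℂ) (v : Fin 3 → ℂ) : eval (c • v) Φ = c ^ d * eval v Φ :=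
  hΦ.aeval_smul_eq c v

/-- A singular point of the affine chart is a singular point of the curve. -/
lemma eval_pderiv_eq_zero_of_affine {d : ℕ} (hd : F.IsHomogeneous d) {z : Fin 2 → ℂ}
    (h0 : eval z (affineEquation (pullbackForm e F)) = 0)
    (h1 : ∀ i, eval z (pderiv i (affineEquation (pullbackForm e F))) = 0) (i : Fin 3) :
    eval (z 0 • e 0 + z 1 • e 1 + e 2) (pderiv i F) = 0 := by
  set Φ := pullbackForm e F with hΦ
  have hsum : ∑ j, ![z 0, z 1, 1] j • e j = z 0 • e 0 + z 1 • e 1 + e 2 := by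
    simp [Fin.sum_univ_three]
  have hpd : ∀ p, eval z (aeval ![X 0, X 1, 1] p) = eval ![z 0, z 1, 1] p :=
    fun p => eval_affineEquation p z
  have h10 := h1 0
  have h11 := h1 1
  rw [pderiv_zero_affineEquation, hpd] at h10
  rw [pderiv_one_affineEquation, hpd] at h11
  rw [eval_affineEquation] at h0
  -- Euler's relation supplies the third partial derivative, since the last coordinate of the point
  -- is 1.
  have heuler := (isHomogeneous_pullbackForm e hd).sum_X_mul_pderiv
  have h2 : eval ![z 0, z 1, 1] (pderiv 2 Φ) = 0 := by
    have := congrArg (eval ![z 0, z 1, 1]) heuler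
    rw [Fin.sum_univ_three] at this
    simp only [← hΦ] at this
    simpa [h0, h10, h11] using this
  have hall : ∀ j, ∑ i, e j i * eval (z 0 • e 0 + z 1 • e 1 + e 2) (pderiv i F) = 0 := by
    intro j
    rw [← hsum, ← eval_pderiv_pullbackForm]
    fin_cases j
    · exact h10
    · exact h11
    · exact h2
  -- a linear functional vanishing on a basis vanishes
  let L : (Fin 3 → ℂ) →ₗ[ℂ] ℂ :=
    ∑ i, (eval (z 0 • e 0 + z 1 • e 1 + e 2) (pderiv i F)) • LinearMap.proj i
  have hL : L = 0 := e.ext fun j => by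
    simpa [L, mul_comm] using hall j
  have := LinearMap.congr_fun hL (Pi.single i 1)
  simpa [L, Pi.single_apply] using this

end Pullback

/-! ## Formal charts from affine charts -/

namespace IsFormalChart

variable {θ : MvPolynomial (Fin 2) ℂ →ₐ[ℂ] MvPowerSeries (Fin 2) ℂ} {z : Fin 2 → ℂ}

open MvPowerSeries (augmentation augmentation_eq_maximalIdeal)

/-- Automorphisms preserve units, hence the maximal ideal; no continuity assumption is needed. -/
lemma _root_.MvPowerSeries.algEquiv_mem_augmentation
    (φ : MvPowerSeries (Fin 2) ℂ ≃ₐ[ℂ] MvPowerSeries (Fin 2) ℂ) {s : MvPowerSeries (Fin 2) ℂ}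
    (hs : s ∈ augmentation) : φ s ∈ augmentation := by
  rw [augmentation_eq_maximalIdeal, IsLocalRing.mem_maximalIdeal, mem_nonunits_iff] at hs ⊢
  exact fun h => hs ((isUnit_map_iff φ s).1 h)

lemma comp_algEquiv (h : IsFormalChart θ z)
    (φ : MvPowerSeries (Fin 2) ℂ ≃ₐ[ℂ] MvPowerSeries (Fin 2) ℂ) :
    IsFormalChart ((φ : MvPowerSeries (Fin 2) ℂ →ₐ[ℂ] MvPowerSeries (Fin 2) ℂ).comp θ) z where
  mem_augmentation i := MvPowerSeries.algEquiv_mem_augmentation φ (h.mem_augmentation i)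
  le_span s hs := by
    have h1 := h.le_span (MvPowerSeries.algEquiv_mem_augmentation φ.symm hs)
    obtain ⟨a, b, hab⟩ := Ideal.mem_span_pair.1 h1
    refine Ideal.mem_span_pair.2 ⟨φ a, φ b, ?_⟩
    have := congrArg φ hab
    rw [map_add, map_mul, map_mul, AlgEquiv.apply_symm_apply] at this
    exact this

end IsFormalChart

section LocalEquation

variable (C₀ : IrredPlaneCurve 5) (e : Module.Basis (Fin 3) ℂ (Fin 3 → ℂ))

open MvPowerSeries (augmentation)

/-- The expansion of the coordinates of the point `v + x a + y b` in the basis `e`. -/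
def coordSeries (v a b : Fin 3 → ℂ) (j : Fin 3) : MvPowerSeries (Fin 2) ℂ :=
  MvPowerSeries.C (e.repr v j) + MvPowerSeries.C (e.repr a j) * MvPowerSeries.X 0 +
    MvPowerSeries.C (e.repr b j) * MvPowerSeries.X 1

lemma sum_coordSeries (v a b : Fin 3 → ℂ) (i : Fin 3) :
    ∑ j, algebraMap ℂ (MvPowerSeries (Fin 2) ℂ) (e j i) * coordSeries e v a b j =
      MvPowerSeries.C (v i) + MvPowerSeries.C (a i) * MvPowerSeries.X 0 +
        MvPowerSeries.C (b i) * MvPowerSeries.X 1 := by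
  have h : ∀ w : Fin 3 → ℂ, w i = ∑ j, e j i * e.repr w j := by
    intro w
    conv_lhs => rw [← e.sum_repr w]
    simp [mul_comm]
  rw [h v, h a, h b, map_sum, map_sum, map_sum, Finset.sum_mul, Finset.sum_mul,
    ← Finset.sum_add_distrib, ← Finset.sum_add_distrib]
  refine Finset.sum_congr rfl fun j _ => ?_
  rw [coordSeries, MvPowerSeries.algebraMap_apply, Algebra.algebraMap_self, RingHom.id_apply,
    map_mul, map_mul, map_mul]
  ring

lemma aeval_coordSeries (v a b : Fin 3 → ℂ) :
    aeval (coordSeries e v a b) (pullbackForm e C₀.form) =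
      (C₀.localEquation v a b : MvPowerSeries (Fin 2) ℂ) := by
  rw [aeval_pullbackForm, IrredPlaneCurve.localEquation]
  change _ = (MvPolynomial.coeToMvPowerSeries.algHom (σ := Fin 2) (R := ℂ) ℂ) _
  rw [← AlgHom.comp_apply]
  congr 1
  ext1 i
  rw [aeval_X, sum_coordSeries]
  simp

/-- The chart sends the affine coordinates to W₀/W₂ and W₁/W₂, where W is the generic point v + x a
+ y b in the basis e. By homogeneity the two equations differ by the unit W₂⁵. -/
lemma exists_isFormalChart {v a b : Fin 3 → ℂ} (hv : e.repr v 2 ≠ 0)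
    (hli : LinearIndependent ℂ ![v, a, b]) :
    ∃ θ, IsFormalChart θ ![e.repr v 0 / e.repr v 2, e.repr v 1 / e.repr v 2] ∧
      Associated (θ (affineEquation (pullbackForm e C₀.form)))
        (C₀.localEquation v a b : MvPowerSeries (Fin 2) ℂ) := by
  let W := coordSeries e v a b
  have hW : ∀ j, MvPowerSeries.constantCoeff (W j) = e.repr v j := fun j => by
    simp [W, coordSeries]
  have hW2 : MvPowerSeries.constantCoeff (W 2) ≠ 0 := by rwa [hW]
  have hinv : W 2 * (W 2)⁻¹ = 1 := MvPowerSeries.mul_inv_cancel _ hW2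
  let θ : MvPolynomial (Fin 2) ℂ →ₐ[ℂ] MvPowerSeries (Fin 2) ℂ :=
    aeval ![W 0 * (W 2)⁻¹, W 1 * (W 2)⁻¹]
  refine ⟨θ, ⟨fun i => ?_, ?_⟩, ?_⟩
  · have hθC : ∀ c : ℂ, θ (C c) = MvPowerSeries.C c := fun c => θ.commutes c
    rw [MvPowerSeries.mem_augmentation, map_sub, hθC]
    fin_cases i <;> simp [θ, hW, MvPowerSeries.constantCoeff_inv, div_eq_mul_inv]
  · have hθC : ∀ c : ℂ, θ (C c) = MvPowerSeries.C c := fun c => θ.commutes c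
    set z : Fin 2 → ℂ := ![e.repr v 0 / e.repr v 2, e.repr v 1 / e.repr v 2] with hz
    -- Up to a scalar, M is the Jacobian matrix of the chart at the origin. A kernel vector would
    -- give a linear relation between v, a and b.
    let M : Matrix (Fin 2) (Fin 2) ℂ :=
      !![e.repr a 0 - z 0 * e.repr a 2, e.repr b 0 - z 0 * e.repr b 2;
        e.repr a 1 - z 1 * e.repr a 2, e.repr b 1 - z 1 * e.repr b 2]
    have hdet : M.det ≠ 0 := by
      intro h0
      obtain ⟨c, hc, hMc⟩ := Matrix.exists_mulVec_eq_zero_iff.2 h0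
      have h1 := congrFun hMc 0
      have h2 := congrFun hMc 1
      simp [M, Matrix.mulVec, dotProduct, Fin.sum_univ_two] at h1 h2
      let t := (c 0 * e.repr a 2 + c 1 * e.repr b 2) / e.repr v 2
      have hrel : (-t) • v + c 0 • a + c 1 • b = 0 := by
        apply e.repr.injective
        ext j
        fin_cases j
        · simp [t]
          simp only [hz, Matrix.cons_val_zero] at h1
          field_simp at h1 ⊢
          linear_combination h1
        · simp [t]
          simp only [hz, Matrix.cons_val_one, Matrix.cons_val_zero] at h2
          field_simp at h2 ⊢
          linear_combination h2
        · simp [t]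
          field_simp
          ring
      have h3 := Fintype.linearIndependent_iff.1 hli ![-t, c 0, c 1] (by
        simpa [Fin.sum_univ_three] using hrel)
      apply hc
      ext i
      fin_cases i
      · simpa using h3 1
      · simpa using h3 2
    set I : Ideal (MvPowerSeries (Fin 2) ℂ) := Ideal.span {θ (X 0 - C (z 0)), θ (X 1 - C (z 1))}
    -- Multiplied by W₂, the centred coordinate becomes W_i - z_i W₂, which is exactly linear
    -- because its constant term cancels. Cramer's rule then recovers both variables.
    have hmem : ∀ i : Fin 2, MvPowerSeries.C (M i 0) * MvPowerSeries.X 0 +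
        MvPowerSeries.C (M i 1) * MvPowerSeries.X 1 ∈ I := by
      intro i
      have h1 : θ (X i - C (z i)) ∈ I := Ideal.subset_span (by fin_cases i <;> simp)
      have h2 := I.mul_mem_left (W 2) h1
      convert h2 using 1
      rw [map_sub, hθC]
      have hθX : θ (X i) = W i.castSucc * (W 2)⁻¹ := by
        fin_cases i <;> simp [θ]
      have hzi : z i * e.repr v 2 = e.repr v i.castSucc := by
        fin_cases i <;> simp [hz, hv]
      rw [hθX, mul_sub, mul_left_comm, hinv, mul_one]
      have hM0 : M i 0 = e.repr a i.castSucc - z i * e.repr a 2 := by fin_cases i <;> simp [M]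
      have hM1 : M i 1 = e.repr b i.castSucc - z i * e.repr b 2 := by fin_cases i <;> simp [M]
      simp only [W, coordSeries, hM0, hM1, ← hzi, map_sub, map_mul]
      ring
    rw [MvPowerSeries.augmentation_eq_span, Ideal.span_le]
    have hd : M.det = M 0 0 * M 1 1 - M 0 1 * M 1 0 := Matrix.det_fin_two M
    have hCd : MvPowerSeries.C (M.det)⁻¹ * MvPowerSeries.C M.det =
        (1 : MvPowerSeries (Fin 2) ℂ) := by
      rw [← map_mul, inv_mul_cancel₀ hdet, map_one]
    have hCd' : MvPowerSeries.C (M.det)⁻¹ * (MvPowerSeries.C (M 0 0) * MvPowerSeries.C (M 1 1) -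
        MvPowerSeries.C (M 0 1) * MvPowerSeries.C (M 1 0)) = (1 : MvPowerSeries (Fin 2) ℂ) := by
      rw [← hCd, hd, map_sub, map_mul, map_mul]
    rintro _ (rfl | rfl)
    · have := I.mul_mem_left (MvPowerSeries.C (M.det)⁻¹)
        (I.sub_mem (I.mul_mem_left (MvPowerSeries.C (M 1 1)) (hmem 0))
          (I.mul_mem_left (MvPowerSeries.C (M 0 1)) (hmem 1)))
      rw [SetLike.mem_coe]
      convert this using 1
      linear_combination (-MvPowerSeries.X 0) * hCd'
    · have := I.mul_mem_left (MvPowerSeries.C (M.det)⁻¹)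
        (I.sub_mem (I.mul_mem_left (MvPowerSeries.C (M 0 0)) (hmem 1))
          (I.mul_mem_left (MvPowerSeries.C (M 1 0)) (hmem 0)))
      rw [SetLike.mem_coe]
      convert this using 1
      linear_combination (-MvPowerSeries.X 1) * hCd'
  · rw [← aeval_coordSeries C₀ e]
    have h1 : θ (affineEquation (pullbackForm e C₀.form)) =
        aeval ![W 0 * (W 2)⁻¹, W 1 * (W 2)⁻¹, 1] (pullbackForm e C₀.form) := by
      rw [affineEquation, ← AlgHom.comp_apply]
      congr 1
      ext1 i; fin_cases i <;> simp [θ]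
    have h2 := (isHomogeneous_pullbackForm e C₀.isHomogeneous).aeval_smul_eq (W 2)
      ![W 0 * (W 2)⁻¹, W 1 * (W 2)⁻¹, 1]
    have h3 : (fun i => W 2 * ![W 0 * (W 2)⁻¹, W 1 * (W 2)⁻¹, 1] i) = coordSeries e v a b := by
      ext1 i
      fin_cases i
      · simp only [Fin.zero_eta, Matrix.cons_val_zero]
        rw [mul_left_comm, hinv, mul_one]
      · simp only [Fin.mk_one, Matrix.cons_val_one, Matrix.cons_val_zero]
        rw [mul_left_comm, hinv, mul_one]
      · simp [W]
    rw [h3] at h2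
    rw [h1, h2]
    exact ⟨((IsUnit.of_mul_eq_one _ hinv).pow 5).unit, by rw [IsUnit.unit_spec, mul_comm]⟩

/-- The local bound at a singular point of type A or D of the curve. -/
lemma localBound_of_hasSingularityAt {p : ℙ ℂ (Fin 3 → ℂ)} {t : ADType}
    (hp : C₀.HasSingularityAt p t) (hv : e.repr p.rep 2 ≠ 0) :
    LocalBound (affineEquation (pullbackForm e C₀.form))
      ![e.repr p.rep 0 / e.repr p.rep 2, e.repr p.rep 1 / e.repr p.rep 2] t.deltaBound := by
  obtain ⟨a, b, hli, φ, hφ⟩ := hp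
  obtain ⟨θ, hθ, hass⟩ := exists_isFormalChart C₀ e hv hli
  exact (hθ.comp_algEquiv φ).localBound t ((hass.map φ).trans hφ)

end LocalEquation

end

noncomputable section

/-! ## Affine charts of a plane quintic -/

open MvPolynomial

section Homogenize

/-- Homogenization with respect to the last coordinate. -/
lemma exists_homogenization (p : MvPolynomial (Fin 2) ℂ) :
    ∃ (N : ℕ) (q : MvPolynomial (Fin 3) ℂ), aeval ![X 0, X 1, 1] q = p ∧
      ∀ {L : Type} [Field L] [Algebra ℂ L] (η : Fin 3 → L), η 2 ≠ 0 →
        aeval η q = η 2 ^ N * aeval ![η 0 / η 2, η 1 / η 2] p := by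
  induction p using MvPolynomial.induction_on with
  | C a => exact ⟨0, C a, by simp, fun η _ => by simp⟩
  | add p p' hp hp' =>
    obtain ⟨N, q, hq, hη⟩ := hp
    obtain ⟨N', q', hq', hη'⟩ := hp'
    refine ⟨N + N', X 2 ^ N' * q + X 2 ^ N * q', ?_, fun η h2 => ?_⟩
    · rw [map_add, map_mul, map_mul, hq, hq']; simp
    · rw [map_add, map_mul, map_mul, hη η h2, hη' η h2, map_pow, map_pow, aeval_X, map_add]; ring
  | mul_X p i hp =>
    obtain ⟨N, q, hq, hη⟩ := hp
    refine ⟨N + 1, q * X i.castSucc, ?_, fun η h2 => ?_⟩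
    · rw [map_mul, hq]
      fin_cases i <;> simp
    · rw [map_mul, hη η h2, map_mul, aeval_X, aeval_X]
      have : η 2 * ![η 0 / η 2, η 1 / η 2] i = η i.castSucc := by
        fin_cases i
        · exact mul_div_cancel₀ _ h2
        · exact mul_div_cancel₀ _ h2
      rw [← this]; ring

end Homogenize

namespace IrredPlaneCurve

variable (C₀ : IrredPlaneCurve 5) (e : Module.Basis (Fin 3) ℂ (Fin 3 → ℂ))

/-- The coordinates of the generic point of the curve in the basis `e`. -/
def genericCoord (j : Fin 3) : FractionRing C₀.CoordRing :=
  ∑ i, algebraMap ℂ (FractionRing C₀.CoordRing) (e.repr (Pi.single i 1) j) * C₀.coord i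

lemma aeval_coord (p : MvPolynomial (Fin 3) ℂ) : aeval C₀.coord p =
    algebraMap C₀.CoordRing (FractionRing C₀.CoordRing) (Ideal.Quotient.mk _ p) := by
  have : (aeval C₀.coord : MvPolynomial (Fin 3) ℂ →ₐ[ℂ] FractionRing C₀.CoordRing) =
      (IsScalarTower.toAlgHom ℂ C₀.CoordRing (FractionRing C₀.CoordRing)).comp
        (Ideal.Quotient.mkₐ ℂ (Ideal.span {C₀.form})) := by
    ext i
    simp [coord]
  rw [this]
  rfl

lemma aeval_coord_eq_zero_iff (p : MvPolynomial (Fin 3) ℂ) :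
    aeval C₀.coord p = 0 ↔ C₀.form ∣ p := by
  rw [aeval_coord, map_eq_zero_iff _ (IsFractionRing.injective C₀.CoordRing _),
    Ideal.Quotient.eq_zero_iff_mem, Ideal.mem_span_singleton]

lemma sum_repr_single (v : Fin 3 → ℂ) (j : Fin 3) :
    ∑ i, e.repr (Pi.single i 1) j * v i = e.repr v j := by
  conv_rhs => rw [← Finset.univ_sum_single v]
  rw [map_sum, Finsupp.finsetSum_apply]
  refine Finset.sum_congr rfl fun i _ => ?_
  have h : (Pi.single i (v i) : Fin 3 → ℂ) = v i • Pi.single i 1 := by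
    ext k; simp [Pi.single_apply]
  rw [h, map_smul, Finsupp.smul_apply, smul_eq_mul, mul_comm]

lemma sum_mul_repr_single (i k : Fin 3) :
    ∑ j, e j i * e.repr (Pi.single k 1) j = if i = k then 1 else 0 := by
  have h := congrFun (e.sum_repr (Pi.single k (1 : ℂ))) i
  rw [Pi.single_apply] at h
  rw [← h]
  simp [mul_comm]

lemma sum_genericCoord (i : Fin 3) :
    ∑ j, algebraMap ℂ (FractionRing C₀.CoordRing) (e j i) * C₀.genericCoord e j = C₀.coord i := by
  simp only [genericCoord, Finset.mul_sum, ← mul_assoc, ← map_mul]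
  rw [Finset.sum_comm]
  simp only [← Finset.sum_mul, ← map_sum, sum_mul_repr_single]
  simp

/-- The substitution inverse to `pullbackForm`. -/
def pushForm (q : MvPolynomial (Fin 3) ℂ) : MvPolynomial (Fin 3) ℂ :=
  aeval (fun j => ∑ i, C (e.repr (Pi.single i 1) j) * X i) q

lemma pullbackForm_pushForm (q : MvPolynomial (Fin 3) ℂ) : pullbackForm e (pushForm e q) = q := by
  rw [pullbackForm, pushForm, ← AlgHom.comp_apply]
  conv_rhs => rw [← AlgHom.id_apply (R := ℂ) q]
  congr 1
  ext1 j
  have h : ∀ k, ∑ i, e.repr (Pi.single i 1) j * e k i = if k = j then 1 else 0 := by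
    intro k
    rw [sum_repr_single, e.repr_self, Finsupp.single_apply]
  simp only [AlgHom.comp_apply, aeval_X, AlgHom.id_apply, map_sum, map_mul, aeval_C, algebraMap_eq,
    Finset.mul_sum, ← mul_assoc]
  rw [Finset.sum_comm]
  simp only [← Finset.sum_mul, ← C_mul, ← map_sum, h]
  simp

lemma aeval_genericCoord (q : MvPolynomial (Fin 3) ℂ) :
    aeval (C₀.genericCoord e) q = aeval C₀.coord (pushForm e q) := by
  rw [pushForm, ← AlgHom.comp_apply]
  congr 1
  ext1 j
  simp [genericCoord]

lemma pullbackForm_dvd_of_aeval_eq_zero {q : MvPolynomial (Fin 3) ℂ}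
    (hq : aeval (C₀.genericCoord e) q = 0) : pullbackForm e C₀.form ∣ q := by
  rw [aeval_genericCoord, aeval_coord_eq_zero_iff] at hq
  have := map_dvd (aeval (fun i => ∑ j, C (e j i) * X j) :
    MvPolynomial (Fin 3) ℂ →ₐ[ℂ] MvPolynomial (Fin 3) ℂ) hq
  change pullbackForm e C₀.form ∣ pullbackForm e (pushForm e q) at this
  rwa [pullbackForm_pushForm] at this

lemma aeval_genericCoord_pullbackForm :
    aeval (C₀.genericCoord e) (pullbackForm e C₀.form) = 0 := by
  rw [aeval_pullbackForm]
  simp only [sum_genericCoord]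
  exact (aeval_coord_eq_zero_iff C₀ _).2 dvd_rfl

/-- Otherwise a form of degree 5 would divide a variable. -/
lemma genericCoord_ne_zero (j : Fin 3) : C₀.genericCoord e j ≠ 0 := by
  intro h0
  have h1 : aeval (C₀.genericCoord e) (X j : MvPolynomial (Fin 3) ℂ) = 0 := by rwa [aeval_X]
  have h2 := C₀.pullbackForm_dvd_of_aeval_eq_zero e h1
  have hne : pullbackForm e C₀.form ≠ 0 := ne_zero_of_dvd_ne_zero (X_ne_zero j) h2
  have h3 := totalDegree_le_of_dvd_of_isDomain h2 (X_ne_zero j)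
  rw [(isHomogeneous_pullbackForm e C₀.isHomogeneous).totalDegree hne, totalDegree_X] at h3
  omega

lemma genericCoord_div_mem (i j : Fin 3) :
    C₀.genericCoord e i / C₀.genericCoord e j ∈ C₀.functionField := by
  obtain ⟨k, hk⟩ : ∃ k, C₀.coord k ≠ 0 := by
    by_contra! h
    exact C₀.genericCoord_ne_zero e 0 (by simp [genericCoord, h])
  have h1 : ∀ i, C₀.genericCoord e i / C₀.coord k ∈ C₀.functionField := by
    intro i
    rw [genericCoord, Finset.sum_div]
    refine sum_mem fun l _ => ?_
    rw [mul_div_assoc]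
    exact mul_mem (IntermediateField.algebraMap_mem _ _)
      (IntermediateField.subset_adjoin _ _ ⟨l, k, hk, rfl⟩)
  have := div_mem (h1 i) (h1 j)
  rwa [div_div_div_cancel_right₀ hk] at this

/-- The first affine coordinate, as a rational function on the curve. -/
def affineX : C₀.functionField := ⟨_, C₀.genericCoord_div_mem e 0 2⟩

/-- The second affine coordinate, as a rational function on the curve. -/
def affineY : C₀.functionField := ⟨_, C₀.genericCoord_div_mem e 1 2⟩

lemma adjoin_affine_eq_top :
    IntermediateField.adjoin ℂ {C₀.affineX e, C₀.affineY e} = ⊤ := by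
  have hL : ∀ w ∈ C₀.functionField, w ∈ IntermediateField.adjoin ℂ
      {C₀.genericCoord e 0 / C₀.genericCoord e 2, C₀.genericCoord e 1 / C₀.genericCoord e 2} := by
    change C₀.functionField ≤ _
    set M := IntermediateField.adjoin ℂ
      {C₀.genericCoord e 0 / C₀.genericCoord e 2, C₀.genericCoord e 1 / C₀.genericCoord e 2}
    have hη : ∀ j, C₀.genericCoord e j / C₀.genericCoord e 2 ∈ M := by
      intro j
      fin_cases j
      · exact IntermediateField.subset_adjoin _ _ (by simp)
      · exact IntermediateField.subset_adjoin _ _ (by simp)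
      · simp only [Fin.reduceFinMk]
        rw [div_self (C₀.genericCoord_ne_zero e 2)]
        exact one_mem M
    have hξ : ∀ i, C₀.coord i / C₀.genericCoord e 2 ∈ M := by
      intro i
      rw [← C₀.sum_genericCoord e i, Finset.sum_div]
      refine sum_mem fun j _ => ?_
      rw [mul_div_assoc]
      exact mul_mem (IntermediateField.algebraMap_mem _ _) (hη j)
    rw [functionField, IntermediateField.adjoin_le_iff]
    rintro _ ⟨i, j, hj, rfl⟩
    have := div_mem (hξ i) (hξ j)
    rwa [div_div_div_cancel_right₀ (C₀.genericCoord_ne_zero e 2)] at this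
  have hmap : (IntermediateField.adjoin ℂ {C₀.affineX e, C₀.affineY e}).map C₀.functionField.val =
      IntermediateField.adjoin ℂ
      {C₀.genericCoord e 0 / C₀.genericCoord e 2, C₀.genericCoord e 1 / C₀.genericCoord e 2} := by
    rw [IntermediateField.adjoin_map, Set.image_pair]
    rfl
  rw [eq_top_iff]
  rintro w -
  have h1 := hL w w.2
  rw [← hmap] at h1
  obtain ⟨w', hw', h2⟩ := h1
  have : w' = w := Subtype.ext h2
  exact this ▸ hw'

lemma aeval_affine_coe {σ : Type*} (v : σ → C₀.functionField) (p : MvPolynomial σ ℂ) :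
    ((aeval v p : C₀.functionField) : FractionRing C₀.CoordRing) = 
      aeval (fun i => ((v i : C₀.functionField) : FractionRing C₀.CoordRing)) p := by
  change C₀.functionField.val (aeval v p) = _
  rw [← AlgHom.comp_apply]
  congr 1
  ext1 i
  simp

theorem isPlaneChart (he : eval (e 1) C₀.form = 1) :
    IsPlaneChart (pullbackForm e C₀.form) (C₀.affineX e) (C₀.affineY e) where
  isHomogeneous := isHomogeneous_pullbackForm e C₀.isHomogeneous
  eval_eq_one := by
    rw [eval_pullbackForm]
    simpa [Fin.sum_univ_three] using he
  aeval_eq_zero := by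
    apply Subtype.ext
    rw [aeval_affine_coe]
    have h2 := C₀.genericCoord_ne_zero e 2
    have h1 := (isHomogeneous_pullbackForm e C₀.isHomogeneous).aeval_smul_eq
      (C₀.genericCoord e 2) (fun i => ((![C₀.affineX e, C₀.affineY e, 1] i : C₀.functionField) :
        FractionRing C₀.CoordRing))
    have h3 : (fun i => C₀.genericCoord e 2 * ((![C₀.affineX e, C₀.affineY e, 1] i :
        C₀.functionField) : FractionRing C₀.CoordRing)) = C₀.genericCoord e := by
      ext1 i
      fin_cases i
      · exact mul_div_cancel₀ _ h2
      · exact mul_div_cancel₀ _ h2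
      · exact mul_one _
    rw [h3, aeval_genericCoord_pullbackForm] at h1
    exact (mul_eq_zero.1 h1.symm).resolve_left (pow_ne_zero _ h2)
  dvd_of_aeval_eq_zero := by
    intro p hp
    obtain ⟨N, q, rfl, hq⟩ := exists_homogenization p
    have h1 := hq (C₀.genericCoord e) (C₀.genericCoord_ne_zero e 2)
    have h2 := congrArg (fun w : C₀.functionField => (w : FractionRing C₀.CoordRing)) hp
    simp only [aeval_affine_coe] at h2
    have h3 : (fun i => ((![C₀.affineX e, C₀.affineY e] i : C₀.functionField) :
        FractionRing C₀.CoordRing)) = ![C₀.genericCoord e 0 / C₀.genericCoord e 2,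
          C₀.genericCoord e 1 / C₀.genericCoord e 2] := by
      ext1 i
      fin_cases i <;> rfl
    rw [h3] at h2
    rw [h2, ZeroMemClass.coe_zero, mul_zero] at h1
    exact map_dvd _ (C₀.pullbackForm_dvd_of_aeval_eq_zero e h1)
  adjoin_eq_top := C₀.adjoin_affine_eq_top e

end IrredPlaneCurve

end

noncomputable section

/-! ## The line at infinity can be chosen transversal to the curve -/

open MvPolynomial
open scoped LinearAlgebra.Projectivization

namespace IsPlaneChart

variable {K : Type*} [Field K] [Algebra ℂ K] {Φ : MvPolynomial (Fin 3) ℂ} {x y : K}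
  (h : IsPlaneChart Φ x y)

include h

/-- Some line through `[0 : 1 : 0]` meets the curve transversally. -/
lemma exists_forall_ne_zero : ∃ x₀ : ℂ, ∀ Y : ℂ, eval ![x₀, Y] (affineEquation Φ) ≠ 0 ∨
    eval ![x₀, Y] (pderiv 1 (affineEquation Φ)) ≠ 0 := by
  set f := affineEquation Φ with hf
  have hne : aeval ![x, y] (pderiv 1 f) ≠ 0 := h.aeval_pderiv_one_ne_zero
  -- Clearing the denominator of 1/f_y² and multiplying by f_y gives U in ℂ[x, y] with f_y U = r(x)
  -- on the curve. So r plays the role of a discriminant, and any x₀ with r(x₀) ≠ 0 works.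
  obtain ⟨d, hd0, hd⟩ := exists_mul_mem_normalization h.isIntegral h.adjoin_eq_top
    ((aeval ![x, y] (pderiv 1 f))⁻¹ * (aeval ![x, y] (pderiv 1 f))⁻¹)
  have h1 := h.aeval_pderiv_one_mul_mem hd
  rw [← hf] at h1
  obtain ⟨r, hr⟩ := mem_adjoin_singleton_iff_aeval.1 d.2
  have h2 : ∃ U : MvPolynomial (Fin 2) ℂ, aeval ![x, y] U = aeval ![x, y] (pderiv 1 f) *
      (↑d * ((aeval ![x, y] (pderiv 1 f))⁻¹ * (aeval ![x, y] (pderiv 1 f))⁻¹)) := by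
    have : Algebra.adjoin ℂ {x, y} ≤ (aeval (R := ℂ) ![x, y]).range := by
      rw [Algebra.adjoin_le_iff]
      rintro w (rfl | hw)
      · exact ⟨X 0, by simp⟩
      · exact ⟨X 1, by simpa using (Set.mem_singleton_iff.1 hw).symm⟩
    exact this h1
  obtain ⟨U, hU⟩ := h2
  have h3 : f ∣ pderiv 1 f * U - Polynomial.aeval (X 0) r := by
    rw [hf, ← h.aeval_eq_zero_iff, map_sub, map_mul, ← hf, hU, ← Polynomial.aeval_algHom_apply,
      aeval_X]
    simp only [Matrix.cons_val_zero, hr]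
    field_simp
    ring
  obtain ⟨q, hq⟩ := h3
  have hr0 : r ≠ 0 := by
    rintro rfl
    rw [map_zero] at hr
    exact hd0 (Subtype.ext hr.symm)
  obtain ⟨x₀, hx₀⟩ := Set.Infinite.exists_notMem_finset Set.infinite_univ r.roots.toFinset
  refine ⟨x₀, fun Y => ?_⟩
  by_contra! hc
  refine hx₀.2 ?_
  rw [Multiset.mem_toFinset, Polynomial.mem_roots hr0, Polynomial.IsRoot]
  have h4 := congrArg (aeval ![x₀, Y]) hq
  rw [map_sub, map_mul, map_mul, ← Polynomial.aeval_algHom_apply, aeval_X] at h4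
  have h5 : aeval ![x₀, Y] f = 0 := hc.1
  have h6 : aeval ![x₀, Y] (pderiv 1 f) = 0 := hc.2
  rw [h5, h6] at h4
  simpa using h4

end IsPlaneChart

namespace IrredPlaneCurve

variable (C₀ : IrredPlaneCurve 5)

lemma exists_basis_eval_eq_one :
    ∃ e : Module.Basis (Fin 3) ℂ (Fin 3 → ℂ), eval (e 1) C₀.form = 1 := by
  have h0 : C₀.form ≠ 0 := C₀.irreducible.ne_zero
  obtain ⟨v, hv⟩ : ∃ v, eval v C₀.form ≠ 0 := by
    by_contra! h
    exact h0 (MvPolynomial.funext fun v => by rw [h v, map_zero])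
  -- A fifth root normalizes the value at v to 1, the form having degree 5.
  obtain ⟨c, hc⟩ := IsAlgClosed.exists_pow_nat_eq (eval v C₀.form)⁻¹ (n := 5) (by norm_num)
  have h1 : eval (c • v) C₀.form = 1 := by
    rw [C₀.isHomogeneous.eval_smul_eq, hc, inv_mul_cancel₀ hv]
  have hw : c • v ≠ 0 := by
    intro hw
    have h2 := C₀.isHomogeneous.eval_smul_eq 0 (c • v)
    rw [zero_smul, ← hw, h1] at h2
    norm_num at h2
  obtain ⟨A, hA⟩ := SeparatingDual.exists_continuousLinearEquiv_apply_eq (R := ℂ)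
    (x := (Pi.single 1 1 : Fin 3 → ℂ)) (y := c • v) (by simp) hw
  refine ⟨(Pi.basisFun ℂ (Fin 3)).map A.toLinearEquiv, ?_⟩
  rw [Module.Basis.map_apply, Pi.basisFun_apply]
  change eval (A (Pi.single 1 1)) C₀.form = 1
  rw [hA, h1]

lemma exists_basis_separable :
    ∃ e : Module.Basis (Fin 3) ℂ (Fin 3 → ℂ), eval (e 1) C₀.form = 1 ∧
      (aeval ![1, Polynomial.X, 0] (pullbackForm e C₀.form) : Polynomial ℂ).Separable := by
  obtain ⟨e, he⟩ := C₀.exists_basis_eval_eq_one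
  obtain ⟨x₀, hx₀⟩ := (C₀.isPlaneChart e he).exists_forall_ne_zero
  -- The transversal line x = x₀ becomes the line at infinity: [1:Y:0] in the new basis is the old
  -- affine point (x₀, Y). The vector `e 1` is kept, so [0:1:0] stays off the curve.
  have hli : LinearIndependent ℂ ![x₀ • e 0 + e 2, e 1, e 0] := by
    rw [Fintype.linearIndependent_iff]
    intro g hg
    have h1 := Fintype.linearIndependent_iff.1 e.linearIndependent ![g 0 * x₀ + g 2, g 1, g 0] (by
      rw [← hg]
      simp only [Fin.sum_univ_three, Matrix.cons_val_zero, Matrix.cons_val_one, Matrix.cons_val]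
      module)
    have h2 := h1 0
    have h3 := h1 1
    have h4 := h1 2
    simp at h2 h3 h4
    rw [h4] at h2
    intro i
    fin_cases i
    · exact h4
    · exact h3
    · simpa using h2
  let e' := basisOfLinearIndependentOfCardEqFinrank hli (by simp)
  have he' : ∀ i, e' i = ![x₀ • e 0 + e 2, e 1, e 0] i := fun i => by simp [e']
  have hsum : ∀ Y : ℂ, ∑ j, ![1, Y, 0] j • e' j = ∑ j, ![x₀, Y, 1] j • e j := by
    intro Y
    simp only [Fin.sum_univ_three, he', Matrix.cons_val_zero, Matrix.cons_val_one, Matrix.cons_val]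
    module
  refine ⟨e', by rw [he']; exact he, ?_⟩
  rw [Polynomial.separable_def, Polynomial.isCoprime_iff_aeval_ne_zero_of_isAlgClosed ℂ ℂ]
  intro Y
  have hev : ∀ p : MvPolynomial (Fin 3) ℂ, Polynomial.aeval Y
      (aeval ![1, Polynomial.X, 0] p : Polynomial ℂ) = eval ![1, Y, 0] p := by
    intro p
    have := aeval_aeval_form (R := ℂ) (A := ℂ) p 1 0 Y
    simpa using this
  have hd : Polynomial.derivative (aeval ![1, Polynomial.X, 0] (pullbackForm e' C₀.form) :
      Polynomial ℂ) = aeval ![1, Polynomial.X, 0] (pderiv 1 (pullbackForm e' C₀.form)) := by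
    have := derivative_aeval_form (R := ℂ) (pullbackForm e' C₀.form) 1 0
    simpa using this
  have h1 : eval ![1, Y, 0] (pderiv 1 (pullbackForm e' C₀.form)) =
      eval ![x₀, Y, 1] (pderiv 1 (pullbackForm e C₀.form)) := by
    rw [eval_pderiv_pullbackForm, eval_pderiv_pullbackForm, hsum, he']
    rfl
  rw [hd, hev, hev, h1, eval_pullbackForm, hsum, ← eval_pullbackForm]
  have h2 := hx₀ Y
  rw [pderiv_one_affineEquation, eval_affineEquation] at h2
  have h3 := eval_affineEquation (pderiv 1 (pullbackForm e C₀.form)) ![x₀, Y]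
  rw [affineEquation] at h3
  rw [h3] at h2
  exact h2

/-! ## Singular points in the affine chart -/

section Points

variable (e : Module.Basis (Fin 3) ℂ (Fin 3 → ℂ))

/-- The singular points of the affine chart. -/
def affineSingularSet : Set (Fin 2 → ℂ) :=
  {z | eval z (affineEquation (pullbackForm e C₀.form)) = 0 ∧
    ∀ i, eval z (pderiv i (affineEquation (pullbackForm e C₀.form))) = 0}

/-- A representative of the point with affine coordinates `z`. -/
def affineVector (z : Fin 2 → ℂ) : Fin 3 → ℂ := z 0 • e 0 + z 1 • e 1 + e 2

lemma repr_affineVector (z : Fin 2 → ℂ) (j : Fin 3) :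
    e.repr (affineVector e z) j = ![z 0, z 1, 1] j := by
  fin_cases j <;> simp [affineVector]

lemma affineVector_ne_zero (z : Fin 2 → ℂ) : affineVector e z ≠ 0 := by
  intro h
  have := repr_affineVector e z 2
  rw [h] at this
  simp at this

/-- The point with affine coordinates `z`. -/
def affinePoint (z : Fin 2 → ℂ) : ℙ ℂ (Fin 3 → ℂ) :=
  Projectivization.mk ℂ (affineVector e z) (affineVector_ne_zero e z)

lemma exists_rep_affinePoint (z : Fin 2 → ℂ) :
    ∃ c : ℂ, c ≠ 0 ∧ (affinePoint e z).rep = c • affineVector e z := by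
  obtain ⟨c, hc⟩ := Projectivization.exists_smul_eq_mk_rep ℂ _ (affineVector_ne_zero e z)
  exact ⟨c, c.ne_zero, hc.symm⟩

lemma repr_rep_affinePoint_two_ne_zero (z : Fin 2 → ℂ) : e.repr (affinePoint e z).rep 2 ≠ 0 := by
  obtain ⟨c, hc, h⟩ := exists_rep_affinePoint e z
  rw [h, map_smul, Finsupp.smul_apply, repr_affineVector]
  simpa using hc

lemma repr_rep_affinePoint_div (z : Fin 2 → ℂ) :
    ![e.repr (affinePoint e z).rep 0 / e.repr (affinePoint e z).rep 2,
      e.repr (affinePoint e z).rep 1 / e.repr (affinePoint e z).rep 2] = z := by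
  obtain ⟨c, hc, h⟩ := exists_rep_affinePoint e z
  rw [h, map_smul]
  ext i
  fin_cases i <;> simp [repr_affineVector, hc]

lemma affinePoint_injective : Function.Injective (affinePoint e) := fun z w h => by
  rw [← repr_rep_affinePoint_div e z, h, repr_rep_affinePoint_div]

lemma isSingular_affinePoint {z : Fin 2 → ℂ} (hz : z ∈ C₀.affineSingularSet e) :
    C₀.IsSingular (affinePoint e z) := by
  obtain ⟨c, hc, h⟩ := exists_rep_affinePoint e z
  refine ⟨?_, fun i => ?_⟩
  · rw [h, C₀.isHomogeneous.eval_smul_eq]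
    have h1 := hz.1
    rw [eval_affineEquation, eval_pullbackForm] at h1
    have h2 : ∑ j, ![z 0, z 1, 1] j • e j = affineVector e z := by
      simp [Fin.sum_univ_three, affineVector]
    rw [← h2, h1, mul_zero]
  · rw [h, (C₀.isHomogeneous.pderiv (i := i)).eval_smul_eq]
    have := eval_pderiv_eq_zero_of_affine e C₀.isHomogeneous hz.1 hz.2 i
    rw [affineVector, this, mul_zero]

variable {e}

/-- A singular point on the line at infinity would be a multiple root of the separable restriction
to that line. -/
lemma repr_rep_two_ne_zero
    (hsep : (aeval ![1, Polynomial.X, 0] (pullbackForm e C₀.form) : Polynomial ℂ).Separable)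
    (he : eval (e 1) C₀.form = 1) {p : ℙ ℂ (Fin 3 → ℂ)} (hp : C₀.IsSingular p) :
    e.repr p.rep 2 ≠ 0 := by
  intro h2
  have hrep := e.sum_repr p.rep
  rw [Fin.sum_univ_three, h2, zero_smul, add_zero] at hrep
  set r := e.repr p.rep
  have hr0 : r 0 ≠ 0 := by
    intro h0
    rw [h0, zero_smul, zero_add] at hrep
    have h1 := hp.1
    rw [← hrep, C₀.isHomogeneous.eval_smul_eq, he, mul_one] at h1
    rw [pow_eq_zero_iff (by norm_num)] at h1
    rw [h1, zero_smul] at hrep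
    exact p.rep_nonzero hrep.symm
  rw [Polynomial.separable_def, Polynomial.isCoprime_iff_aeval_ne_zero_of_isAlgClosed ℂ ℂ] at hsep
  have hev : ∀ (q : MvPolynomial (Fin 3) ℂ) (Y : ℂ), Polynomial.aeval Y
      (aeval ![1, Polynomial.X, 0] q : Polynomial ℂ) = eval ![1, Y, 0] q := by
    intro q Y
    have := aeval_aeval_form (R := ℂ) (A := ℂ) q 1 0 Y
    simpa using this
  have hd : Polynomial.derivative (aeval ![1, Polynomial.X, 0] (pullbackForm e C₀.form) :
      Polynomial ℂ) = aeval ![1, Polynomial.X, 0] (pderiv 1 (pullbackForm e C₀.form)) := by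
    have := derivative_aeval_form (R := ℂ) (pullbackForm e C₀.form) 1 0
    simpa using this
  have hvec : ∑ j, ![1, r 1 / r 0, 0] j • e j = (r 0)⁻¹ • p.rep := by
    rw [← hrep, smul_add, smul_smul, smul_smul, inv_mul_cancel₀ hr0]
    simp [Fin.sum_univ_three, div_eq_inv_mul]
  rcases hsep (r 1 / r 0) with h | h
  · apply h
    rw [hev, eval_pullbackForm, hvec, C₀.isHomogeneous.eval_smul_eq, hp.1, mul_zero]
  · apply h
    rw [hd, hev, eval_pderiv_pullbackForm, hvec]
    refine Finset.sum_eq_zero fun i _ => ?_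
    rw [(C₀.isHomogeneous.pderiv (i := i)).eval_smul_eq, hp.2 i, mul_zero, mul_zero]

lemma exists_affinePoint_eq
    (hsep : (aeval ![1, Polynomial.X, 0] (pullbackForm e C₀.form) : Polynomial ℂ).Separable)
    (he : eval (e 1) C₀.form = 1) {p : ℙ ℂ (Fin 3 → ℂ)} (hp : C₀.IsSingular p) :
    ∃ z ∈ C₀.affineSingularSet e, affinePoint e z = p := by
  have h2 := C₀.repr_rep_two_ne_zero hsep he hp
  set r := e.repr p.rep with hr
  let z : Fin 2 → ℂ := ![r 0 / r 2, r 1 / r 2]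
  have hvec : ∑ j, ![z 0, z 1, 1] j • e j = (r 2)⁻¹ • p.rep := by
    rw [← e.sum_repr p.rep, ← hr, Finset.smul_sum]
    simp [Fin.sum_univ_three, div_eq_inv_mul, smul_smul, h2, z]
  have hpd : ∀ i, eval ![z 0, z 1, 1] (pderiv i (pullbackForm e C₀.form)) = 0 := by
    intro i
    rw [eval_pderiv_pullbackForm, hvec]
    refine Finset.sum_eq_zero fun i _ => ?_
    rw [(C₀.isHomogeneous.pderiv (i := i)).eval_smul_eq, hp.2 i, mul_zero, mul_zero]
  refine ⟨z, ⟨?_, fun i => ?_⟩, ?_⟩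
  · rw [eval_affineEquation, eval_pullbackForm, hvec, C₀.isHomogeneous.eval_smul_eq, hp.1, mul_zero]
  · have h3 := fun j => eval_affineEquation (pderiv j (pullbackForm e C₀.form)) z
    simp only [affineEquation] at h3
    fin_cases i
    · simp only [Fin.zero_eta]
      rw [pderiv_zero_affineEquation, h3, hpd]
    · simp only [Fin.mk_one]
      rw [pderiv_one_affineEquation, h3, hpd]
  · rw [affinePoint, ← Projectivization.mk_rep p, Projectivization.mk_eq_mk_iff']
    refine ⟨(r 2)⁻¹, ?_⟩
    rw [← hvec, affineVector]
    simp [Fin.sum_univ_three]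

end Points

/-! ## Counting singular points by type -/

variable {C₀}

lemma HasSingularities.finite {R : ADType →₀ ℕ} (hR : C₀.HasSingularities R) :
    {p | C₀.IsSingular p}.Finite := by
  have hsub : {p | C₀.IsSingular p} ⊆ ⋃ t ∈ R.support,
      {p | C₀.IsSingular p ∧ C₀.HasSingularityAt p t} := by
    intro p hp
    obtain ⟨t, ht⟩ := hR.1 p hp
    refine Set.mem_biUnion (x := t) ?_ ⟨hp, ht⟩
    rw [Finset.mem_coe, Finsupp.mem_support_iff]
    intro h0
    have h1 := hR.2 t
    rw [h0, Nat.cast_zero, Set.encard_eq_zero] at h1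
    exact (Set.eq_empty_iff_forall_notMem.1 h1) p ⟨hp, ht⟩
  refine Set.Finite.subset (Set.Finite.biUnion R.support.finite_toSet fun t _ => ?_) hsub
  exact Set.finite_of_encard_eq_coe (hR.2 t)

/-- Points are grouped by a chosen type τ. Only an inequality is claimed, so the uniqueness of the
type of a singularity is not needed. -/
lemma HasSingularities.sum_le {R : ADType →₀ ℕ} (hR : C₀.HasSingularities R)
    {τ : ℙ ℂ (Fin 3 → ℂ) → ADType} (hτ : ∀ p, C₀.IsSingular p → C₀.HasSingularityAt p (τ p))
    {ι : Type*} (S : Finset ι) (P : ι → ℙ ℂ (Fin 3 → ℂ)) (hP : Function.Injective P)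
    (hS : ∀ z ∈ S, C₀.IsSingular (P z)) (b : ADType → ℕ) :
    ∑ z ∈ S, b (τ (P z)) ≤ R.sum fun t m => b t * m := by
  classical
  have hcard : ∀ t, (S.filter fun z => τ (P z) = t).card ≤ R t := by
    intro t
    have h1 : (((S.filter fun z => τ (P z) = t).image P : Finset _) : Set (ℙ ℂ (Fin 3 → ℂ))) ⊆
        {p | C₀.IsSingular p ∧ C₀.HasSingularityAt p t} := by
      intro p hp
      obtain ⟨z, hz, rfl⟩ := Finset.mem_image.1 (Finset.mem_coe.1 hp)
      obtain ⟨hzS, rfl⟩ := Finset.mem_filter.1 hz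
      exact ⟨hS z hzS, hτ _ (hS z hzS)⟩
    have h2 := Set.encard_le_encard h1
    rw [hR.2 t, Set.encard_coe_eq_coe_finsetCard, Finset.card_image_of_injective _ hP] at h2
    exact_mod_cast h2
  have hmaps : ∀ z ∈ S, τ (P z) ∈ R.support := by
    intro z hz
    rw [Finsupp.mem_support_iff]
    intro h0
    have h1 := hcard (τ (P z))
    rw [h0, Nat.le_zero, Finset.card_eq_zero] at h1
    exact (Finset.eq_empty_iff_forall_notMem.1 h1) z (Finset.mem_filter.2 ⟨hz, rfl⟩)
  rw [← Finset.sum_fiberwise_of_maps_to hmaps, Finsupp.sum]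
  refine Finset.sum_le_sum fun t _ => ?_
  rw [Finset.sum_congr rfl fun z hz => by rw [(Finset.mem_filter.1 hz).2], Finset.sum_const,
    smul_eq_mul, mul_comm]
  exact Nat.mul_le_mul_left _ (hcard t)

end IrredPlaneCurve

/-! ### Comparison of δ with the total Milnor number, and the conclusion -/

lemma ADType.deltaBound_le_milnor (t : ADType) : t.deltaBound ≤ t.milnor := by
  cases t with
  | A l hl => simp only [deltaBound, milnor]; omega
  | D k hk => simp only [deltaBound, milnor]; omega

lemma ADType.eq_A_one_of_milnor_le {t : ADType} (h : t.milnor ≤ t.deltaBound) :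
    t = ADType.A 1 le_rfl := by
  cases t with
  | A l hl =>
    simp only [deltaBound, milnor] at h
    obtain rfl : l = 1 := by omega
    rfl
  | D k hk => simp only [deltaBound, milnor] at h; omega

theorem lemma2p4 (C : IrredPlaneCurve 5) (R : ADType →₀ ℕ) (hR : C.HasSingularities R)
    (hμ : totalMilnor R ≤ 5) :
    1 ≤ C.geometricGenus ∧
      (C.geometricGenus = 1 ↔ R = Finsupp.single (ADType.A 1 le_rfl) 5) := by
  obtain ⟨e, he, hsep⟩ := C.exists_basis_separable
  have hfin : (C.affineSingularSet e).Finite :=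
    Set.Finite.of_finite_image (hR.finite.subset (by
      rintro _ ⟨z, hz, rfl⟩
      exact C.isSingular_affinePoint e hz)) (IrredPlaneCurve.affinePoint_injective e).injOn
  have : Nonempty ADType := ⟨ADType.A 1 le_rfl⟩
  choose! τ hτ using hR.1
  have hsing : ∀ z ∈ hfin.toFinset, C.IsSingular (IrredPlaneCurve.affinePoint e z) := fun z hz =>
    C.isSingular_affinePoint e (hfin.mem_toFinset.1 hz)
  obtain ⟨δ, hδ, hcard, hle⟩ := (C.isPlaneChart e he).functionFieldGenus_bounds hsep hfin.toFinset
    (fun z => hfin.mem_toFinset) (fun z => (τ (IrredPlaneCurve.affinePoint e z)).deltaBound)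
    (fun z hz => by
      have := localBound_of_hasSingularityAt C e (hτ _ (hsing z hz))
        (IrredPlaneCurve.repr_rep_affinePoint_two_ne_zero e z)
      rwa [IrredPlaneCurve.repr_rep_affinePoint_div] at this)
  have hsum := hR.sum_le hτ hfin.toFinset _ (IrredPlaneCurve.affinePoint_injective e) hsing
    ADType.deltaBound
  have hgenus : C.geometricGenus + δ = 6 := hδ
  have hmil : (R.sum fun t m => t.deltaBound * m) ≤ totalMilnor R :=
    Finset.sum_le_sum fun t _ => Nat.mul_le_mul_right _ t.deltaBound_le_milnor
  -- The chain is g + δ = 6 and δ ≤ Σ deltaBound ≤ μ_tot ≤ 5.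
  refine ⟨by omega, fun hg => ?_, fun hR5 => ?_⟩
  -- g = 1 means δ = 5, which forces equality in the chain, hence termwise equality and only nodes.
  · have heq : (R.sum fun t m => t.deltaBound * m) = totalMilnor R := by omega
    have hterm := (Finset.sum_eq_sum_iff_of_le fun t _ =>
      Nat.mul_le_mul_right (R t) t.deltaBound_le_milnor).1 heq
    have hsupp : ∀ t ∈ R.support, t = ADType.A 1 le_rfl := fun t ht =>
      ADType.eq_A_one_of_milnor_le (Nat.le_of_mul_le_mul_right (hterm t ht).ge
        (Nat.pos_of_ne_zero (Finsupp.mem_support_iff.1 ht)))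
    have hRs : R = Finsupp.single (ADType.A 1 le_rfl) (R (ADType.A 1 le_rfl)) := by
      rw [← Finsupp.support_subset_singleton]
      exact fun t ht => Finset.mem_singleton.2 (hsupp t ht)
    have h5 : totalMilnor R = R (ADType.A 1 le_rfl) := by
      rw [hRs, totalMilnor, Finsupp.sum_single_index (by simp)]
      simp [ADType.milnor]
    rw [hRs, ← h5]
    congr 1
    omega
  -- The five nodes are all affine, so δ is at least 5; with δ ≤ 5 this gives g = 1.
  · have h5 := hR.2 (ADType.A 1 le_rfl)
    rw [hR5, Finsupp.single_eq_same] at h5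
    have hsub : {p | C.IsSingular p ∧ C.HasSingularityAt p (ADType.A 1 le_rfl)} ⊆
        IrredPlaneCurve.affinePoint e '' (hfin.toFinset : Set (Fin 2 → ℂ)) := by
      rintro p ⟨hp, -⟩
      obtain ⟨z, hz, rfl⟩ := C.exists_affinePoint_eq hsep he hp
      exact ⟨z, by simpa using hz, rfl⟩
    have h6 := (Set.encard_le_encard hsub).trans (Set.encard_image_le _ _)
    rw [h5, Set.encard_coe_eq_coe_finsetCard] at h6
    have h7 : 5 ≤ hfin.toFinset.card := by exact_mod_cast h6
    omega

end
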